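/- All diagrams are oriented link diagrams in $\mathbb{R}^2$, considered up to isotopy of $\mathbb{R}^2$. A virtual link diagram may have, besides classical crossings, virtual crossings (crossings without over/under information); a twisted link diagram is a virtual link diagram possibly with bars on its arcs. A virtual link is an equivalence class of virtual link diagrams under the classical Reidemeister moves R1, R2, R3 and the virtual Reidemeister moves V1 (removing a curl with a virtual crossing), V2, V3 (the analogues of R2 and R3 with virtual crossings only) and V4 (an arc with two consecutive virtual crossings is moved across a classical crossing). A twisted link is an equivalence class of twisted link diagrams under these moves and the twisted Reidemeister moves T1 (a bar is slid along its arc through a virtual crossing), T2 (two adjacent bars on an arc cancel) and T3 (a classical crossing placed between two virtual crossings of the same two strands, with bars on the four outer ends, is replaced by that classical crossing alone). Two virtual links are equivalent as twisted links if diagrams representing them represent the same twisted link. For a virtual link $L$ with diagram $D$, $s(L)$ is the virtual link represented by the diagram $s(D)$ obtained from $D$ by a reflection along a line in $\mathbb{R}^2$ and switching the over/under information at all classical crossings. A split decomposition $L = L_1 \sqcup \dots \sqcup L_n$ consists of virtual links $L_1,\dots,L_n$ such that some diagram $D$ of $L$ is a union of mutually disjoint non-empty subdiagrams $D_1,\dots,D_n$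 with $D_i$ representing $L_i$. A virtual link is non-splittable if it has no split decomposition with $n\ge 2$, and a split decomposition is maximal if every $L_i$ is non-splittable. (For the empty link, $n=0$ is allowed.) Two virtual links $L$ and $L'$ are $s$-congruent if there are maximal split decompositions $L = L_1 \sqcup \dots \sqcup L_n$ and $L' = L'_1 \sqcup \dots \sqcup L'_n$ such that for each $i$, $L'_i$ is equal, as a virtual link, to $L_i$ or to $s(L_i)$. **Theorem.** Let $L$ and $L'$ be virtual links. Then $L$ and $L'$ are equivalent as twisted links if and only if they are $s$-congruent. -/

import Mathlib

/-!
# Virtual links and twisted links, by plane diagrams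

Diagrams are oriented.  A diagram in the plane, in general position with respect to the height
function, is cut by horizontal lines into chambers, each of which contains vertical strands and
exactly one event: a minimal point, a maximal point, a classical crossing, a virtual crossing
or a bar.  It is recorded as the list of its events from bottom to top.  Isotopies of the plane
are generated by exchanging the heights of two distant events, creating or cancelling a
minimal point against a maximal point, and turning a crossing or a bar through a minimal or a
maximal point.
-/

namespace TwistedLinks

/-- The events of a diagram in general position with respect to the height function.
Directions of strands are Booleans: `true` is upwards, `false` is downwards. -/
inductive Kind where
  /-- A minimal point, whose left leg has direction `d` (and whose right leg has `!d`). -/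
  | cup (d : Bool)
  /-- A maximal point, whose left leg has direction `d` (and whose right leg has `!d`). -/
  | cap (d : Bool)
  /-- A classical crossing of two neighbouring strands; `o = true` says that the strand which
  runs from the lower left to the upper right is the over-strand. -/
  | cross (o : Bool)
  /-- A virtual crossing of two neighbouring strands. -/
  | virt
  /-- A bar on a strand. -/
  | bar

/-- The number of strands that enter an event from below. -/
def Kind.inWidth : Kind → ℕ
  | .cup _ => 0
  | .cap _ => 2
  | .cross _ => 2
  | .virt => 2
  | .bar => 1

/-- The number of strands that leave an event upwards. -/
def Kind.outWidth : Kind → ℕ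
  | .cup _ => 2
  | .cap _ => 0
  | .cross _ => 2
  | .virt => 2
  | .bar => 1

/-- The directions, from left to right, of the strands just below and just above an event. -/
inductive Kind.Acts : Kind → List Bool → List Bool → Prop
  | cup (d : Bool) : Kind.Acts (.cup d) [] [d, !d]
  | cap (d : Bool) : Kind.Acts (.cap d) [d, !d] []
  | cross (o a b : Bool) : Kind.Acts (.cross o) [a, b] [b, a]
  | virt (a b : Bool) : Kind.Acts .virt [a, b] [b, a]
  | bar (a : Bool) : Kind.Acts .bar [a] [a]

/-- A standard piece: an event together with the number `pos` of vertical strands to the left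
of it. -/
structure Piece where
  kind : Kind
  pos : ℕ

/-- A sequence of standard pieces, from bottom to top. -/
abbrev Word := List Piece

/-- `Run w σ τ`: the pieces of `w` fit on top of each other, starting from strands with
directions `σ` at the bottom and ending with strands with directions `τ` at the top. -/
inductive Run : Word → List Bool → List Bool → Prop
  | nil (σ : List Bool) : Run [] σ σ
  | cons (a : Kind) (l m u v τ : List Bool) (w : Word) (h : a.Acts l m)
      (hw : Run w (u ++ m ++ v) τ) : Run (⟨a, u.length⟩ :: w) (u ++ l ++ v) τ

/-- A twisted link diagram. -/
@[ext]
structure TwistedDiagram where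
  word : Word
  closed : Run word [] []

/-- A virtual link diagram: a diagram without bars. -/
@[ext]
structure VirtualDiagram where
  word : Word
  closed : Run word [] []
  noBar : ∀ p ∈ word, p.kind ≠ Kind.bar

/-- Virtual link diagrams are twisted link diagrams. -/
def VirtualDiagram.toTwisted (D : VirtualDiagram) : TwistedDiagram := ⟨D.word, D.closed⟩

/-! ### The pieces, by name -/

/-- A minimal point at position `k`. -/
abbrev cupAt (k : ℕ) (d : Bool) : Piece := ⟨.cup d, k⟩
/-- A maximal point at position `k`. -/
abbrev capAt (k : ℕ) (d : Bool) : Piece := ⟨.cap d, k⟩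
/-- A classical crossing at position `k`. -/
abbrev crossAt (k : ℕ) (o : Bool) : Piece := ⟨.cross o, k⟩
/-- A virtual crossing at position `k`. -/
abbrev virtAt (k : ℕ) : Piece := ⟨.virt, k⟩
/-- A bar at position `k`. -/
abbrev barAt (k : ℕ) : Piece := ⟨.bar, k⟩

/-! ### Isotopy of the plane and the extended Reidemeister moves

Each relation lists the two sides of a local replacement.  Strands may have all directions that
fit, crossings all over/under informations for which the two sides show the same move. -/

/-- Isotopy of the plane. -/
inductive Isotopy : Word → Word → Prop
  /-- Exchanging the heights of two events, the second of which lies to the right of the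
  first. -/
  | exchange (a b : Kind) (k i : ℕ) :
      Isotopy [⟨a, k⟩, ⟨b, k + a.outWidth + i⟩] [⟨b, k + a.inWidth + i⟩, ⟨a, k⟩]
  /-- Straightening a strand which goes up, down and up again. -/
  | zigzag_right (k : ℕ) (d : Bool) : Isotopy [cupAt k d, capAt (k + 1) (!d)] []
  | zigzag_left (k : ℕ) (d : Bool) : Isotopy [cupAt (k + 1) d, capAt k (!d)] []
  /-- Turning a crossing through a minimal or a maximal point of one of its strands. -/
  | cross_cup (k : ℕ) (d o : Bool) :
      Isotopy [cupAt (k + 1) d, crossAt k o] [cupAt k d, crossAt (k + 1) (!o)]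
  | cross_cap (k : ℕ) (d o : Bool) :
      Isotopy [crossAt k o, capAt (k + 1) d] [crossAt (k + 1) (!o), capAt k d]
  | virt_cup (k : ℕ) (d : Bool) :
      Isotopy [cupAt (k + 1) d, virtAt k] [cupAt k d, virtAt (k + 1)]
  | virt_cap (k : ℕ) (d : Bool) :
      Isotopy [virtAt k, capAt (k + 1) d] [virtAt (k + 1), capAt k d]
  /-- Sliding a bar through a minimal or a maximal point. -/
  | bar_cup (k : ℕ) (d : Bool) : Isotopy [cupAt k d, barAt k] [cupAt k d, barAt (k + 1)]
  | bar_cap (k : ℕ) (d : Bool) : Isotopy [barAt k, capAt k d] [barAt (k + 1), capAt k d]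

/-- The classical Reidemeister moves. -/
inductive ClassicalMove : Word → Word → Prop
  /-- A curl on the right, or on the left, of a strand. -/
  | R1_right (k : ℕ) (d o : Bool) :
      ClassicalMove [cupAt (k + 1) d, crossAt k o, capAt (k + 1) d] []
  | R1_left (k : ℕ) (d o : Bool) :
      ClassicalMove [cupAt k d, crossAt (k + 1) o, capAt k d] []
  | R2 (k : ℕ) (o : Bool) : ClassicalMove [crossAt k o, crossAt k (!o)] []
  /-- Here `o₁`, `o₂`, `o₃` say whether the first strand from the left passes over the second,
  the first over the third, the second over the third; the hypothesis says that the three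
  strands are not cyclically above each other. -/
  | R3 (k : ℕ) (o₁ o₂ o₃ : Bool) (h : o₁ = o₃ → o₂ = o₁) :
      ClassicalMove [crossAt k o₁, crossAt (k + 1) o₂, crossAt k o₃]
        [crossAt (k + 1) o₃, crossAt k o₂, crossAt (k + 1) o₁]

/-- The virtual Reidemeister moves. -/
inductive VirtualMove : Word → Word → Prop
  | V1_right (k : ℕ) (d : Bool) : VirtualMove [cupAt (k + 1) d, virtAt k, capAt (k + 1) d] []
  | V1_left (k : ℕ) (d : Bool) : VirtualMove [cupAt k d, virtAt (k + 1), capAt k d] []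
  | V2 (k : ℕ) : VirtualMove [virtAt k, virtAt k] []
  | V3 (k : ℕ) : VirtualMove [virtAt k, virtAt (k + 1), virtAt k]
      [virtAt (k + 1), virtAt k, virtAt (k + 1)]
  /-- A strand with two virtual crossings passes a classical crossing of two other strands:
  the third, the first, or the second strand from the left. -/
  | V4_third (k : ℕ) (o : Bool) : VirtualMove [crossAt k o, virtAt (k + 1), virtAt k]
      [virtAt (k + 1), virtAt k, crossAt (k + 1) o]
  | V4_first (k : ℕ) (o : Bool) : VirtualMove [virtAt k, virtAt (k + 1), crossAt k o]
      [crossAt (k + 1) o, virtAt k, virtAt (k + 1)]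
  | V4_second (k : ℕ) (o : Bool) : VirtualMove [virtAt k, crossAt (k + 1) o, virtAt k]
      [virtAt (k + 1), crossAt k o, virtAt (k + 1)]

/-- The twisted Reidemeister moves. -/
inductive TwistedMove : Word → Word → Prop
  /-- A bar passes a virtual crossing, on either strand. -/
  | T1_left (k : ℕ) : TwistedMove [barAt k, virtAt k] [virtAt k, barAt (k + 1)]
  | T1_right (k : ℕ) : TwistedMove [barAt (k + 1), virtAt k] [virtAt k, barAt k]
  /-- Two consecutive bars cancel. -/
  | T2 (k : ℕ) : TwistedMove [barAt k, barAt k] []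
  /-- A classical crossing between two virtual crossings, with bars on the four ends, is
  replaced by the classical crossing alone. -/
  | T3 (k : ℕ) (o : Bool) : TwistedMove
      [barAt k, barAt (k + 1), virtAt k, crossAt k o, virtAt k, barAt k, barAt (k + 1)]
      [crossAt k o]

/-- The generators of the equivalence of virtual link diagrams. -/
def VirtualRule (l r : Word) : Prop := Isotopy l r ∨ ClassicalMove l r ∨ VirtualMove l r

/-- The generators of the equivalence of twisted link diagrams. -/
def TwistedRule (l r : Word) : Prop := VirtualRule l r ∨ TwistedMove l r

/-- `w'` is obtained from `w` by replacing one side of a rule by the other, somewhere. -/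
def Rewrites (R : Word → Word → Prop) (w w' : Word) : Prop :=
  ∃ u v l r : Word, R l r ∧ w = u ++ l ++ v ∧ w' = u ++ r ++ v

/-- One step, from one virtual link diagram to another. -/
def VirtualDiagram.Step (D D' : VirtualDiagram) : Prop := Rewrites VirtualRule D.word D'.word

/-- One step, from one twisted link diagram to another. -/
def TwistedDiagram.Step (D D' : TwistedDiagram) : Prop := Rewrites TwistedRule D.word D'.word

/-- A virtual link: an equivalence class of virtual link diagrams (for the equivalence relation
generated by `VirtualDiagram.Step`). -/
def VirtualLink : Type := Quot VirtualDiagram.Step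

/-- A twisted link: an equivalence class of twisted link diagrams (for the equivalence relation
generated by `TwistedDiagram.Step`). -/
def TwistedLink : Type := Quot TwistedDiagram.Step

/-- The virtual link represented by a virtual link diagram. -/
def VirtualDiagram.link (D : VirtualDiagram) : VirtualLink := Quot.mk _ D

/-- The natural map from virtual links to twisted links. -/
def VirtualLink.toTwisted : VirtualLink → TwistedLink :=
  Quot.map VirtualDiagram.toTwisted
    (fun _ _ ⟨u, v, l, r, h, h₁, h₂⟩ => ⟨u, v, l, r, Or.inl h, h₁, h₂⟩)

/-! ### Reflection and switching of the crossings -/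

/-- The effect on an event of the reflection of the plane along a horizontal line. -/
def Kind.reflect : Kind → Kind
  | .cup d => .cap (!d)
  | .cap d => .cup (!d)
  | .cross o => .cross (!o)
  | .virt => .virt
  | .bar => .bar

/-- Switching over/under information. -/
def Kind.switch : Kind → Kind
  | .cross o => .cross (!o)
  | a => a

/-- The reflection along a horizontal line turns the sequence of the pieces around. -/
def Word.reflect (w : Word) : Word := (w.map fun p => ⟨p.kind.reflect, p.pos⟩).reverse

/-- Switching over/under information on all classical crossings. -/
def Word.switch (w : Word) : Word := w.map fun p => ⟨p.kind.switch, p.pos⟩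

theorem Run.append {w₁ w₂ : Word} {σ τ ρ : List Bool} (h₁ : Run w₁ σ τ) (h₂ : Run w₂ τ ρ) :
    Run (w₁ ++ w₂) σ ρ := by
  induction h₁ with
  | nil => exact h₂
  | cons a l m u v τ w h _ ih => exact Run.cons a l m u v ρ _ h (ih h₂)

theorem Run.reflect {w : Word} {σ τ : List Bool} (h : Run w σ τ) :
    Run (Word.reflect w) (τ.map (!·)) (σ.map (!·)) := by
  induction h with
  | nil => exact Run.nil _
  | cons a l m u v τ w h _ ih =>
    have h' : a.reflect.Acts (m.map (!·)) (l.map (!·)) := by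
      cases h <;> constructor
    have e := Run.cons a.reflect _ _ (u.map (!·)) (v.map (!·)) _ [] h' (Run.nil _)
    simp only [List.length_map, ← List.map_append] at e
    have := ih.append e
    simpa [Word.reflect] using this

theorem Run.switch {w : Word} {σ τ : List Bool} (h : Run w σ τ) : Run (Word.switch w) σ τ := by
  induction h with
  | nil => exact Run.nil _
  | cons a l m u v τ w h _ ih =>
    have h' : a.switch.Acts l m := by cases h <;> constructor
    exact Run.cons a.switch l m u v τ _ h' ih

/-- The mirror image of a diagram under a reflection along a line. -/
def VirtualDiagram.reflect (D : VirtualDiagram) : VirtualDiagram where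
  word := Word.reflect D.word
  closed := D.closed.reflect
  noBar := by
    intro p hp
    simp only [Word.reflect, List.mem_reverse, List.mem_map] at hp
    obtain ⟨q, hq, rfl⟩ := hp
    have := D.noBar q hq
    cases h : q.kind <;> simp_all [Kind.reflect]

/-- The diagram with over/under information switched on all classical crossings. -/
def VirtualDiagram.switch (D : VirtualDiagram) : VirtualDiagram where
  word := Word.switch D.word
  closed := D.closed.switch
  noBar := by
    intro p hp
    simp only [Word.switch, List.mem_map] at hp
    obtain ⟨q, hq, rfl⟩ := hp
    have := D.noBar q hq
    cases h : q.kind <;> simp_all [Kind.switch]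

/-- `s(D)`: reflect the diagram along a line and switch all classical crossings. -/
def VirtualDiagram.s (D : VirtualDiagram) : VirtualDiagram := D.reflect.switch

theorem s_append (w₁ w₂ : Word) : Word.switch (Word.reflect (w₁ ++ w₂)) =
    Word.switch (Word.reflect w₂) ++ Word.switch (Word.reflect w₁) := by
  simp [Word.switch, Word.reflect]

theorem VirtualRule.s {l r : Word} (h : VirtualRule l r) :
    VirtualRule (Word.switch (Word.reflect l)) (Word.switch (Word.reflect r)) ∨
    VirtualRule (Word.switch (Word.reflect r)) (Word.switch (Word.reflect l)) := by
  rcases h with h | h | h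
  · cases h with
    | exchange a b k i =>
      refine Or.inr (Or.inl ?_)
      have e := Isotopy.exchange a.reflect.switch b.reflect.switch k i
      have h₁ : a.reflect.switch.outWidth = a.inWidth := by cases a <;> rfl
      have h₂ : a.reflect.switch.inWidth = a.outWidth := by cases a <;> rfl
      rw [h₁, h₂] at e
      exact e
    | zigzag_right k d =>
      have e := Isotopy.zigzag_left k d
      exact Or.inl (Or.inl (by simpa [Word.switch, Word.reflect, Kind.switch, Kind.reflect] using e))
    | zigzag_left k d =>
      have e := Isotopy.zigzag_right k d
      exact Or.inl (Or.inl (by simpa [Word.switch, Word.reflect, Kind.switch, Kind.reflect] using e))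
    | cross_cup k d o =>
      have e := Isotopy.cross_cap k (!d) o
      exact Or.inl (Or.inl (by simpa [Word.switch, Word.reflect, Kind.switch, Kind.reflect] using e))
    | cross_cap k d o =>
      have e := Isotopy.cross_cup k (!d) o
      exact Or.inl (Or.inl (by simpa [Word.switch, Word.reflect, Kind.switch, Kind.reflect] using e))
    | virt_cup k d => exact Or.inl (Or.inl (Isotopy.virt_cap k (!d)))
    | virt_cap k d => exact Or.inl (Or.inl (Isotopy.virt_cup k (!d)))
    | bar_cup k d => exact Or.inl (Or.inl (Isotopy.bar_cap k (!d)))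
    | bar_cap k d => exact Or.inl (Or.inl (Isotopy.bar_cup k (!d)))
  · cases h with
    | R1_right k d o =>
      have e := ClassicalMove.R1_right k (!d) o
      exact Or.inl (Or.inr (Or.inl
        (by simpa [Word.switch, Word.reflect, Kind.switch, Kind.reflect] using e)))
    | R1_left k d o =>
      have e := ClassicalMove.R1_left k (!d) o
      exact Or.inl (Or.inr (Or.inl
        (by simpa [Word.switch, Word.reflect, Kind.switch, Kind.reflect] using e)))
    | R2 k o =>
      have e := ClassicalMove.R2 k (!o)
      exact Or.inl (Or.inr (Or.inl
        (by simpa [Word.switch, Word.reflect, Kind.switch, Kind.reflect] using e)))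
    | R3 k o₁ o₂ o₃ h =>
      have e := ClassicalMove.R3 k o₃ o₂ o₁ (fun q => (h q.symm).trans q.symm)
      exact Or.inl (Or.inr (Or.inl
        (by simpa [Word.switch, Word.reflect, Kind.switch, Kind.reflect] using e)))
  · cases h with
    | V1_right k d => exact Or.inl (Or.inr (Or.inr (VirtualMove.V1_right k (!d))))
    | V1_left k d => exact Or.inl (Or.inr (Or.inr (VirtualMove.V1_left k (!d))))
    | V2 k => exact Or.inl (Or.inr (Or.inr (VirtualMove.V2 k)))
    | V3 k => exact Or.inl (Or.inr (Or.inr (VirtualMove.V3 k)))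
    | V4_third k o =>
      have e := VirtualMove.V4_first k o
      exact Or.inl (Or.inr (Or.inr
        (by simpa [Word.switch, Word.reflect, Kind.switch, Kind.reflect] using e)))
    | V4_first k o =>
      have e := VirtualMove.V4_third k o
      exact Or.inl (Or.inr (Or.inr
        (by simpa [Word.switch, Word.reflect, Kind.switch, Kind.reflect] using e)))
    | V4_second k o =>
      have e := VirtualMove.V4_second k o
      exact Or.inl (Or.inr (Or.inr
        (by simpa [Word.switch, Word.reflect, Kind.switch, Kind.reflect] using e)))

theorem VirtualDiagram.link_s_eq {D D' : VirtualDiagram} (h : D.Step D') :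
    D.s.link = D'.s.link := by
  obtain ⟨u, v, l, r, h, h₁, h₂⟩ := h
  have e₁ : D.s.word = Word.switch (Word.reflect v) ++ Word.switch (Word.reflect l) ++
      Word.switch (Word.reflect u) := by
    change Word.switch (Word.reflect D.word) = _
    rw [h₁, s_append, s_append, List.append_assoc]
  have e₂ : D'.s.word = Word.switch (Word.reflect v) ++ Word.switch (Word.reflect r) ++
      Word.switch (Word.reflect u) := by
    change Word.switch (Word.reflect D'.word) = _
    rw [h₂, s_append, s_append, List.append_assoc]
  rcases h.s with h | h
  · exact Quot.sound ⟨_, _, _, _, h, e₁, e₂⟩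
  · exact (Quot.sound ⟨_, _, _, _, h, e₂, e₁⟩).symm

/-- `s(L)`: the virtual link represented by `s(D)`, for any diagram `D` of `L`. -/
def VirtualLink.s : VirtualLink → VirtualLink :=
  Quot.lift (fun D => D.s.link) (fun _ _ h => VirtualDiagram.link_s_eq h)

/-! ### Split decompositions -/

/-- `Splits w σ F`: the strands and events of `w` can be coloured, continuing the colours of the
strands `σ` at the bottom, such that events involve strands of one colour only (connected arcs
have one colour, and arcs of different colours are disjoint) and such that, for every colour
`i`, the part of colour `i` has the sequence of pieces `F i`. -/
inductive Splits {ι : Type} [DecidableEq ι] : Word → List (ι × Bool) → (ι → Word) → Prop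
  | nil : Splits [] [] (fun _ => [])
  | cons (a : Kind) (c : ι) (l m : List Bool) (u v : List (ι × Bool)) (w : Word) (F : ι → Word)
      (h : a.Acts l m) (hw : Splits w (u ++ m.map (fun d => (c, d)) ++ v) F) :
      Splits (⟨a, u.length⟩ :: w) (u ++ l.map (fun d => (c, d)) ++ v)
        (Function.update F c (⟨a, (u.filter fun x => x.1 = c).length⟩ :: F c))

/-- The diagram `D` is the union of the mutually disjoint, non-empty subdiagrams `E i`. -/
def VirtualDiagram.IsSplit {n : ℕ} (D : VirtualDiagram) (E : Fin n → VirtualDiagram) : Prop :=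
  Splits D.word [] (fun i => (E i).word) ∧ ∀ i, (E i).word ≠ []

/-- `L = A 0 ⊔ ⋯ ⊔ A (n - 1)` is a split decomposition of the virtual link `L`. -/
def VirtualLink.IsSplit {n : ℕ} (L : VirtualLink) (A : Fin n → VirtualLink) : Prop :=
  ∃ (D : VirtualDiagram) (E : Fin n → VirtualDiagram),
    D.link = L ∧ (∀ i, (E i).link = A i) ∧ D.IsSplit E

/-- The virtual link `L` is splittable. -/
def VirtualLink.Splittable (L : VirtualLink) : Prop :=
  ∃ (n : ℕ) (A : Fin n → VirtualLink), 2 ≤ n ∧ L.IsSplit A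

/-- `L = A 0 ⊔ ⋯ ⊔ A (n - 1)` is a maximal split decomposition. -/
def VirtualLink.IsMaximalSplit {n : ℕ} (L : VirtualLink) (A : Fin n → VirtualLink) : Prop :=
  L.IsSplit A ∧ ∀ i, ¬ (A i).Splittable

/-- Two virtual links are s-congruent. -/
def VirtualLink.SCongruent (L L' : VirtualLink) : Prop :=
  ∃ (n : ℕ) (A A' : Fin n → VirtualLink), L.IsMaximalSplit A ∧ L'.IsMaximalSplit A' ∧
    ∀ i, A' i = A i ∨ A' i = (A i).s

end TwistedLinks

/-! From s-congruence to twisted equivalence. A layer of bars across all strands can be pushed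
through a diagram without bars (`bars_run`): two bars cancel at an extremal point, T1 takes them
through virtual crossings, and T3 takes them through a classical crossing at the price of placing it
between two virtual crossings. In a closed diagram `D` the layers at both ends are empty, so `D` is
twisted equivalent to `virtConj` of it, in which every classical crossing is conjugated by virtual
ones. Virtual moves alone turn this diagram into `s(D)` (`virtConj_eqv_sWord`). A split diagram is
equivalent to the stack of its parts (`Splits.eqv_flatten`), so parts can be replaced one by one.

From twisted equivalence to s-congruence. Strands get labels `(i, b)`, where `i` is a part of the
split diagram and `b` a sheet; a bar changes the sheet. A labelled diagram has an image without bars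
for each `i`: only strands of part `i` are kept, crossings between different sheets become virtual,
crossings on sheet `false` stay, and crossings on sheet `true` are conjugated by virtual crossings.
Every move, including the twisted ones, carries the labels along and changes the images by virtual
moves only (`Eqv.transport`); this plays the role of a double covering.

Let `D` with non-splittable parts `E i` be twisted equivalent to `D'` with parts `E' j`. With all
labels of `D` on sheet `false`, the image for `i` is `E i`. On `D'` the same image falls apart, by
virtual moves, into pieces of one sheet and one colour `j` (`Img.separate_colours`). As `E i` is
non-splittable, exactly one piece is non-empty, for a sheet `β i` and a colour `J i`
(`exists_pieces`). Every `E' j` is non-empty, so `J` is surjective. By symmetry both decompositions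
have the same number of parts, `J` is bijective, and `E' (J i)` consists of a single piece. Hence `E
i` is `E' (J i)` or its conjugate, which is `s(E' (J i))`.

Maximal decompositions exist because labels bound the number of parts by the number of events of any
fixed diagram (`Splits.card_le`). -/

namespace TwistedLinks

section

/-! ### Words with strands added to the left, and the computation of `Run` -/

/-- The word `w` with `n` vertical strands added to the left. -/
def shift (n : ℕ) (w : Word) : Word := w.map fun p => ⟨p.kind, n + p.pos⟩

@[simp] theorem shift_nil (n : ℕ) : shift n [] = [] := rfl

@[simp] theorem shift_cons (n : ℕ) (p : Piece) (w : Word) :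
    shift n (p :: w) = ⟨p.kind, n + p.pos⟩ :: shift n w := rfl

@[simp] theorem shift_append (n : ℕ) (w w' : Word) :
    shift n (w ++ w') = shift n w ++ shift n w' := by simp [shift]

@[simp] theorem shift_zero (w : Word) : shift 0 w = w := by simp [shift]

theorem shift_shift (m n : ℕ) (w : Word) : shift m (shift n w) = shift (m + n) w := by
  simp [shift, Nat.add_assoc]

@[simp] theorem shift_eq_nil {n : ℕ} {w : Word} : shift n w = [] ↔ w = [] := by simp [shift]

/-- The effect of an event on the directions of the strands, the event being leftmost. -/
def Kind.act : Kind → List Bool → Option (List Bool)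
  | .cup d, s => some (d :: (!d) :: s)
  | .cap d, a :: b :: s => if a = d ∧ b = !d then some s else none
  | .cross _, a :: b :: s => some (b :: a :: s)
  | .virt, a :: b :: s => some (b :: a :: s)
  | .bar, a :: s => some (a :: s)
  | _, _ => none

/-- The effect of an event at position `k` on the directions of the strands. -/
def Kind.actAt (a : Kind) : ℕ → List Bool → Option (List Bool)
  | 0, s => a.act s
  | _ + 1, [] => none
  | k + 1, x :: s => (a.actAt k s).map (x :: ·)

/-- The directions at the top of a word, computed from the directions at the bottom. -/
def run : Word → List Bool → Option (List Bool)
  | [], σ => some σ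
  | p :: w, σ => (p.kind.actAt p.pos σ).bind (run w)

theorem Kind.Acts.actAt {a : Kind} {l m : List Bool} (h : a.Acts l m) (u v : List Bool) :
    a.actAt u.length (u ++ l ++ v) = some (u ++ m ++ v) := by
  induction u with
  | nil => cases h <;> simp [Kind.actAt, Kind.act]
  | cons x u ih => simpa [Kind.actAt] using ih

theorem Kind.exists_acts {a : Kind} {k : ℕ} {σ τ : List Bool} (h : a.actAt k σ = some τ) :
    ∃ l m u v, a.Acts l m ∧ u.length = k ∧ σ = u ++ l ++ v ∧ τ = u ++ m ++ v := by
  induction k generalizing σ τ with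
  | zero =>
    cases a with
    | cup d =>
      simp only [Kind.actAt, Kind.act, Option.some.injEq] at h
      exact ⟨[], _, [], σ, .cup d, rfl, by simp, by simp [← h]⟩
    | cap d =>
      match σ, h with
      | x :: y :: s, h =>
        simp only [Kind.actAt, Kind.act, Option.ite_none_right_eq_some, Option.some.injEq] at h
        obtain ⟨⟨rfl, rfl⟩, rfl⟩ := h
        exact ⟨_, [], [], s, .cap x, rfl, by simp, by simp⟩
    | cross o =>
      match σ, h with
      | x :: y :: s, h =>
        simp only [Kind.actAt, Kind.act, Option.some.injEq] at h
        exact ⟨_, _, [], s, .cross o x y, rfl, by simp, by simp [← h]⟩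
    | virt =>
      match σ, h with
      | x :: y :: s, h =>
        simp only [Kind.actAt, Kind.act, Option.some.injEq] at h
        exact ⟨_, _, [], s, .virt x y, rfl, by simp, by simp [← h]⟩
    | bar =>
      match σ, h with
      | x :: s, h =>
        simp only [Kind.actAt, Kind.act, Option.some.injEq] at h
        exact ⟨_, _, [], s, .bar x, rfl, by simp, by simp [← h]⟩
  | succ k ih =>
    match σ, h with
    | x :: s, h =>
      simp only [Kind.actAt, Option.map_eq_some_iff] at h
      obtain ⟨t, ht, rfl⟩ := h
      obtain ⟨l, m, u, v, ha, rfl, rfl, rfl⟩ := ih ht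
      exact ⟨l, m, x :: u, v, ha, rfl, rfl, rfl⟩

/-- Turns the relation into a computation, so that the ends of concrete words are settled by `simp`
or `decide`. -/
theorem run_iff {w : Word} {σ τ : List Bool} : Run w σ τ ↔ run w σ = some τ := by
  constructor
  · intro h
    induction h with
    | nil => rfl
    | cons a l m u v τ w h _ ih =>
      rw [run, h.actAt u v]
      exact ih
  · intro h
    induction w generalizing σ with
    | nil =>
      simp only [run, Option.some.injEq] at h
      exact h ▸ .nil _
    | cons p w ih =>
      obtain ⟨a, k⟩ := p
      simp only [run, Option.bind_eq_some_iff] at h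
      obtain ⟨ρ, h₁, h₂⟩ := h
      obtain ⟨l, m, u, v, ha, rfl, rfl, rfl⟩ := Kind.exists_acts h₁
      exact .cons a l m u v τ w ha (ih h₂)

theorem Run.unique {w : Word} {σ τ τ' : List Bool} (h : Run w σ τ) (h' : Run w σ τ') : τ = τ' := by
  rw [run_iff] at h h'
  simpa [h] using h'

theorem map_not_injective : Function.Injective (List.map (!·)) :=
  List.map_injective_iff.2 fun a b h => by simpa using h

/-- The reflection exchanges bottom and top, which reduces this to uniqueness at the top. -/
theorem Run.unique_bot {w : Word} {σ σ' τ : List Bool} (h : Run w σ τ) (h' : Run w σ' τ) :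
    σ = σ' := map_not_injective (h.reflect.unique h'.reflect)

theorem run_append {w w' : Word} {σ τ : List Bool} :
    Run (w ++ w') σ τ ↔ ∃ ρ, Run w σ ρ ∧ Run w' ρ τ := by
  constructor
  · intro h
    induction w generalizing σ with
    | nil => exact ⟨σ, .nil _, h⟩
    | cons p w ih =>
      cases h with
      | cons a l m u v τ w h hw =>
        obtain ⟨ρ, h₁, h₂⟩ := ih hw
        exact ⟨ρ, .cons a l m u v _ w h h₁, h₂⟩
  · rintro ⟨ρ, h₁, h₂⟩
    exact h₁.append h₂

theorem Run.tail {w : Word} {σ τ : List Bool} (h : Run w σ τ) (ρ : List Bool) :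
    Run w (σ ++ ρ) (τ ++ ρ) := by
  induction h with
  | nil => exact .nil _
  | cons a l m u v τ w h _ ih =>
    have := Run.cons a l m u (v ++ ρ) (τ ++ ρ) w h (by simpa using ih)
    simpa using this

theorem Run.shift {w : Word} {σ τ : List Bool} (h : Run w σ τ) (ρ : List Bool) :
    Run (shift ρ.length w) (ρ ++ σ) (ρ ++ τ) := by
  induction h with
  | nil => exact .nil _
  | cons a l m u v τ w h _ ih =>
    have := Run.cons a l m (ρ ++ u) v (ρ ++ τ) _ h (by simpa using ih)
    simpa using this

theorem Run.single {a : Kind} {l m : List Bool} (h : a.Acts l m) (u v : List Bool) :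
    Run [⟨a, u.length⟩] (u ++ l ++ v) (u ++ m ++ v) := .cons a l m u v _ _ h (.nil _)

/-! ### Equivalence of words with given ends -/

/-- Equivalence of words from `σ` to `τ` generated by the replacements `R`. -/
def Eqv (R : Word → Word → Prop) (σ τ : List Bool) : Word → Word → Prop :=
  Relation.EqvGen fun w w' => Run w σ τ ∧ Run w' σ τ ∧ Rewrites R w w'

namespace Eqv

variable {R R' : Word → Word → Prop} {σ τ ρ π : List Bool} {w w' w'' : Word}

@[refl] theorem refl (w : Word) : Eqv R σ τ w w := Relation.EqvGen.refl _

theorem of_eq (h : w = w') : Eqv R σ τ w w' := h ▸ refl w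

@[symm] theorem symm (h : Eqv R σ τ w w') : Eqv R σ τ w' w := Relation.EqvGen.symm _ _ h

@[trans] theorem trans (h : Eqv R σ τ w w') (h' : Eqv R σ τ w' w'') : Eqv R σ τ w w'' :=
  Relation.EqvGen.trans _ _ _ h h'

theorem run_iff (h : Eqv R σ τ w w') : Run w σ τ ↔ Run w' σ τ := by
  induction h with
  | rel _ _ h => exact iff_of_true h.1 h.2.1
  | refl => rfl
  | symm _ _ _ ih => exact ih.symm
  | trans _ _ _ _ _ ih₁ ih₂ => exact ih₁.trans ih₂

theorem map {σ' τ' : List Bool} (f : Word → Word)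
    (hf : ∀ w w', Run w σ τ → Run w' σ τ → Rewrites R w w' → Eqv R' σ' τ' (f w) (f w'))
    (h : Eqv R σ τ w w') : Eqv R' σ' τ' (f w) (f w') := by
  induction h with
  | rel _ _ h => exact hf _ _ h.1 h.2.1 h.2.2
  | refl => exact refl _
  | symm _ _ _ ih => exact ih.symm
  | trans _ _ _ _ _ ih₁ ih₂ => exact ih₁.trans ih₂

theorem mono (hR : ∀ l r, R l r → R' l r) (h : Eqv R σ τ w w') : Eqv R' σ τ w w' :=
  h.map id fun _ _ h₁ h₂ ⟨u, v, l, r, h, e, e'⟩ => .rel _ _ ⟨h₁, h₂, u, v, l, r, hR _ _ h, e, e'⟩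

/-- Stacking words below and on top. -/
theorem comp {u v : Word} (hu : Run u ρ σ) (hv : Run v τ π) (h : Eqv R σ τ w w') :
    Eqv R ρ π (u ++ w ++ v) (u ++ w' ++ v) :=
  h.map (fun w => u ++ w ++ v) fun _ _ h₁ h₂ ⟨x, y, l, r, h, e, e'⟩ =>
    .rel _ _ ⟨(hu.append h₁).append hv, (hu.append h₂).append hv, u ++ x, y ++ v, l, r, h,
      by simp [e], by simp [e']⟩

theorem append_left {u : Word} (hu : Run u ρ σ) (h : Eqv R σ τ w w') :
    Eqv R ρ τ (u ++ w) (u ++ w') := by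
  simpa using h.comp hu (.nil _)

theorem append_right {v : Word} (hv : Run v τ π) (h : Eqv R σ τ w w') :
    Eqv R σ π (w ++ v) (w' ++ v) := by
  simpa using h.comp (.nil _) hv

theorem append {v v' : Word} (h : Eqv R σ τ w w') (h' : Eqv R τ ρ v v') (hw : Run w σ τ)
    (hv : Run v τ ρ) : Eqv R σ ρ (w ++ v) (w' ++ v') :=
  (h.append_right hv).trans (h'.append_left (h.run_iff.1 hw))

/-- Adding strands to the right. -/
theorem tail (h : Eqv R σ τ w w') (ρ : List Bool) : Eqv R (σ ++ ρ) (τ ++ ρ) w w' :=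
  h.map id fun _ _ h₁ h₂ h => .rel _ _ ⟨h₁.tail ρ, h₂.tail ρ, h⟩

/-- Adding strands to the left. -/
theorem shift_of_rule (hR : ∀ n l r, R l r → R (shift n l) (shift n r)) (h : Eqv R σ τ w w')
    (ρ : List Bool) :
    Eqv R (ρ ++ σ) (ρ ++ τ) (TwistedLinks.shift ρ.length w) (TwistedLinks.shift ρ.length w') :=
  h.map _ fun _ _ h₁ h₂ ⟨x, y, l, r, h, e, e'⟩ =>
    .rel _ _ ⟨h₁.shift ρ, h₂.shift ρ, _, _, _, _, hR _ _ _ h, by rw [e]; simp; rfl, by rw [e']; simp⟩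

end Eqv

/-! ### Shifting the rules -/

theorem VirtualRule.shift (n : ℕ) (l r : Word) (h : VirtualRule l r) :
    VirtualRule (shift n l) (shift n r) := by
  rcases h with h | h | h
  · refine Or.inl ?_
    cases h with
    | exchange a b k i =>
      have := Isotopy.exchange a b (n + k) i
      simpa [Nat.add_assoc] using this
    | zigzag_right k d => exact .zigzag_right (n + k) d
    | zigzag_left k d => exact .zigzag_left (n + k) d
    | cross_cup k d o => exact .cross_cup (n + k) d o
    | cross_cap k d o => exact .cross_cap (n + k) d o
    | virt_cup k d => exact .virt_cup (n + k) d
    | virt_cap k d => exact .virt_cap (n + k) d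
    | bar_cup k d => exact .bar_cup (n + k) d
    | bar_cap k d => exact .bar_cap (n + k) d
  · refine Or.inr (Or.inl ?_)
    cases h with
    | R1_right k d o => exact .R1_right (n + k) d o
    | R1_left k d o => exact .R1_left (n + k) d o
    | R2 k o => exact .R2 (n + k) o
    | R3 k o₁ o₂ o₃ h => exact .R3 (n + k) o₁ o₂ o₃ h
  · refine Or.inr (Or.inr ?_)
    cases h with
    | V1_right k d => exact .V1_right (n + k) d
    | V1_left k d => exact .V1_left (n + k) d
    | V2 k => exact .V2 (n + k)
    | V3 k => exact .V3 (n + k)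
    | V4_third k o => exact .V4_third (n + k) o
    | V4_first k o => exact .V4_first (n + k) o
    | V4_second k o => exact .V4_second (n + k) o

theorem TwistedRule.shift (n : ℕ) (l r : Word) (h : TwistedRule l r) :
    TwistedRule (shift n l) (shift n r) := by
  rcases h with h | h
  · exact Or.inl (h.shift n)
  · refine Or.inr ?_
    cases h with
    | T1_left k => exact .T1_left (n + k)
    | T1_right k => exact .T1_right (n + k)
    | T2 k => exact .T2 (n + k)
    | T3 k o => exact .T3 (n + k) o

/-- Equivalence of words by isotopy and the classical and virtual moves. -/
abbrev VEqv := Eqv VirtualRule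

/-- Equivalence of words by isotopy and the classical, virtual and twisted moves. -/
abbrev TEqv := Eqv TwistedRule

variable {σ τ ρ π : List Bool} {w w' : Word}

theorem Eqv.shift (h : VEqv σ τ w w') (ρ : List Bool) :
    VEqv (ρ ++ σ) (ρ ++ τ) (TwistedLinks.shift ρ.length w) (TwistedLinks.shift ρ.length w') :=
  Eqv.shift_of_rule VirtualRule.shift h ρ

theorem Eqv.shift_twisted (h : TEqv σ τ w w') (ρ : List Bool) :
    TEqv (ρ ++ σ) (ρ ++ τ) (TwistedLinks.shift ρ.length w) (TwistedLinks.shift ρ.length w') :=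
  Eqv.shift_of_rule TwistedRule.shift h ρ

theorem Eqv.twisted (h : VEqv σ τ w w') : TEqv σ τ w w' := h.mono fun _ _ => Or.inl

/-! ### Exchanging the heights of distant words -/

theorem interchange_single {a b : Kind} {l m l' m' : List Bool} (ha : a.Acts l m)
    (hb : b.Acts l' m') (u v u' v' : List Bool) :
    VEqv (u ++ l ++ v ++ (u' ++ l' ++ v')) (u ++ m ++ v ++ (u' ++ m' ++ v'))
      ([⟨a, u.length⟩] ++ shift (u ++ m ++ v).length [⟨b, u'.length⟩])
      (shift (u ++ l ++ v).length [⟨b, u'.length⟩] ++ [⟨a, u.length⟩]) := by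
  have hl : l.length = a.inWidth := by cases ha <;> rfl
  have hm : m.length = a.outWidth := by cases ha <;> rfl
  refine .rel _ _ ⟨((Run.single ha u v).tail _).append ((Run.single hb u' v').shift _),
    ((Run.single hb u' v').shift _).append ((Run.single ha u v).tail _), [], [], _, _,
    -- The rule counts strands from the right end of the first event: between the two events lie `v`
    -- and `u'`.
    Or.inl (Isotopy.exchange a b u.length (v.length + u'.length)), ?_, ?_⟩
  · simp [hm, Nat.add_assoc]
  · simp [hl, Nat.add_assoc]

/-- Two words next to each other can be stacked in either order. -/
theorem interchange {p q : Word} (hp : Run p σ τ) (hq : Run q ρ π) :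
    VEqv (σ ++ ρ) (τ ++ π) (p ++ shift τ.length q) (shift σ.length q ++ p) := by
  induction hp generalizing ρ π q with
  | nil => simpa using Eqv.refl _
  | cons a l m u v τ p ha hp ih =>
    -- The outer induction takes one event off `p`; the inner one moves this event past all of `q`.
    have key : VEqv (u ++ l ++ v ++ ρ) (u ++ m ++ v ++ π)
        ([⟨a, u.length⟩] ++ shift (u ++ m ++ v).length q)
        (shift (u ++ l ++ v).length q ++ [⟨a, u.length⟩]) := by
      clear ih
      induction hq with
      | nil => simpa using Eqv.refl _
      | cons b l' m' u' v' π q hb hq ih =>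
        have h₁ := (interchange_single ha hb u v u' v').append_right (hq.shift (u ++ m ++ v))
        have h₂ := ih.append_left ((Run.single hb u' v').shift (u ++ l ++ v))
        refine Eqv.trans ?_ (h₂.trans ?_)
        · simpa using h₁
        · simpa using Eqv.refl _
    have h₁ := (ih hq).append_left ((Run.single ha u v).tail ρ)
    have h₂ := key.append_right (hp.tail π)
    simpa using h₁.trans (by simpa using h₂)

/-! ### Links as classes of words -/

/-- The isotopies may move bars, but without the twisted moves bars neither appear nor vanish. So
all words along a virtual equivalence between virtual diagrams are free of bars. -/
theorem VirtualRule.bar_mem_iff {l r : Word} (h : VirtualRule l r) :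
    (∃ p ∈ l, p.kind = Kind.bar) ↔ ∃ p ∈ r, p.kind = Kind.bar := by
  rcases h with h | h | h <;> cases h <;> simp [or_comm]

theorem Rewrites.bar_mem_iff {w w' : Word} (h : Rewrites VirtualRule w w') :
    (∃ p ∈ w, p.kind = Kind.bar) ↔ ∃ p ∈ w', p.kind = Kind.bar := by
  obtain ⟨u, v, l, r, h, rfl, rfl⟩ := h
  have := h.bar_mem_iff
  simp only [List.mem_append, or_and_right, exists_or, this]

theorem Eqv.noBar_iff (h : VEqv σ τ w w') :
    (∀ p ∈ w, p.kind ≠ Kind.bar) ↔ ∀ p ∈ w', p.kind ≠ Kind.bar := by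
  induction h with
  | rel _ _ h => have := h.2.2.bar_mem_iff; grind
  | refl => rfl
  | symm _ _ _ ih => exact ih.symm
  | trans _ _ _ _ _ ih₁ ih₂ => exact ih₁.trans ih₂

theorem VirtualDiagram.link_eq_iff {D D' : VirtualDiagram} :
    D.link = D'.link ↔ VEqv [] [] D.word D'.word := by
  constructor
  · intro h
    have := Quot.eqvGen_exact h
    clear h
    induction this with
    | rel D D' h => exact .rel _ _ ⟨D.closed, D'.closed, h⟩
    | refl => exact .refl _
    | symm _ _ _ ih => exact ih.symm
    | trans _ _ _ _ _ ih₁ ih₂ => exact ih₁.trans ih₂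
  · intro h
    have key : ∀ w w', VEqv [] [] w w' → ∀ D D' : VirtualDiagram, D.word = w → D'.word = w' →
        D.link = D'.link := by
      intro w w' h
      induction h with
      | rel w w' h => rintro D D' rfl rfl; exact Quot.sound h.2.2
      | refl w => rintro D D' rfl h; rw [VirtualDiagram.ext h]
      | symm _ _ _ ih => intro D D' h h'; exact (ih D' D h' h).symm
      | trans w₁ w₂ w₃ h₁ h₂ ih₁ ih₂ =>
        rintro D D' rfl h'
        have e : VEqv [] [] D.word w₂ := h₁
        -- The intermediate word is again a virtual diagram, since being closed and having no bars
        -- are both invariant.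
        let M : VirtualDiagram := ⟨w₂, e.run_iff.1 D.closed, e.noBar_iff.1 D.noBar⟩
        exact (ih₁ D M rfl rfl).trans (ih₂ M D' rfl h')
    exact key _ _ h _ _ rfl rfl

theorem VirtualDiagram.toTwisted_eq_iff {D D' : VirtualDiagram} :
    D.link.toTwisted = D'.link.toTwisted ↔ TEqv [] [] D.word D'.word := by
  have aux : ∀ D D' : TwistedDiagram, (Quot.mk _ D : TwistedLink) = Quot.mk _ D' ↔
      TEqv [] [] D.word D'.word := by
    intro D D'
    constructor
    · intro h
      have := Quot.eqvGen_exact h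
      clear h
      induction this with
      | rel D D' h => exact .rel _ _ ⟨D.closed, D'.closed, h⟩
      | refl => exact .refl _
      | symm _ _ _ ih => exact ih.symm
      | trans _ _ _ _ _ ih₁ ih₂ => exact ih₁.trans ih₂
    · intro h
      have key : ∀ w w', TEqv [] [] w w' → ∀ D D' : TwistedDiagram, D.word = w → D'.word = w' →
          (Quot.mk _ D : TwistedLink) = Quot.mk _ D' := by
        intro w w' h
        induction h with
        | rel w w' h => rintro D D' rfl rfl; exact Quot.sound h.2.2
        | refl w => rintro D D' rfl h; rw [TwistedDiagram.ext h]
        | symm _ _ _ ih => intro D D' h h'; exact (ih D' D h' h).symm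
        | trans w₁ w₂ w₃ h₁ h₂ ih₁ ih₂ =>
          rintro D D' rfl h'
          have e : TEqv [] [] D.word w₂ := h₁
          let M : TwistedDiagram := ⟨w₂, e.run_iff.1 D.closed⟩
          exact (ih₁ D M rfl rfl).trans (ih₂ M D' rfl h')
      exact key _ _ h _ _ rfl rfl
  exact aux D.toTwisted D'.toTwisted

end

end TwistedLinks

namespace TwistedLinks

section

/-! ### A checker for chains of moves -/

/-- Equality of events, as a Boolean. -/
def Kind.beq : Kind → Kind → Bool
  | .cup d, .cup e => d == e
  | .cap d, .cap e => d == e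
  | .cross d, .cross e => d == e
  | .virt, .virt => true
  | .bar, .bar => true
  | _, _ => false

theorem Kind.eq_of_beq {a b : Kind} (h : a.beq b = true) : a = b := by
  cases a <;> cases b <;> simp_all [Kind.beq]

theorem Piece.eq_of_beq {p q : Piece} (h : p.kind.beq q.kind = true) (h' : p.pos = q.pos) :
    p = q := by
  cases p
  cases q
  obtain rfl := Kind.eq_of_beq h
  obtain rfl : _ = _ := h'
  rfl

/-- Equality of words, as a Boolean. -/
def wordBeq : Word → Word → Bool
  | [], [] => true
  | p :: w, q :: w' => p.kind.beq q.kind && p.pos == q.pos && wordBeq w w'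
  | _, _ => false

theorem eq_of_wordBeq {w w' : Word} (h : wordBeq w w' = true) : w = w' := by
  induction w generalizing w' with
  | nil => cases w' <;> simp_all [wordBeq]
  | cons p w ih =>
    cases w' with
    | nil => simp [wordBeq] at h
    | cons q w' =>
      simp only [wordBeq, Bool.and_eq_true, beq_iff_eq] at h
      obtain ⟨⟨h₁, h₂⟩, h₃⟩ := h
      rw [ih h₃, Piece.eq_of_beq h₁ h₂]

/-- The rules without bars at position `k`, except for exchanges. -/
def ruleTable (k : ℕ) (d o o' : Bool) : List (Word × Word) :=
  [([cupAt k d, capAt (k + 1) (!d)], []), ([cupAt (k + 1) d, capAt k (!d)], []),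
    ([cupAt (k + 1) d, crossAt k o], [cupAt k d, crossAt (k + 1) (!o)]),
    ([crossAt k o, capAt (k + 1) d], [crossAt (k + 1) (!o), capAt k d]),
    ([cupAt (k + 1) d, virtAt k], [cupAt k d, virtAt (k + 1)]),
    ([virtAt k, capAt (k + 1) d], [virtAt (k + 1), capAt k d]),
    ([cupAt (k + 1) d, crossAt k o, capAt (k + 1) d], []),
    ([cupAt k d, crossAt (k + 1) o, capAt k d], []),
    ([crossAt k o, crossAt k (!o)], []),
    -- The hypothesis of `R3` means `o₂ = o₁` or `o₃ ≠ o₁`; this row and the next are these two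
    -- overlapping families.
    ([crossAt k o, crossAt (k + 1) o, crossAt k o'],
      [crossAt (k + 1) o', crossAt k o, crossAt (k + 1) o]),
    ([crossAt k o, crossAt (k + 1) o', crossAt k (!o)],
      [crossAt (k + 1) (!o), crossAt k o', crossAt (k + 1) o]),
    ([cupAt (k + 1) d, virtAt k, capAt (k + 1) d], []),
    ([cupAt k d, virtAt (k + 1), capAt k d], []),
    ([virtAt k, virtAt k], []),
    ([virtAt k, virtAt (k + 1), virtAt k], [virtAt (k + 1), virtAt k, virtAt (k + 1)]),
    ([crossAt k o, virtAt (k + 1), virtAt k], [virtAt (k + 1), virtAt k, crossAt (k + 1) o]),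
    ([virtAt k, virtAt (k + 1), crossAt k o], [crossAt (k + 1) o, virtAt k, virtAt (k + 1)]),
    ([virtAt k, crossAt (k + 1) o, virtAt k], [virtAt (k + 1), crossAt k o, virtAt (k + 1)])]

theorem virtualRule_of_mem_ruleTable {k : ℕ} {d o o' : Bool} {p : Word × Word}
    (hp : p ∈ ruleTable k d o o') : VirtualRule p.1 p.2 := by
  simp only [ruleTable, List.mem_cons, List.not_mem_nil, or_false] at hp
  rcases hp with rfl | rfl | rfl | rfl | rfl | rfl | rfl | rfl | rfl | rfl | rfl | rfl | rfl |
    rfl | rfl | rfl | rfl | rfl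
  · exact .inl (.zigzag_right k d)
  · exact .inl (.zigzag_left k d)
  · exact .inl (.cross_cup k d o)
  · exact .inl (.cross_cap k d o)
  · exact .inl (.virt_cup k d)
  · exact .inl (.virt_cap k d)
  · exact .inr (.inl (.R1_right k d o))
  · exact .inr (.inl (.R1_left k d o))
  · exact .inr (.inl (.R2 k o))
  · exact .inr (.inl (.R3 k o o o' fun _ => rfl))
  · exact .inr (.inl (.R3 k o o' (!o) fun h => by simp at h))
  · exact .inr (.inr (.V1_right k d))
  · exact .inr (.inr (.V1_left k d))
  · exact .inr (.inr (.V2 k))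
  · exact .inr (.inr (.V3 k))
  · exact .inr (.inr (.V4_third k o))
  · exact .inr (.inr (.V4_first k o))
  · exact .inr (.inr (.V4_second k o))

/-- Whether two words are the two sides of an exchange. -/
def exchangeB : Word → Word → Bool
  | [⟨a, k⟩, ⟨b, j⟩], [⟨b', j'⟩, ⟨a', k'⟩] =>
    a.beq a' && b.beq b' && k == k' && decide (k + a.outWidth ≤ j) &&
      j' + a.outWidth == j + a.inWidth
  | _, _ => false

theorem virtualRule_of_exchangeB {l r : Word} (h : exchangeB l r = true) : VirtualRule l r := by
  unfold exchangeB at h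
  split at h
  · rename_i a k b j b' j' a' k'
    simp only [Bool.and_eq_true, beq_iff_eq, decide_eq_true_eq] at h
    obtain ⟨⟨⟨⟨h₁, h₂⟩, rfl⟩, h₃⟩, h₄⟩ := h
    obtain rfl := Kind.eq_of_beq h₁
    obtain rfl := Kind.eq_of_beq h₂
    obtain ⟨i, rfl⟩ := Nat.exists_eq_add_of_le h₃
    obtain rfl : j' = k + a.inWidth + i := by omega
    exact .inl (.exchange a b k i)
  · simp at h

/-- The smallest position in a word. -/
def minPos : Word → ℕ
  | [] => 0
  | [p] => p.pos
  | p :: w => min p.pos (minPos w)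

/-- Whether two words are the two sides of a rule. -/
def ruleB (l r : Word) : Bool :=
  exchangeB l r || [true, false].any fun d => [true, false].any fun o => [true, false].any fun o' =>
    -- Every left side in the table has an event at position `k` and none at a smaller one, so `k`
    -- can be read off.
    (ruleTable (minPos l) d o o').any fun p => wordBeq l p.1 && wordBeq r p.2

theorem virtualRule_of_ruleB {l r : Word} (h : ruleB l r = true) : VirtualRule l r := by
  rw [ruleB, Bool.or_eq_true] at h
  rcases h with h | h
  · exact virtualRule_of_exchangeB h
  · rw [List.any_eq_true] at h
    obtain ⟨d, -, h⟩ := h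
    rw [List.any_eq_true] at h
    obtain ⟨o, -, h⟩ := h
    rw [List.any_eq_true] at h
    obtain ⟨o', -, h⟩ := h
    rw [List.any_eq_true] at h
    obtain ⟨p, hp, h⟩ := h
    rw [Bool.and_eq_true] at h
    rw [eq_of_wordBeq h.1, eq_of_wordBeq h.2]
    exact virtualRule_of_mem_ruleTable hp

/-- Removing the longest common prefix. -/
def stripPrefix : Word → Word → Word × Word
  | p :: w, q :: w' =>
    if p.kind.beq q.kind && p.pos == q.pos then stripPrefix w w' else (p :: w, q :: w')
  | w, w' => (w, w')

theorem exists_stripPrefix (w w' : Word) :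
    ∃ u, w = u ++ (stripPrefix w w').1 ∧ w' = u ++ (stripPrefix w w').2 := by
  induction w generalizing w' with
  | nil => exact ⟨[], by simp [stripPrefix]⟩
  | cons p w ih =>
    cases w' with
    | nil => exact ⟨[], by simp [stripPrefix]⟩
    | cons q w' =>
      by_cases h : (p.kind.beq q.kind && p.pos == q.pos) = true
      · obtain ⟨u, h₁, h₂⟩ := ih w'
        have e : p = q := by
          simp only [Bool.and_eq_true, beq_iff_eq] at h
          exact Piece.eq_of_beq h.1 h.2
        refine ⟨p :: u, ?_, ?_⟩
        · simpa [stripPrefix, h] using h₁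
        · rw [stripPrefix, if_pos h, e, List.cons_append, ← h₂]
      · exact ⟨[], by simp [stripPrefix, h]⟩

/-- Whether one replacement, in either direction, leads from `w` to `w'`. -/
def stepB (w w' : Word) : Bool :=
  let p := stripPrefix w w'
  let q := stripPrefix p.1.reverse p.2.reverse
  ruleB q.1.reverse q.2.reverse || ruleB q.2.reverse q.1.reverse ||
    -- Stripping the common suffix can cut an exchange in half, for example for two maximal points
    -- of the same direction. Exchanges are therefore also looked for directly after the common
    -- prefix.
    (exchangeB (p.1.take 2) (p.2.take 2) && wordBeq (p.1.drop 2) (p.2.drop 2)) ||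
    (exchangeB (p.2.take 2) (p.1.take 2) && wordBeq (p.1.drop 2) (p.2.drop 2))

theorem rewrites_of_stepB {w w' : Word} (h : stepB w w' = true) :
    Rewrites VirtualRule w w' ∨ Rewrites VirtualRule w' w := by
  obtain ⟨u, h₁, h₂⟩ := exists_stripPrefix w w'
  obtain ⟨v, h₃, h₄⟩ := exists_stripPrefix (stripPrefix w w').1.reverse
    (stripPrefix w w').2.reverse
  rw [List.reverse_eq_iff, List.reverse_append] at h₃ h₄
  have e₁ := h₁
  have e₂ := h₂
  rw [h₃, ← List.append_assoc] at e₁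
  rw [h₄, ← List.append_assoc] at e₂
  have f₁ := List.take_append_drop 2 (stripPrefix w w').1
  have f₂ := List.take_append_drop 2 (stripPrefix w w').2
  simp only [stepB, Bool.or_eq_true, Bool.and_eq_true] at h
  rcases h with ((h | h) | ⟨h, h'⟩) | ⟨h, h'⟩
  · exact .inl ⟨_, _, _, _, virtualRule_of_ruleB h, e₁, e₂⟩
  · exact .inr ⟨_, _, _, _, virtualRule_of_ruleB h, e₂, e₁⟩
  · rw [← eq_of_wordBeq h'] at f₂
    exact .inl ⟨u, _, _, _, virtualRule_of_exchangeB h, by rw [List.append_assoc, f₁, ← h₁],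
      by rw [List.append_assoc, f₂, ← h₂]⟩
  · rw [← eq_of_wordBeq h'] at f₂
    exact .inr ⟨u, _, _, _, virtualRule_of_exchangeB h, by rw [List.append_assoc, f₂, ← h₂],
      by rw [List.append_assoc, f₁, ← h₁]⟩

/-- Whether a word runs from `σ` to `τ`. -/
def runB (w : Word) (σ τ : List Bool) : Bool := run w σ == some τ

/-- Whether a list of words is a chain of replacements from `w` to `w'`. -/
def chainB (σ τ : List Bool) : Word → List Word → Word → Bool
  | w, [], w' => runB w σ τ && runB w' σ τ && (stepB w w' || wordBeq w w')
  | w, w₁ :: ws, w' => runB w σ τ && runB w₁ σ τ && (stepB w w₁ || wordBeq w w₁) &&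
      chainB σ τ w₁ ws w'

theorem veqv_of_check {σ τ : List Bool} {w w' : Word}
    (h : (runB w σ τ && runB w' σ τ && (stepB w w' || wordBeq w w')) = true) :
    VEqv σ τ w w' := by
  simp only [Bool.and_eq_true, Bool.or_eq_true, runB, beq_iff_eq] at h
  obtain ⟨⟨h₁, h₂⟩, h | h⟩ := h
  · rcases rewrites_of_stepB h with h | h
    · exact .rel _ _ ⟨run_iff.2 h₁, run_iff.2 h₂, h⟩
    · exact Eqv.symm (.rel _ _ ⟨run_iff.2 h₂, run_iff.2 h₁, h⟩)
  · exact .of_eq (eq_of_wordBeq h)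

/-- Only soundness of the checker is needed: explicit chains for words on few strands are verified
by `decide`, for all directions and over/under informations at once. -/
theorem veqv_of_chainB {σ τ : List Bool} {w w' : Word} (ws : List Word)
    (h : chainB σ τ w ws w' = true) : VEqv σ τ w w' := by
  induction ws generalizing w with
  | nil => exact veqv_of_check h
  | cons w₁ ws ih =>
    rw [chainB, Bool.and_eq_true] at h
    exact (veqv_of_check h.1).trans (ih h.2)

end

end TwistedLinks

/-! ### Moves for crossings that are virtual, classical, or classical between virtual crossings -/

namespace TwistedLinks

section

/-- The crossing in mode `m` at position `k`: virtual, classical, or classical between two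
virtual crossings. -/
def modeAt (k : ℕ) (m : Option Bool) (o : Bool) : Word :=
  match m with
  | none => [virtAt k]
  | some false => [crossAt k o]
  | some true => [virtAt k, crossAt k o, virtAt k]

@[simp] theorem shift_modeAt (n k : ℕ) (m : Option Bool) (o : Bool) :
    shift n (modeAt k m o) = modeAt (n + k) m o := by
  rcases m with _ | _ | _ <;> rfl

theorem run_modeAt (m : Option Bool) (o a b : Bool) : Run (modeAt 0 m o) [a, b] [b, a] := by
  rcases m with _ | _ | _ <;> simp [run_iff, run, modeAt, Kind.actAt, Kind.act]

/-- The chain which turns a minimal point with a virtual crossing on top of it around. -/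
def cupVirtChain (k : ℕ) (d : Bool) (post : Word) : List Word :=
  ([[cupAt 0 d, virtAt 0], [cupAt 0 d, virtAt 0, cupAt 0 (!d), capAt 1 d],
    [cupAt 0 d, cupAt 0 (!d), virtAt 2, capAt 1 d],
    [cupAt 0 (!d), cupAt 2 d, virtAt 2, capAt 1 d],
    [cupAt 0 (!d), cupAt 2 d, virtAt 1, capAt 2 d],
    [cupAt 0 (!d)]] : List Word).map fun w => shift k w ++ post

/-- The chain which turns a maximal point with a virtual crossing below it around. -/
def capVirtChain (k : ℕ) (d : Bool) (pre : Word) : List Word :=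
  ([[virtAt 0, capAt 0 d], [cupAt 1 d, capAt 0 (!d), virtAt 0, capAt 0 d],
    [cupAt 1 d, virtAt 2, capAt 0 (!d), capAt 0 d],
    [cupAt 1 d, virtAt 2, capAt 2 d, capAt 0 (!d)],
    [cupAt 2 d, virtAt 1, capAt 2 d, capAt 0 (!d)],
    [capAt 0 (!d)]] : List Word).map fun w => pre ++ shift k w

/-- A zigzag inserted above the crossing makes it part of a virtual curl, which V1 removes; what is
left is a minimal point of the other direction. -/
theorem cup_virt (d : Bool) : VEqv [] [!d, d] [cupAt 0 d, virtAt 0] [cupAt 0 (!d)] :=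
  veqv_of_chainB (cupVirtChain 0 d []) (by revert d; decide)

theorem cap_virt (d : Bool) : VEqv [!d, d] [] [virtAt 0, capAt 0 d] [capAt 0 (!d)] :=
  veqv_of_chainB (capVirtChain 0 d []) (by revert d; decide)

theorem mode_cup (m : Option Bool) (d o a : Bool) :
    VEqv [a] [d, a, !d] ([cupAt 1 d] ++ modeAt 0 m o) ([cupAt 0 d] ++ modeAt 1 m (!o)) := by
  rcases m with _ | _ | _
  · exact veqv_of_chainB [] (by revert d o a; decide)
  · exact veqv_of_chainB [] (by revert d o a; decide)
  -- V4 brings a virtual crossing onto the minimal point, which absorbs it as in `cup_virt`. The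
  -- remaining crossing passes the minimal point by isotopy, V3 rearranges the virtual crossings,
  -- and the same steps are undone at the other position.
  · refine veqv_of_chainB ([[cupAt 0 d, virtAt 1, crossAt 0 o, virtAt 0],
      [cupAt 0 d, virtAt 1, crossAt 0 o, virtAt 1, virtAt 1, virtAt 0]] ++
      cupVirtChain 0 d [crossAt 1 o, virtAt 0, virtAt 1, virtAt 0] ++
      [[cupAt 1 (!d), crossAt 0 (!o), virtAt 0, virtAt 1, virtAt 0],
      [cupAt 1 (!d), crossAt 0 (!o), virtAt 1, virtAt 0, virtAt 1]] ++
      (cupVirtChain 1 d [crossAt 0 (!o), virtAt 1, virtAt 0, virtAt 1]).reverse ++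
      [[cupAt 1 d, virtAt 0, crossAt 1 (!o), virtAt 0, virtAt 0, virtAt 1],
      [cupAt 1 d, virtAt 0, crossAt 1 (!o), virtAt 1]]) (by revert d o a; decide)

theorem mode_cap (m : Option Bool) (d o a : Bool) :
    VEqv [d, a, !d] [a] (modeAt 0 m o ++ [capAt 1 d]) (modeAt 1 m (!o) ++ [capAt 0 d]) := by
  rcases m with _ | _ | _
  · exact veqv_of_chainB [] (by revert d o a; decide)
  · exact veqv_of_chainB [] (by revert d o a; decide)
  · refine veqv_of_chainB ([[virtAt 0, crossAt 0 o, virtAt 1, capAt 0 d],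
      [virtAt 0, virtAt 1, virtAt 1, crossAt 0 o, virtAt 1, capAt 0 d]] ++
      capVirtChain 0 d [virtAt 0, virtAt 1, virtAt 0, crossAt 1 o] ++
      [[virtAt 0, virtAt 1, virtAt 0, crossAt 0 (!o), capAt 1 (!d)],
      [virtAt 1, virtAt 0, virtAt 1, crossAt 0 (!o), capAt 1 (!d)]] ++
      (capVirtChain 1 d [virtAt 1, virtAt 0, virtAt 1, crossAt 0 (!o)]).reverse ++
      [[virtAt 1, virtAt 0, virtAt 0, crossAt 1 (!o), virtAt 0, capAt 1 d],
      [virtAt 1, crossAt 1 (!o), virtAt 0, capAt 1 d]]) (by revert d o a; decide)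

/-- In a curl a strand meets itself, hence its own sheet, and the mode `none` does not occur. If the
crossing is conjugated, V4 moves its virtual crossings onto the minimal and the maximal point, which
absorb them, and an ordinary curl on the other side is left. -/
theorem mode_R1_right (b d o : Bool) :
    VEqv [d] [d] ([cupAt 1 d] ++ modeAt 0 (some b) o ++ [capAt 1 d]) [] := by
  cases b
  · exact veqv_of_chainB [] (by revert d o; decide)
  · exact veqv_of_chainB ([[cupAt 0 d, virtAt 1, crossAt 0 o, virtAt 0, capAt 1 d],
      [cupAt 0 d, virtAt 1, crossAt 0 o, virtAt 1, capAt 0 d]] ++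
      cupVirtChain 0 d [crossAt 1 o, virtAt 0, capAt 0 d] ++
      capVirtChain 0 d [cupAt 0 (!d), crossAt 1 o]) (by revert d o; decide)

theorem mode_R1_left (b d o : Bool) :
    VEqv [!d] [!d] ([cupAt 0 d] ++ modeAt 1 (some b) o ++ [capAt 0 d]) [] := by
  cases b
  · exact veqv_of_chainB [] (by revert d o; decide)
  · exact veqv_of_chainB ([[cupAt 1 d, virtAt 0, crossAt 1 o, virtAt 1, capAt 0 d],
      [cupAt 1 d, virtAt 0, crossAt 1 o, virtAt 0, capAt 1 d]] ++
      cupVirtChain 1 d [crossAt 0 o, virtAt 1, capAt 1 d] ++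
      capVirtChain 1 d [cupAt 1 (!d), crossAt 0 o]) (by revert d o; decide)

theorem mode_R2 (m : Option Bool) (o a b : Bool) :
    VEqv [a, b] [a, b] (modeAt 0 m o ++ modeAt 0 m (!o)) [] := by
  rcases m with _ | _ | _
  · exact veqv_of_chainB [] (by revert o a b; decide)
  · exact veqv_of_chainB [] (by revert o a b; decide)
  · exact veqv_of_chainB [[virtAt 0, crossAt 0 o, crossAt 0 (!o), virtAt 0],
      [virtAt 0, virtAt 0]] (by revert o a b; decide)

theorem mode_V4_third (m : Option Bool) (o a b c : Bool) : VEqv [a, b, c] [c, b, a]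
    (modeAt 0 m o ++ [virtAt 1, virtAt 0]) ([virtAt 1, virtAt 0] ++ modeAt 1 m o) := by
  rcases m with _ | _ | _
  · exact veqv_of_chainB [] (by revert o a b c; decide)
  · exact veqv_of_chainB [] (by revert o a b c; decide)
  · exact veqv_of_chainB [[virtAt 0, crossAt 0 o, virtAt 1, virtAt 0, virtAt 1],
      [virtAt 0, virtAt 1, virtAt 0, crossAt 1 o, virtAt 1]] (by revert o a b c; decide)

theorem mode_V4_first (m : Option Bool) (o a b c : Bool) : VEqv [a, b, c] [c, b, a]
    ([virtAt 0, virtAt 1] ++ modeAt 0 m o) (modeAt 1 m o ++ [virtAt 0, virtAt 1]) := by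
  rcases m with _ | _ | _
  · exact veqv_of_chainB [] (by revert o a b c; decide)
  · exact veqv_of_chainB [] (by revert o a b c; decide)
  · exact veqv_of_chainB [[virtAt 1, virtAt 0, virtAt 1, crossAt 0 o, virtAt 0],
      [virtAt 1, crossAt 1 o, virtAt 0, virtAt 1, virtAt 0]] (by revert o a b c; decide)

theorem mode_V4_second (m : Option Bool) (o a b c : Bool) : VEqv [a, b, c] [c, b, a]
    ([virtAt 0] ++ modeAt 1 m o ++ [virtAt 0]) ([virtAt 1] ++ modeAt 0 m o ++ [virtAt 1]) := by
  rcases m with _ | _ | _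
  · exact veqv_of_chainB [] (by revert o a b c; decide)
  · exact veqv_of_chainB [] (by revert o a b c; decide)
  -- Pairs of virtual crossings are inserted around the classical one until V4 applies to it; the
  -- virtual crossings on either side are then rearranged by V2 and V3.
  · exact veqv_of_chainB [
      [virtAt 0, virtAt 1, virtAt 0, virtAt 0, crossAt 1 o, virtAt 1, virtAt 0],
      [virtAt 0, virtAt 1, virtAt 0, virtAt 0, crossAt 1 o, virtAt 0, virtAt 0, virtAt 1,
        virtAt 0],
      [virtAt 0, virtAt 1, virtAt 0, virtAt 1, crossAt 0 o, virtAt 1, virtAt 0, virtAt 1,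
        virtAt 0],
      [virtAt 1, virtAt 0, virtAt 1, virtAt 1, crossAt 0 o, virtAt 1, virtAt 0, virtAt 1,
        virtAt 0],
      [virtAt 1, virtAt 0, crossAt 0 o, virtAt 1, virtAt 0, virtAt 1, virtAt 0],
      [virtAt 1, virtAt 0, crossAt 0 o, virtAt 1, virtAt 1, virtAt 0, virtAt 1]]
      (by revert o a b c; decide)

/-- The chain which moves a crossing at position `0` through a half turn. -/
def halfTurnChain₀ (o : Bool) (pre post : Word) : List Word :=
  ([[virtAt 0, virtAt 1, virtAt 0, crossAt 1 o],
    [virtAt 0, virtAt 1, virtAt 0, crossAt 1 o, virtAt 0, virtAt 0],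
    [virtAt 0, virtAt 1, virtAt 1, crossAt 0 o, virtAt 1, virtAt 0],
    [virtAt 0, crossAt 0 o, virtAt 1, virtAt 0],
    [virtAt 0, crossAt 0 o, virtAt 0, virtAt 0, virtAt 1, virtAt 0]] : List Word).reverse.map
      fun w => pre ++ w ++ post

/-- The chain which moves a crossing at position `1` through a half turn. -/
def halfTurnChain₁ (o : Bool) (pre post : Word) : List Word :=
  ([[virtAt 0, virtAt 1, virtAt 0, crossAt 0 o],
    [virtAt 1, virtAt 0, virtAt 1, crossAt 0 o],
    [virtAt 1, virtAt 0, virtAt 1, crossAt 0 o, virtAt 1, virtAt 1],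
    [virtAt 1, virtAt 0, virtAt 0, crossAt 1 o, virtAt 0, virtAt 1],
    [virtAt 1, crossAt 1 o, virtAt 0, virtAt 1],
    [virtAt 1, crossAt 1 o, virtAt 1, virtAt 1, virtAt 0, virtAt 1],
    [virtAt 1, crossAt 1 o, virtAt 1, virtAt 0, virtAt 1, virtAt 0]] : List Word).reverse.map
      fun w => pre ++ w ++ post

/-- The mode of a crossing between strands on the given sheets. -/
def sheetMode (x y : Bool) : Option Bool := if x = y then some x else none

/-- The chain for the third Reidemeister move with all crossings between virtual crossings. -/
def halfTurnChain (o₁ o₂ o₃ : Bool) : List Word :=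
  let p := modeAt 0 (some true) o₁ ++ modeAt 1 (some true) o₂ ++ modeAt 0 (some true) o₃
  let q := modeAt 1 (some true) o₃ ++ modeAt 0 (some true) o₂ ++ modeAt 1 (some true) o₁
  let x : Word := [virtAt 0, virtAt 1, virtAt 0]
  [p ++ [virtAt 0, virtAt 0], p ++ [virtAt 0, virtAt 1, virtAt 1, virtAt 0], p ++ x ++ x] ++
    halfTurnChain₀ o₃ (modeAt 0 (some true) o₁ ++ modeAt 1 (some true) o₂) x ++
    halfTurnChain₁ o₂ (modeAt 0 (some true) o₁) ([crossAt 1 o₃] ++ x) ++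
    halfTurnChain₀ o₁ [] ([crossAt 0 o₂, crossAt 1 o₃] ++ x) ++
    (halfTurnChain₁ o₃ [] ([crossAt 1 o₂, crossAt 0 o₁] ++ x)).reverse ++
    (halfTurnChain₀ o₂ (modeAt 1 (some true) o₃) ([crossAt 0 o₁] ++ x)).reverse ++
    (halfTurnChain₁ o₁ (modeAt 1 (some true) o₃ ++ modeAt 0 (some true) o₂) x).reverse ++
    [q ++ [virtAt 0, virtAt 1, virtAt 1, virtAt 0], q ++ [virtAt 0, virtAt 0]]

/-- Let `x` be the virtual half turn of three strands; its square is trivial. A conjugated crossing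
below `x` becomes an ordinary crossing above `x` at the other position. So, with `x ++ x` inserted
on top, the three conjugated crossings become three ordinary ones enclosed by half turns, to which
the ordinary R3 applies. -/
theorem mode_R3_true (o₁ o₂ o₃ a b c : Bool) (h : o₁ = o₃ → o₂ = o₁) :
    VEqv [a, b, c] [c, b, a]
      (modeAt 0 (some true) o₁ ++ modeAt 1 (some true) o₂ ++ modeAt 0 (some true) o₃)
      (modeAt 1 (some true) o₃ ++ modeAt 0 (some true) o₂ ++ modeAt 1 (some true) o₁) := by
  have key : chainB [a, b, c] [c, b, a]
      (modeAt 0 (some true) o₁ ++ modeAt 1 (some true) o₂ ++ modeAt 0 (some true) o₃)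
      (halfTurnChain o₁ o₂ o₃)
      (modeAt 1 (some true) o₃ ++ modeAt 0 (some true) o₂ ++ modeAt 1 (some true) o₁) = true := by
    cases o₁ <;> cases o₃ <;> simp only [reduceCtorEq, forall_const, false_implies] at h <;>
      try subst h
    · revert a b c; decide
    · clear h; revert a b c o₂; decide
    · clear h; revert a b c o₂; decide
    · revert a b c; decide
  exact veqv_of_chainB _ key

/-- Among three sheets two agree. If all agree, this is R3 or its conjugated form; otherwise one
strand crosses the two others virtually, and the move is a form of V4. -/
theorem mode_R3 (x y z o₁ o₂ o₃ a b c : Bool) (h : o₁ = o₃ → o₂ = o₁) :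
    VEqv [a, b, c] [c, b, a]
      (modeAt 0 (sheetMode x y) o₁ ++ modeAt 1 (sheetMode x z) o₂ ++ modeAt 0 (sheetMode y z) o₃)
      (modeAt 1 (sheetMode y z) o₃ ++ modeAt 0 (sheetMode x z) o₂ ++
        modeAt 1 (sheetMode x y) o₁) := by
  cases x <;> cases y <;> cases z
  · exact veqv_of_chainB [] (by revert o₁ o₂ o₃ a b c; decide)
  · exact mode_V4_third (some false) o₁ a b c
  · exact mode_V4_second (some false) o₂ a b c
  · exact mode_V4_first (some true) o₃ a b c
  · exact mode_V4_first (some false) o₃ a b c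
  · exact mode_V4_second (some true) o₂ a b c
  · exact mode_V4_third (some true) o₁ a b c
  · exact mode_R3_true o₁ o₂ o₃ a b c h

theorem cup_detour_right (d a : Bool) :
    VEqv [a] [d, !d, a] [cupAt 1 d, virtAt 0, virtAt 1] [cupAt 0 d] :=
  veqv_of_chainB [[cupAt 0 d, virtAt 1, virtAt 1]] (by revert d a; decide)

theorem cup_detour_left (d a : Bool) :
    VEqv [a] [a, d, !d] [cupAt 0 d, virtAt 1, virtAt 0] [cupAt 1 d] :=
  veqv_of_chainB [[cupAt 1 d, virtAt 0, virtAt 0]] (by revert d a; decide)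

theorem cap_detour_right (d a : Bool) :
    VEqv [a, d, !d] [a] [virtAt 0, virtAt 1, capAt 0 d] [capAt 1 d] :=
  veqv_of_chainB [[virtAt 0, virtAt 0, capAt 1 d]] (by revert d a; decide)

theorem cap_detour_left (d a : Bool) :
    VEqv [d, !d, a] [a] [virtAt 1, virtAt 0, capAt 1 d] [capAt 0 d] :=
  veqv_of_chainB [[virtAt 1, virtAt 1, capAt 0 d]] (by revert d a; decide)

theorem mode_conj (b o x y : Bool) : VEqv [x, y] [y, x]
    ([virtAt 0] ++ modeAt 0 (some b) o ++ [virtAt 0]) (modeAt 0 (some !b) o) := by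
  cases b
  · exact .refl _
  · exact veqv_of_chainB [[crossAt 0 o, virtAt 0, virtAt 0]] (by revert o x y; decide)

end

end TwistedLinks

namespace TwistedLinks

section

/-! ### Detours -/

/-- A word without bars. -/
def NoBar (w : Word) : Prop := ∀ p ∈ w, p.kind ≠ Kind.bar

@[simp] theorem noBar_nil : NoBar [] := by simp [NoBar]

@[simp] theorem noBar_cons {p : Piece} {w : Word} :
    NoBar (p :: w) ↔ p.kind ≠ Kind.bar ∧ NoBar w := by simp [NoBar]

@[simp] theorem noBar_append {w w' : Word} : NoBar (w ++ w') ↔ NoBar w ∧ NoBar w' := by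
  simp [NoBar, or_imp, forall_and]

@[simp] theorem noBar_shift {n : ℕ} {w : Word} : NoBar (shift n w) ↔ NoBar w := by
  simp [NoBar, shift]

theorem noBar_modeAt (k : ℕ) (m : Option Bool) (o : Bool) : NoBar (modeAt k m o) := by
  rcases m with _ | _ | _ <;> simp [modeAt]

/-- The leftmost strand passes the next `n` strands to the right, by virtual crossings. -/
def pass : ℕ → Word
  | 0 => []
  | n + 1 => virtAt 0 :: shift 1 (pass n)

/-- A strand passes `n` strands to the left, by virtual crossings. -/
def passLeft : ℕ → Word
  | 0 => []
  | n + 1 => virtAt n :: passLeft n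

/-- The `m` leftmost strands pass the next `n` strands to the right, by virtual crossings. -/
def passBlock (m : ℕ) : ℕ → Word
  | 0 => []
  | n + 1 => passLeft m ++ shift 1 (passBlock m n)

theorem run_virt (a b : Bool) (ρ : List Bool) : Run [virtAt 0] (a :: b :: ρ) (b :: a :: ρ) := by
  simp [run_iff, run, Kind.actAt, Kind.act]

theorem Run.shift_one {w : Word} {σ τ : List Bool} (h : Run w σ τ) (a : Bool) :
    Run (TwistedLinks.shift 1 w) (a :: σ) (a :: τ) := h.shift [a]

theorem Eqv.shift_one {σ τ : List Bool} {w w' : Word} (h : VEqv σ τ w w') (a : Bool) :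
    VEqv (a :: σ) (a :: τ) (TwistedLinks.shift 1 w) (TwistedLinks.shift 1 w') := h.shift [a]

theorem run_pass (a : Bool) (ρ : List Bool) : Run (pass ρ.length) (a :: ρ) (ρ ++ [a]) := by
  induction ρ with
  | nil => exact .nil _
  | cons b ρ ih => exact (run_virt a b ρ).append (ih.shift_one b)

theorem run_passLeft (l : List Bool) (x : Bool) :
    Run (passLeft l.length) (l ++ [x]) (x :: l) := by
  induction l using List.reverseRecOn with
  | nil => exact .nil _
  | append_singleton l a ih =>
    have h₁ := (run_virt a x []).shift l
    have h₂ := ih.tail [a]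
    rw [List.append_assoc] at h₂
    simpa [passLeft] using h₁.append h₂

theorem run_passBlock (l ρ : List Bool) : Run (passBlock l.length ρ.length) (l ++ ρ) (ρ ++ l) := by
  induction ρ with
  | nil => simpa [passBlock] using Run.nil l
  | cons x ρ ih =>
    have := ((run_passLeft l x).tail ρ).append (ih.shift_one x)
    simpa [passBlock] using this

theorem pass_add (m n : ℕ) : pass (m + n) = pass m ++ shift m (pass n) := by
  induction m with
  | zero => simp [pass]
  | succ m ih => rw [Nat.succ_add, pass, ih, pass]; simp [shift_shift, Nat.add_comm]

/-- Words next to each other, with further strands, can be stacked in either order. -/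
theorem interchange_tail {σ τ ρ π : List Bool} {p q : Word} (hp : Run p σ τ) (hq : Run q ρ π)
    (v : List Bool) :
    VEqv (σ ++ ρ ++ v) (τ ++ π ++ v) (p ++ shift τ.length q) (shift σ.length q ++ p) :=
  (interchange hp hq).tail v

/-- Past an extremal point this is V2 up to isotopy, past a classical crossing V4, past a virtual
one V3. A bar is excluded, since passing it requires T1. -/
theorem detour_local {a : Kind} {l m : List Bool} (h : a.Acts l m) (hb : a ≠ .bar) (x : Bool) :
    VEqv (x :: l) (m ++ [x]) (shift 1 [⟨a, 0⟩] ++ pass m.length) (pass l.length ++ [⟨a, 0⟩]) := by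
  cases h with
  | cup d => exact cup_detour_right d x
  | cap d => exact (cap_detour_right d x).symm
  | cross o a b => exact (mode_V4_first (some false) o x a b).symm
  | virt a b => exact (mode_V4_first none true x a b).symm
  | bar a => exact absurd rfl hb

theorem detour_single {a : Kind} {l m : List Bool} (h : a.Acts l m) (hb : a ≠ .bar) (x : Bool)
    (u v : List Bool) :
    VEqv (x :: (u ++ l ++ v)) (u ++ m ++ v ++ [x])
      (shift 1 [⟨a, u.length⟩] ++ pass (u ++ m ++ v).length)
      (pass (u ++ l ++ v).length ++ [⟨a, u.length⟩]) := by
  have hq : Run [⟨a, 0⟩] l m := by simpa using Run.single h [] []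
  -- The moving strand meets `u`, then the event, then `v`. The event is exchanged with the first
  -- stretch (`h₁`), passed (`h₂`), and exchanged with the last stretch (`h₃`).
  have h₁ := ((interchange (run_pass x u) hq).tail v).append_right
    (π := u ++ m ++ v ++ [x]) (v := shift u.length (pass m.length ++ shift m.length (pass v.length)))
    (by simpa using (((run_pass x m).tail v).append
      (by simpa using (run_pass x v).shift m)).shift u)
  have h₂ := (((detour_local h hb x).tail v).shift u).comp (ρ := x :: (u ++ l ++ v))
    (π := u ++ m ++ v ++ [x]) (u := pass u.length)
    (v := shift u.length (shift m.length (pass v.length)))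
    (by simpa using (run_pass x u).tail (l ++ v))
    (by simpa using ((run_pass x v).shift m).shift u)
  have h₃ := ((interchange hq (run_pass x v)).shift u).append_left (ρ := x :: (u ++ l ++ v))
    (u := pass u.length ++ shift u.length (pass l.length))
    (by
      have e₁ := (run_pass x u).tail (l ++ v)
      have e₂ := ((run_pass x l).tail v).shift u
      simp only [List.append_assoc, List.cons_append, List.nil_append] at e₁ e₂ ⊢
      exact e₁.append e₂)
  simp only [List.length_append, pass_add]
  simp only [List.append_assoc, List.cons_append, List.nil_append, shift_append, shift_cons,
    shift_nil, shift_shift, List.length_append, List.length_cons, List.length_nil,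
    Nat.add_zero, Nat.zero_add] at h₁ h₂ h₃ ⊢
  rw [Nat.add_comm 1]
  exact (h₁.symm.trans h₂).trans h₃

/-- A strand passes a word, by virtual crossings. -/
theorem detour {w : Word} {σ τ : List Bool} (h : Run w σ τ) (hw : NoBar w) (x : Bool) :
    VEqv (x :: σ) (τ ++ [x]) (shift 1 w ++ pass τ.length) (pass σ.length ++ w) := by
  induction h with
  | nil => simpa using Eqv.refl _
  | cons a l m u v τ w h hr ih =>
    rw [noBar_cons] at hw
    have h₁ := (ih hw.2).append_left ((Run.single h u v).shift_one x)
    have h₂ := (detour_single h hw.1 x u v).append_right (hr.tail [x])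
    simpa using h₁.trans (by simpa using h₂)

/-- A word on the left passes strands, by virtual crossings, if it passes one strand. -/
theorem block_detour {p : Word} {l m : List Bool}
    (h : ∀ x, VEqv (l ++ [x]) (x :: m) (p ++ passLeft m.length)
      (passLeft l.length ++ shift 1 p)) (ρ : List Bool) :
    VEqv (l ++ ρ) (ρ ++ m) (p ++ passBlock m.length ρ.length)
      (passBlock l.length ρ.length ++ shift ρ.length p) := by
  induction ρ with
  | nil => simpa [passBlock] using Eqv.refl _
  | cons x ρ ih =>
    have h₁ := ((h x).tail ρ).append_right ((run_passBlock m ρ).shift_one x)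
    have h₂ := (ih.shift_one x).append_left (ρ := l ++ x :: ρ)
      (by simpa using (run_passLeft l x).tail ρ)
    simp only [List.length_cons, passBlock]
    simp only [shift_append, shift_shift, List.append_assoc,
      List.cons_append, List.nil_append, Nat.add_comm 1] at h₁ h₂ ⊢
    exact h₁.trans h₂

/-- Both words consist of the same virtual crossings: on the left both strands pass one strand after
the other together, on the right the second strand goes all the way before the first. Only distant
crossings change heights. -/
theorem passBlock_two (a b : Bool) (ρ : List Bool) :
    VEqv (a :: b :: ρ) (ρ ++ [a, b]) (passBlock 2 ρ.length)
      (shift 1 (pass ρ.length) ++ pass ρ.length) := by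
  induction ρ with
  | nil => exact .refl _
  | cons x ρ ih =>
    have h₁ := (ih.shift_one x).append_left ((run_passLeft [a, b] x).tail ρ)
    have h₂ := (interchange (run_virt a x []) (run_pass b ρ)).comp (ρ := a :: b :: x :: ρ)
      (π := x :: (ρ ++ [a, b])) (u := [virtAt 1]) (v := shift 1 (pass ρ.length))
      ((run_virt b x ρ).shift_one a) (by simpa using ((run_pass a ρ).tail [b]).shift_one x)
    simp only [passBlock, pass, passLeft, List.length_cons, shift_append, shift_cons, shift_shift,
      List.append_assoc, List.cons_append, List.nil_append, List.length_nil] at h₁ h₂ ⊢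
    exact h₁.trans h₂

theorem passBlock_zero (n : ℕ) : passBlock 0 n = [] := by
  induction n with
  | zero => rfl
  | succ n ih => simp [passBlock, passLeft, ih]

theorem block_cup (d : Bool) (ρ : List Bool) :
    VEqv ρ (ρ ++ [d, !d]) ([cupAt 0 d] ++ passBlock 2 ρ.length) [cupAt ρ.length d] := by
  have := block_detour (p := [cupAt 0 d]) (l := []) (m := [d, !d])
    (fun x => by simpa [passLeft] using cup_detour_left d x) ρ
  simpa [passBlock_zero] using this

theorem block_cap (d : Bool) (ρ : List Bool) :
    VEqv (d :: (!d) :: ρ) ρ (passBlock 2 ρ.length ++ [capAt ρ.length d]) [capAt 0 d] := by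
  have := block_detour (p := [capAt 0 d]) (l := [d, !d]) (m := [])
    (fun x => by simpa [passLeft] using (cap_detour_left d x).symm) ρ
  simpa [passBlock_zero] using this.symm

theorem block_mode (m : Option Bool) (o a b : Bool) (ρ : List Bool) :
    VEqv (a :: b :: ρ) (ρ ++ [b, a]) (modeAt 0 m o ++ passBlock 2 ρ.length)
      (passBlock 2 ρ.length ++ modeAt ρ.length m o) := by
  have := block_detour (p := modeAt 0 m o) (l := [a, b]) (m := [b, a])
    (fun x => by simpa [passLeft] using mode_V4_third m o a b x) ρ
  simpa using this

end

end TwistedLinks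

namespace TwistedLinks

section

/-! ### The diagram `s(D)` by virtual crossings -/

/-- Every classical crossing is placed between two virtual crossings. -/
def virtConj (w : Word) : Word := w.flatMap fun p =>
  match p.kind with
  | .cross o => modeAt p.pos (some true) o
  | a => [⟨a, p.pos⟩]

@[simp] theorem virtConj_nil : virtConj [] = [] := rfl

theorem virtConj_cons (p : Piece) (w : Word) : virtConj (p :: w) = virtConj [p] ++ virtConj w := by
  simp [virtConj]

theorem virtConj_append (w w' : Word) : virtConj (w ++ w') = virtConj w ++ virtConj w' := by
  simp [virtConj]

theorem virtConj_shift (n : ℕ) (w : Word) : virtConj (shift n w) = shift n (virtConj w) := by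
  induction w with
  | nil => rfl
  | cons p w ih =>
    rw [shift_cons, virtConj_cons, ih, virtConj_cons p, shift_append]
    obtain ⟨a, k⟩ := p
    cases a <;> simp [virtConj]

theorem noBar_virtConj {w : Word} (h : NoBar w) : NoBar (virtConj w) := by
  induction w with
  | nil => simp
  | cons p w ih =>
    rw [noBar_cons] at h
    rw [virtConj_cons, noBar_append]
    refine ⟨?_, ih h.2⟩
    obtain ⟨a, k⟩ := p
    cases a <;> simp_all [virtConj, modeAt]

theorem Run.virtConj {w : Word} {σ τ : List Bool} (h : Run w σ τ) : Run (virtConj w) σ τ := by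
  induction h with
  | nil => exact .nil _
  | cons a l m u v τ w h _ ih =>
    rw [virtConj_cons]
    refine Run.append ?_ ih
    cases h with
    | cross o x y => simpa [TwistedLinks.virtConj] using ((run_modeAt (some true) o x y).shift u).tail v
    | cup d => exact Run.single (.cup d) u v
    | cap d => exact Run.single (.cap d) u v
    | virt x y => exact Run.single (.virt x y) u v
    | bar x => exact Run.single (.bar x) u v

/-- The effect of `s` on words. -/
def sWord (w : Word) : Word := Word.switch (Word.reflect w)

theorem sWord_append (w w' : Word) : sWord (w ++ w') = sWord w' ++ sWord w := s_append w w'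

theorem Run.sWord {w : Word} {σ τ : List Bool} (h : Run w σ τ) :
    Run (sWord w) (τ.map (!·)) (σ.map (!·)) := h.reflect.switch

@[simp] theorem sWord_single (a : Kind) (k : ℕ) : sWord [⟨a, k⟩] = [⟨a.reflect.switch, k⟩] := rfl

/-- The strands `ρ` are connected with the strands of opposite directions next to them. -/
def capAll : List Bool → Word
  | [] => []
  | x :: ρ => pass ρ.length ++ [capAt ρ.length x] ++ capAll ρ

theorem run_cap (x : Bool) : Run [capAt 0 x] [x, !x] [] := .single (.cap x) [] []

theorem run_pass_cap (x : Bool) (ρ : List Bool) :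
    Run (pass ρ.length ++ [capAt ρ.length x]) (x :: ρ ++ [!x]) ρ := by
  have h₁ := (run_pass x ρ).tail [!x]
  have h₂ := (run_cap x).shift ρ
  rw [List.append_nil] at h₂
  exact h₁.append (by simpa using h₂)

theorem run_capAll (ρ : List Bool) : Run (capAll ρ) (ρ ++ ρ.map (!·)) [] := by
  induction ρ with
  | nil => exact .nil _
  | cons x ρ ih =>
    have h := (run_pass_cap x ρ).tail (ρ.map (!·))
    exact Run.append (by simpa using h) ih

/-- The first two caps of `capAll` are nested, after a block passes the remaining strands. -/
theorem pass_cap_pass_cap (x y : Bool) (ρ : List Bool) :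
    VEqv (x :: y :: ρ ++ [!x, !y]) ρ
      (pass (y :: ρ).length ++ [capAt (y :: ρ).length x] ++ (pass ρ.length ++ [capAt ρ.length y]))
      ([virtAt 0] ++ passBlock 2 ρ.length ++ shift ρ.length [capAt 1 x, capAt 0 y]) := by
  have hcap : Run (shift ρ.length [capAt 0 y]) (ρ ++ [y, !y]) ρ := by
    simpa using (run_cap y).shift ρ
  have h₁ := ((interchange_tail (run_pass y ρ) (run_cap x) [!y])).comp
    (ρ := x :: y :: ρ ++ [!x, !y]) (π := ρ) (u := virtAt 0 :: shift 1 (pass ρ.length))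
    (v := shift ρ.length [capAt 0 y])
    (by
      have e₁ := run_virt x y (ρ ++ [!x, !y])
      have e₂ := ((run_pass x ρ).tail [!x, !y]).shift_one y
      simpa using e₁.append e₂)
    (by simpa using hcap)
  have h₂ := ((passBlock_two y x ρ).tail [!x, !y]).comp (ρ := x :: y :: ρ ++ [!x, !y]) (π := ρ)
    (u := [virtAt 0]) (v := shift ρ.length [capAt 1 x, capAt 0 y])
    (by simpa using run_virt x y (ρ ++ [!x, !y]))
    (by
      have := (show Run [capAt 1 x, capAt 0 y] [y, x, !x, !y] [] by
        simp [run_iff, run, Kind.actAt, Kind.act]).shift ρ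
      simpa using this)
  simp only [pass, List.length_cons, shift_cons, shift_nil, List.append_assoc, List.cons_append,
    List.nil_append, Nat.add_zero, List.length_append, List.length_nil, Nat.zero_add] at h₁ h₂ ⊢
  exact h₁.symm.trans h₂.symm

/-- Here the conjugation is needed: one of its virtual crossings cancels the one below the nested
arcs, the classical crossing turns through both maximal points, and the other virtual crossing takes
the place of the cancelled one. Reflecting and switching both negate the over/under information, so
it is unchanged. -/
theorem cap_rotate_mode {a : Kind} {x y : Bool} (h : a.Acts [x, y] [y, x]) :
    VEqv [x, y, !y, !x] []
      (virtConj [⟨a, 0⟩] ++ [virtAt 0, capAt 1 y, capAt 0 x])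
      ([virtAt 0, ⟨a.reflect.switch, 2⟩, capAt 1 x, capAt 0 y]) := by
  cases h with
  | cross o =>
    simp only [Kind.reflect, Kind.switch, Bool.not_not]
    refine veqv_of_chainB [[virtAt 0, crossAt 0 o, capAt 1 y, capAt 0 x],
      [virtAt 0, crossAt 1 (!o), capAt 0 y, capAt 0 x],
      [virtAt 0, crossAt 1 (!o), capAt 2 x, capAt 0 y]] (by revert o x y; decide)
  | virt =>
    refine veqv_of_chainB [[virtAt 0, virtAt 1, capAt 0 y, capAt 0 x],
      [virtAt 0, virtAt 1, capAt 2 x, capAt 0 y]] (by revert x y; decide)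

theorem cup_cap_cap (d : Bool) :
    VEqv [!d, d] [] [cupAt 0 (!d), capAt 1 d, capAt 0 (!d)] [capAt 0 (!d)] :=
  veqv_of_chainB [] (by revert d; decide)

theorem cup_cap_cap' (d : Bool) :
    VEqv [!d, d] [] [cupAt 2 (!d), capAt 1 d, capAt 0 (!d)] [capAt 0 (!d)] :=
  veqv_of_chainB [] (by revert d; decide)

theorem run_caps (x y : Bool) (ρ : List Bool) :
    Run (shift ρ.length [capAt 1 x, capAt 0 y] ++ capAll ρ)
      (ρ ++ y :: x :: (!x) :: (!y) :: ρ.map (!·)) [] := by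
  have h := (show Run [capAt 1 x, capAt 0 y] [y, x, !x, !y] [] by
    simp [run_iff, run, Kind.actAt, Kind.act]).shift ρ
  have h := h.tail (ρ.map (!·))
  rw [List.append_nil] at h
  exact Run.append (by simpa using h) (run_capAll ρ)

theorem run_block_caps (x y : Bool) (ρ : List Bool) :
    Run (passBlock 2 ρ.length ++ (shift ρ.length [capAt 1 x, capAt 0 y] ++ capAll ρ))
      (y :: x :: ρ ++ (!x) :: (!y) :: ρ.map (!·)) [] := by
  have h := (run_passBlock [y, x] ρ).tail ((!x) :: (!y) :: ρ.map (!·))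
  exact Run.append h (by simpa using run_caps x y ρ)

/-- Replaces the first two arcs, which join strands in parallel order, by nested arcs at the cost of
one virtual crossing; events can be turned through nested arcs. -/
theorem capAll_two (x y : Bool) (ρ : List Bool) :
    VEqv (x :: y :: ρ ++ (!x) :: (!y) :: ρ.map (!·)) [] (capAll (x :: y :: ρ))
      ([virtAt 0] ++
        (passBlock 2 ρ.length ++ (shift ρ.length [capAt 1 x, capAt 0 y] ++ capAll ρ))) := by
  have := ((pass_cap_pass_cap x y ρ).tail (ρ.map (!·))).append_right (run_capAll ρ)
  simpa [capAll] using this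

/-- The two strands of the crossing are taken across `v` under nested arcs. The crossing follows
them, is turned through the arcs by `cap_rotate_mode`, and the two strands are then put back. -/
theorem capAll_crossing {a : Kind} {x y : Bool} (h : a.Acts [x, y] [y, x])
    (v : List Bool) :
    VEqv (x :: y :: v ++ (!y) :: (!x) :: v.map (!·)) [] (virtConj [⟨a, 0⟩] ++ capAll (y :: x :: v))
      (shift (x :: y :: v).length (sWord [⟨a, 0⟩]) ++ capAll (x :: y :: v)) := by
  -- Both kinds of crossing, before and after, are written in the form `modeAt`, so that the block
  -- lemmas treat them together.
  obtain ⟨m, o, hm, ho⟩ : ∃ m o, virtConj [⟨a, 0⟩] = modeAt 0 m o ∧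
      [⟨a.reflect.switch, 0⟩] = modeAt 0 (if m = none then none else some false) o := by
    cases h with
    | cross o => exact ⟨some true, o, rfl, by simp [Kind.reflect, Kind.switch, modeAt]⟩
    | virt => exact ⟨none, true, rfl, by simp [Kind.reflect, Kind.switch, modeAt]⟩
  have hs : Run [⟨a.reflect.switch, 0⟩] [!y, !x] [!x, !y] := ho ▸ run_modeAt _ _ _ _
  have h₁ := (capAll_two y x v).append_left (ρ := x :: y :: v ++ (!y) :: (!x) :: v.map (!·))
    (u := virtConj [⟨a, 0⟩]) (hm ▸ (run_modeAt m o x y).tail _)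
  have h₂ := (((block_mode none true y x v).tail ((!y) :: (!x) :: v.map (!·)))).comp
    (ρ := x :: y :: v ++ (!y) :: (!x) :: v.map (!·)) (u := modeAt 0 m o)
    ((run_modeAt m o x y).tail _) (by simpa using run_caps y x v)
  have h₃ := ((block_mode m o x y v).tail ((!y) :: (!x) :: v.map (!·))).append_right (π := [])
    (v := shift v.length [virtAt 0, capAt 1 y, capAt 0 x] ++ capAll v)
    (by
      have e := (show Run [virtAt 0] [y, x, !y, !x] [x, y, !y, !x] by
        simp [run_iff, run, Kind.actAt, Kind.act]).shift v
      have e := (e.tail (v.map (!·))).append (τ := v ++ [x, y, !y, !x] ++ v.map (!·)) (ρ := [])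
        (by simpa using run_caps y x v)
      simpa using e)
  have h₄ := (((cap_rotate_mode h).shift v).tail (v.map (!·))).comp
    (ρ := x :: y :: v ++ (!y) :: (!x) :: v.map (!·)) (π := [])
    (u := passBlock 2 v.length) (v := capAll v)
    (by simpa using (run_passBlock [x, y] v).tail ((!y) :: (!x) :: v.map (!·)))
    (by simpa using run_capAll v)
  have h₅ := ((block_mode none true x y v).tail ((!x) :: (!y) :: v.map (!·))).append_left
    (ρ := x :: y :: v ++ (!y) :: (!x) :: v.map (!·))
    (u := shift (x :: y :: v).length [⟨a.reflect.switch, 0⟩])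
    ((hs.shift (x :: y :: v)).tail (v.map (!·)) |> fun e => by simpa using e)
  have h₅ := h₅.append_right (π := []) (v := shift v.length [capAt 1 x, capAt 0 y] ++ capAll v)
    (by simpa using run_caps x y v)
  have h₆ := (interchange ((run_passBlock [x, y] v).append
    (by simpa [modeAt] using ((run_modeAt none true x y).shift v))) hs).tail (v.map (!·))
  have h₆ := h₆.append_right (π := []) (v := shift v.length [capAt 1 x, capAt 0 y] ++ capAll v)
    (by simpa using run_caps x y v)
  have h₇ := (capAll_two x y v).append_left (ρ := x :: y :: v ++ (!y) :: (!x) :: v.map (!·))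
    (u := shift (x :: y :: v).length [⟨a.reflect.switch, 0⟩])
    (by simpa using (hs.shift (x :: y :: v)).tail (v.map (!·)))
  rw [hm] at h₁ h₄ ⊢
  have hv : ∀ k, modeAt k none true = [virtAt k] := fun _ => rfl
  simp only [sWord_single, hv, List.append_assoc, List.cons_append, List.nil_append,
    shift_append, shift_cons, shift_nil, List.length_append, List.length_cons, List.length_nil,
    Nat.add_zero, Nat.zero_add, shift_modeAt, Nat.add_assoc, Nat.reduceAdd]
    at h₁ h₂ h₃ h₄ h₅ h₆ h₇ ⊢
  -- Up to `h₄` the crossing has been turned; `h₆` lowers it to the bottom, and `h₅`, `h₇` backwards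
  -- restore the parallel arcs.
  exact ((h₁.trans (h₂.trans (h₃.trans h₄))).trans h₆).trans (h₅.symm.trans h₇.symm)

/-- For an extremal point, its legs are taken under nested arcs, where a zigzag between the point
and one of the arcs straightens. The virtual crossing from `capAll_two` is absorbed by a minimal or
maximal point. -/
theorem capAll_leftmost {a : Kind} {l m : List Bool} (h : a.Acts l m) (hb : a ≠ .bar)
    (v : List Bool) :
    VEqv (l ++ v ++ (m ++ v).map (!·)) [] (virtConj [⟨a, 0⟩] ++ capAll (m ++ v))
      (shift (l ++ v).length (sWord [⟨a, 0⟩]) ++ capAll (l ++ v)) := by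
  cases h with
  | cup d =>
    have h₁ := (capAll_two d (!d) v).append_left (ρ := v ++ (!d) :: (!!d) :: v.map (!·))
      (u := [cupAt 0 d]) (by simp [run_iff, run, Kind.actAt, Kind.act])
    have h₂ := ((cup_virt d).tail (v ++ (!d) :: (!!d) :: v.map (!·))).append_right
      (run_block_caps d (!d) v)
    have h₃ := ((block_cup (!d) v).tail ((!d) :: (!!d) :: v.map (!·))).append_right (π := [])
      (v := shift v.length [capAt 1 d, capAt 0 (!d)] ++ capAll v)
      (by simpa using run_caps d (!d) v)
    have h₄ := ((cup_cap_cap d).shift v).tail (v.map (!·)) |>.append_right (π := [])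
      (v := capAll v) (by simpa using run_capAll v)
    simp only [sWord_single, Kind.reflect, Kind.switch, virtConj, List.flatMap_cons,
      List.flatMap_nil, List.append_assoc, List.cons_append, List.nil_append, List.append_nil,
      shift_cons, shift_nil, Nat.add_zero, Bool.not_not, List.map_cons] at h₁ h₂ h₃ h₄ ⊢
    exact h₁.trans (h₂.trans (h₃.trans h₄))
  | cap d =>
    have h₁ := (capAll_two d (!d) v).append_left (ρ := d :: (!d) :: v ++ v.map (!·))
      (u := shift (d :: (!d) :: v).length [cupAt 0 (!d)])
      (by
        have := ((show Run [cupAt 0 (!d)] [] [!d, !!d] from .single (.cup _) [] []).shift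
          (d :: (!d) :: v)).tail (v.map (!·))
        simpa using this)
    have h₂ := (interchange ((run_virt d (!d) v).append (run_passBlock [!d, d] v))
      (show Run [cupAt 0 (!d)] [] [!d, !!d] from .single (.cup _) [] [])).tail (v.map (!·))
      |>.append_right (π := []) (v := shift v.length [capAt 1 d, capAt 0 (!d)] ++ capAll v)
      (by simpa using run_caps d (!d) v)
    have h₃ := ((cup_cap_cap' d).shift v).tail (v.map (!·)) |>.comp (π := [])
      (ρ := d :: (!d) :: v ++ v.map (!·)) (u := [virtAt 0] ++ passBlock 2 v.length)
      (v := capAll v)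
      (((run_virt d (!d) v).append (run_passBlock [!d, d] v)).tail (v.map (!·)))
      (by simpa using run_capAll v)
    have h₄ := ((block_cap (!d) v).tail (v.map (!·))).comp (ρ := d :: (!d) :: v ++ v.map (!·))
      (by simpa using run_virt d (!d) (v ++ v.map (!·))) (run_capAll v)
    have h₅ := ((cap_virt (!d)).tail (v ++ v.map (!·))).append_right (run_capAll v)
    simp only [sWord_single, Kind.reflect, Kind.switch, virtConj, List.flatMap_cons,
      List.flatMap_nil, List.append_assoc, List.cons_append, List.nil_append, List.append_nil,
      shift_cons, shift_nil, Nat.add_zero, Bool.not_not, List.length_append, List.length_cons,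
      List.length_nil, Nat.add_assoc, Nat.reduceAdd] at h₁ h₂ h₃ h₄ h₅ ⊢
    exact (h₁.trans (h₂.symm.trans (h₃.trans (h₄.trans h₅)))).symm
  | cross o x y => exact capAll_crossing (.cross o x y) v
  | virt x y => exact capAll_crossing (.virt x y) v
  | bar x => exact absurd rfl hb

theorem noBar_virtConj_single {a : Kind} (hb : a ≠ .bar) (k : ℕ) : NoBar (virtConj [⟨a, k⟩]) :=
  noBar_virtConj (by simpa using hb)

/-- A strand to the left of the event starts by passing all other strands virtually, so by the
detour move it passes the event as well. This reduces the claim to a leftmost event. -/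
theorem capAll_single {a : Kind} {l m : List Bool} (h : a.Acts l m) (hb : a ≠ .bar)
    (u v : List Bool) :
    VEqv (u ++ l ++ v ++ (u ++ m ++ v).map (!·)) []
      (virtConj [⟨a, u.length⟩] ++ capAll (u ++ m ++ v))
      (shift (u ++ l ++ v).length (sWord [⟨a, u.length⟩]) ++ capAll (u ++ l ++ v)) := by
  induction u with
  | nil => exact capAll_leftmost h hb v
  | cons x u ih =>
    have hr := (Run.single h u v).virtConj
    have hs := (Run.single h u v).sWord
    have hv : virtConj [⟨a, (x :: u).length⟩] = shift 1 (virtConj [⟨a, u.length⟩]) := by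
      rw [← virtConj_shift]; simp [Nat.add_comm]
    have hs' : sWord [⟨a, (x :: u).length⟩] = shift 1 (sWord [⟨a, u.length⟩]) := by
      simp [Nat.add_comm]
    rw [hv, hs']
    simp only [List.cons_append, capAll, List.length_cons]
    generalize u ++ l ++ v = σ at *
    generalize u ++ m ++ v = ρ at *
    have h₁ := (detour hr (noBar_virtConj_single hb _) x).tail ((!x) :: ρ.map (!·))
      |>.append_right (π := []) (v := [capAt ρ.length x] ++ capAll ρ)
      (by
        have := (((run_cap x).shift ρ).tail (ρ.map (!·)))
        rw [List.append_nil] at this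
        have := this.append (run_capAll ρ)
        simpa using this)
    have h₂ := (interchange hr (run_cap x)).tail (ρ.map (!·)) |>.comp (π := [])
      (ρ := x :: σ ++ (!x) :: ρ.map (!·)) (u := pass σ.length) (v := capAll ρ)
      (by simpa using (run_pass x σ).tail ((!x) :: ρ.map (!·)))
      (by simpa using run_capAll ρ)
    have h₃ := ih.append_left (ρ := x :: σ ++ (!x) :: ρ.map (!·))
      (u := pass σ.length ++ [capAt σ.length x])
      (by simpa using (run_pass_cap x σ).tail (ρ.map (!·)))
    have h₄ := (interchange (run_pass_cap x σ) hs).append_right (run_capAll σ)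
    simp only [List.append_assoc, List.cons_append, List.nil_append, shift_cons, shift_nil,
      shift_shift, Nat.add_zero, List.length_append, List.length_cons, List.length_nil,
      List.map_cons, Nat.zero_add] at h₁ h₂ h₃ h₄ ⊢
    exact h₁.trans (h₂.trans (h₃.trans h₄))

/-- The word is slid over the arcs, from their left feet to their right feet, event by event. This
turns it upside down. Since the arcs join the first foot to the first, the second to the second, and
so on, left and right are kept; the result is a reflection along a horizontal line and not a
rotation. -/
theorem capAll_run {w : Word} {σ τ : List Bool} (h : Run w σ τ) (hw : NoBar w) :
    VEqv (σ ++ τ.map (!·)) [] (virtConj w ++ capAll τ)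
      (shift σ.length (sWord w) ++ capAll σ) := by
  induction h with
  | nil => exact .refl _
  | cons a l m u v τ w h hr ih =>
    rw [noBar_cons] at hw
    have h₁ := (ih hw.2).append_left (((Run.single h u v).virtConj).tail (τ.map (!·)))
    have h₂ := (interchange (Run.single h u v).virtConj hr.sWord).append_right
      (run_capAll (u ++ m ++ v))
    have h₃ := (capAll_single h hw.1 u v).append_left ((hr.sWord).shift (u ++ l ++ v))
    rw [virtConj_cons, ← List.singleton_append (l := w), sWord_append, shift_append]
    simp only [List.append_assoc] at h₁ h₂ h₃ ⊢
    exact h₁.trans (h₂.trans h₃)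

/-- A closed word has no strands at its ends, so there are no arcs, and only the effect on the word
is left. -/
theorem virtConj_eqv_sWord {w : Word} (h : Run w [] []) (hw : NoBar w) :
    VEqv [] [] (virtConj w) (sWord w) := by
  simpa [capAll] using capAll_run h hw

/-! ### The diagram `s(D)` by bars -/

/-- Bars on all of `n` strands. -/
def barAll : ℕ → Word
  | 0 => []
  | n + 1 => barAt 0 :: shift 1 (barAll n)

theorem barAll_add (m n : ℕ) : barAll (m + n) = barAll m ++ shift m (barAll n) := by
  induction m with
  | zero => simp [barAll]
  | succ m ih => rw [Nat.succ_add, barAll, ih, barAll]; simp [shift_shift, Nat.add_comm]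

theorem run_barAll (ρ : List Bool) : Run (barAll ρ.length) ρ ρ := by
  induction ρ with
  | nil => exact .nil _
  | cons x ρ ih => exact ((Run.single (.bar x) [] []).tail ρ).append (ih.shift_one x)

theorem TwistedMove.eqv {l r : Word} {σ τ : List Bool} (h : TwistedMove l r) (u v : Word)
    (hl : Run (u ++ l ++ v) σ τ) (hr : Run (u ++ r ++ v) σ τ) :
    TEqv σ τ (u ++ l ++ v) (u ++ r ++ v) :=
  .rel _ _ ⟨hl, hr, u, v, l, r, .inr h, rfl, rfl⟩

/-- At an extremal point one bar slides to the other leg and cancels there. For a virtual crossing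
this is T1 on both strands. For a classical crossing it is T3, after the bars on top cancel against
those added. -/
theorem bars_local {a : Kind} {l m : List Bool} (h : a.Acts l m) (hb : a ≠ .bar) :
    TEqv l m ([⟨a, 0⟩] ++ barAll m.length) (barAll l.length ++ virtConj [⟨a, 0⟩]) := by
  have exch : ∀ x y, TEqv [x, y] [x, y] [barAt 0, barAt 1] [barAt 1, barAt 0] := fun x y =>
    (interchange (Run.single (.bar x) [] []) (Run.single (.bar y) [] [])).twisted
  have two : ∀ x y, TEqv [x, y] [x, y] [barAt 0, barAt 1, barAt 0, barAt 1] [] := by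
    intro x y
    have h₁ := ((exch x y).append_left (ρ := [x, y]) (u := [barAt 0, barAt 1])
      (by simp [run_iff, run, Kind.actAt, Kind.act]))
    have h₂ := (TwistedMove.T2 1).eqv [barAt 0] [barAt 0] (σ := [x, y]) (τ := [x, y])
      (by simp [run_iff, run, Kind.actAt, Kind.act]) (by simp [run_iff, run, Kind.actAt, Kind.act])
    have h₃ := (TwistedMove.T2 0).eqv [] [] (σ := [x, y]) (τ := [x, y])
      (by simp [run_iff, run, Kind.actAt, Kind.act]) (by simp [run_iff, run])
    exact h₁.trans (h₂.trans h₃)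
  cases h with
  | cup d =>
    have h₁ : VEqv [] [d, !d] [cupAt 0 d, barAt 0, barAt 1] [cupAt 0 d, barAt 1, barAt 1] :=
      .rel _ _ ⟨by simp [run_iff, run, Kind.actAt, Kind.act],
        by simp [run_iff, run, Kind.actAt, Kind.act],
        [], [barAt 1], _, _, .inl (.bar_cup 0 d), rfl, rfl⟩
    have h₂ := (TwistedMove.T2 1).eqv [cupAt 0 d] [] (σ := []) (τ := [d, !d])
      (by simp [run_iff, run, Kind.actAt, Kind.act]) (by simp [run_iff, run, Kind.actAt, Kind.act])
    exact h₁.twisted.trans h₂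
  | cap d =>
    have h₁ := (exch d (!d)).append_right (run_cap d)
    have h₂ : VEqv [d, !d] [] [barAt 1, barAt 0, capAt 0 d] [barAt 1, barAt 1, capAt 0 d] :=
      .rel _ _ ⟨by simp [run_iff, run, Kind.actAt, Kind.act],
        by simp [run_iff, run, Kind.actAt, Kind.act],
        [barAt 1], [], _, _, .inl (.bar_cap 0 d), rfl, rfl⟩
    have h₃ := (TwistedMove.T2 1).eqv [] [capAt 0 d] (σ := [d, !d]) (τ := [])
      (by simp [run_iff, run, Kind.actAt, Kind.act]) (by simp [run_iff, run, Kind.actAt, Kind.act])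
    exact (h₁.trans (h₂.twisted.trans h₃)).symm
  | cross o x y =>
    have h₁ := (TwistedMove.T3 0 o).eqv [] [barAt 0, barAt 1] (σ := [x, y]) (τ := [y, x])
      (by simp [run_iff, run, Kind.actAt, Kind.act]) (by simp [run_iff, run, Kind.actAt, Kind.act])
    have h₂ := (two y x).append_left (ρ := [x, y])
      (u := [barAt 0, barAt 1, virtAt 0, crossAt 0 o, virtAt 0])
      (by simp [run_iff, run, Kind.actAt, Kind.act])
    exact h₁.symm.trans h₂
  | virt x y =>
    have h₁ := (exch y x).append_left (ρ := [x, y]) (u := [virtAt 0])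
      (by simp [run_iff, run, Kind.actAt, Kind.act])
    have h₂ := (TwistedMove.T1_left 0).eqv [] [barAt 0] (σ := [x, y]) (τ := [y, x])
      (by simp [run_iff, run, Kind.actAt, Kind.act]) (by simp [run_iff, run, Kind.actAt, Kind.act])
    have h₃ := (TwistedMove.T1_right 0).eqv [barAt 0] [] (σ := [x, y]) (τ := [y, x])
      (by simp [run_iff, run, Kind.actAt, Kind.act]) (by simp [run_iff, run, Kind.actAt, Kind.act])
    exact h₁.trans (h₂.symm.trans h₃.symm)
  | bar x => exact absurd rfl hb

theorem bars_single {a : Kind} {l m : List Bool} (h : a.Acts l m) (hb : a ≠ .bar)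
    (u v : List Bool) :
    TEqv (u ++ l ++ v) (u ++ m ++ v) ([⟨a, u.length⟩] ++ barAll (u ++ m ++ v).length)
      (barAll (u ++ l ++ v).length ++ virtConj [⟨a, u.length⟩]) := by
  have ha : Run [⟨a, 0⟩] l m := by simpa using Run.single h [] []
  have hv : virtConj [⟨a, u.length⟩] = shift u.length (virtConj [⟨a, 0⟩]) := by
    rw [← virtConj_shift]; simp
  have hr : Run (shift u.length (barAll m.length ++ shift m.length (barAll v.length)))
      (u ++ m ++ v) (u ++ m ++ v) := by
    simpa using (((run_barAll m).tail v).append ((run_barAll v).shift m)).shift u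
  have h₁ := ((interchange (run_barAll u) ha).tail v).append_right hr
  have h₂ := (((bars_local h hb).tail v).shift_twisted u).comp (ρ := u ++ l ++ v)
    (π := u ++ m ++ v) (u := barAll u.length) (v := shift u.length (shift m.length (barAll v.length)))
    (by simpa using (run_barAll u).tail (l ++ v))
    (by simpa using ((run_barAll v).shift m).shift u)
  have h₃ := ((interchange ha.virtConj (run_barAll v)).shift u).append_left (ρ := u ++ l ++ v)
    (u := barAll u.length ++ shift u.length (barAll l.length))
    (by
      have e₁ := (run_barAll u).tail (l ++ v)
      have e₂ := ((run_barAll l).tail v).shift u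
      simpa using e₁.append e₂)
  rw [hv]
  simp only [List.length_append, barAll_add]
  simp only [List.append_assoc, List.cons_append, List.nil_append, shift_append, shift_cons,
    shift_nil, shift_shift, Nat.add_zero] at h₁ h₂ h₃ ⊢
  exact h₁.twisted.symm.trans (h₂.trans h₃.twisted)

/-- The layer of bars is pushed down event by event and conjugates each classical crossing it
passes. For a closed word both layers are empty, which makes `virtConj` a twisted equivalence. -/
theorem bars_run {w : Word} {σ τ : List Bool} (h : Run w σ τ) (hw : NoBar w) :
    TEqv σ τ (w ++ barAll τ.length) (barAll σ.length ++ virtConj w) := by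
  induction h with
  | nil => simpa using Eqv.refl _
  | cons a l m u v τ w h hr ih =>
    rw [noBar_cons] at hw
    have h₁ := (ih hw.2).append_left (Run.single h u v)
    have h₂ := (bars_single h hw.1 u v).append_right hr.virtConj
    rw [virtConj_cons]
    simp only [List.append_assoc, List.cons_append, List.nil_append] at h₁ h₂ ⊢
    exact h₁.trans h₂

/-- A virtual link diagram `D` and `s(D)` are equivalent as twisted link diagrams. -/
theorem eqv_sWord {w : Word} (h : Run w [] []) (hw : NoBar w) : TEqv [] [] w (sWord w) := by
  have := bars_run h hw
  simp only [List.length_nil, barAll, List.append_nil, List.nil_append] at this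
  exact this.trans (virtConj_eqv_sWord h hw).twisted

end

end TwistedLinks

namespace TwistedLinks

section

/-! ### Labelled words and their images -/

/-- A rule for reading off a word from a word with labelled strands: which strands are kept, and
the modes of the crossings between strands with given labels. -/
@[ext]
structure Datum (X : Type) where
  keep : X → Bool
  mode : X → X → Option Bool

variable {X : Type}

/-- The directions of the strands that are kept. -/
def Datum.kept (δ : Datum X) : List (X × Bool) → List Bool
  | [] => []
  | p :: σ => if δ.keep p.1 then p.2 :: δ.kept σ else δ.kept σ

@[simp] theorem Datum.kept_nil (δ : Datum X) : δ.kept [] = [] := rfl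

theorem Datum.kept_cons (δ : Datum X) (p : X × Bool) (σ : List (X × Bool)) :
    δ.kept (p :: σ) = if δ.keep p.1 then p.2 :: δ.kept σ else δ.kept σ := rfl

/-- `LAct flip a k σ τ F`: the event `a` at position `k` takes the labelled strands `σ` to `τ`, and
its image under `δ` is `F δ`.  Bars change the labels by `flip`. -/
inductive LAct (flip : X → X) :
    Kind → ℕ → List (X × Bool) → List (X × Bool) → (Datum X → Word) → Prop
  | cup (d : Bool) (x : X) (σ : List (X × Bool)) :
      LAct flip (.cup d) 0 σ ((x, d) :: (x, !d) :: σ)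
        (fun δ => if δ.keep x then [cupAt 0 d] else [])
  | cap (d : Bool) (x : X) (σ : List (X × Bool)) :
      LAct flip (.cap d) 0 ((x, d) :: (x, !d) :: σ) σ
        (fun δ => if δ.keep x then [capAt 0 d] else [])
  | cross (o : Bool) (p q : X × Bool) (σ : List (X × Bool)) :
      LAct flip (.cross o) 0 (p :: q :: σ) (q :: p :: σ)
        (fun δ => if δ.keep p.1 && δ.keep q.1 then modeAt 0 (δ.mode p.1 q.1) o else [])
  | virt (p q : X × Bool) (σ : List (X × Bool)) :
      LAct flip .virt 0 (p :: q :: σ) (q :: p :: σ)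
        (fun δ => if δ.keep p.1 && δ.keep q.1 then [virtAt 0] else [])
  | bar (x : X) (d : Bool) (σ : List (X × Bool)) :
      LAct flip .bar 0 ((x, d) :: σ) ((flip x, d) :: σ) (fun _ => [])
  | succ (a : Kind) (k : ℕ) (p : X × Bool) (σ τ : List (X × Bool)) (F : Datum X → Word)
      (h : LAct flip a k σ τ F) :
      LAct flip a (k + 1) (p :: σ) (p :: τ)
        (fun δ => if δ.keep p.1 then shift 1 (F δ) else F δ)

/-- `Img flip w σ τ F`: the word `w` takes the labelled strands `σ` to `τ`, and its image under
`δ` is `F δ`. -/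
inductive Img (flip : X → X) :
    Word → List (X × Bool) → List (X × Bool) → (Datum X → Word) → Prop
  | nil (σ : List (X × Bool)) : Img flip [] σ σ (fun _ => [])
  | cons (a : Kind) (k : ℕ) (w : Word) (σ ρ τ : List (X × Bool)) (F G : Datum X → Word)
      (h : LAct flip a k σ ρ F) (hw : Img flip w ρ τ G) :
      Img flip (⟨a, k⟩ :: w) σ τ (fun δ => F δ ++ G δ)

variable {flip : X → X} {a : Kind} {k : ℕ} {w w' : Word} {σ τ ρ : List (X × Bool)}
  {F G : Datum X → Word}

theorem Img.append (h : Img flip w σ ρ F) (h' : Img flip w' ρ τ G) :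
    Img flip (w ++ w') σ τ (fun δ => F δ ++ G δ) := by
  induction h with
  | nil => exact h'
  | cons a k w σ ρ τ F G₁ h hw ih =>
    have := Img.cons a k _ σ ρ _ F _ h (ih h')
    simpa using this

theorem img_append (h : Img flip (w ++ w') σ τ F) :
    ∃ ρ F₁ F₂, Img flip w σ ρ F₁ ∧ Img flip w' ρ τ F₂ ∧ ∀ δ, F δ = F₁ δ ++ F₂ δ := by
  induction w generalizing σ F with
  | nil => exact ⟨σ, _, F, .nil σ, h, fun _ => rfl⟩
  | cons p w ih =>
    cases h with
    | cons a k _ _ ρ _ F G h hw =>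
      obtain ⟨ρ', F₁, F₂, h₁, h₂, h₃⟩ := ih hw
      exact ⟨ρ', _, F₂, .cons a k w σ ρ ρ' F F₁ h h₁, h₂, fun δ => by simp [h₃]⟩

theorem LAct.run_dirs (h : LAct flip a k σ τ F) :
    Run [⟨a, k⟩] (σ.map Prod.snd) (τ.map Prod.snd) := by
  induction h with
  | succ a k p σ τ F h ih => simpa [Nat.add_comm] using ih.shift_one p.2
  | _ => simp [run_iff, run, Kind.actAt, Kind.act]

theorem Img.run_dirs (h : Img flip w σ τ F) : Run w (σ.map Prod.snd) (τ.map Prod.snd) := by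
  induction h with
  | nil => exact .nil _
  | cons a k w σ ρ τ F G h hw ih => exact h.run_dirs.append ih

/-- A bar leaves no trace in the image but changes the label. The image still fits only if a label
and its flip are both kept or both removed. -/
theorem LAct.run (h : LAct flip a k σ τ F) (δ : Datum X)
    (hb : a ≠ .bar ∨ ∀ x, δ.keep (flip x) = δ.keep x) : Run (F δ) (δ.kept σ) (δ.kept τ) := by
  induction h with
  | cup d x σ =>
    simp only [Datum.kept_cons]
    split
    · exact (Run.single (.cup d) [] []).tail _
    · exact .nil _
  | cap d x σ =>
    simp only [Datum.kept_cons]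
    split
    · exact (Run.single (.cap d) [] []).tail _
    · exact .nil _
  | cross o p q σ =>
    simp only [Datum.kept_cons]
    cases δ.keep p.1 <;> cases δ.keep q.1
    · exact .nil _
    · exact .nil _
    · exact .nil _
    · exact (run_modeAt _ o p.2 q.2).tail _
  | virt p q σ =>
    simp only [Datum.kept_cons]
    cases δ.keep p.1 <;> cases δ.keep q.1
    · exact .nil _
    · exact .nil _
    · exact .nil _
    · exact run_virt p.2 q.2 _
  | bar x d σ =>
    rw [Datum.kept_cons, Datum.kept_cons, (hb.resolve_left (by simp)) x]
    exact .nil _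
  | succ a k p σ τ F h ih =>
    simp only [Datum.kept_cons]
    split
    · exact (ih hb).shift_one p.2
    · exact ih hb

theorem Img.run (h : Img flip w σ τ F) (δ : Datum X)
    (hb : NoBar w ∨ ∀ x, δ.keep (flip x) = δ.keep x) : Run (F δ) (δ.kept σ) (δ.kept τ) := by
  induction h with
  | nil => exact .nil _
  | cons a k w σ ρ τ F G h hw ih =>
    simp only [noBar_cons] at hb
    exact (h.run δ (hb.imp_left And.left)).append (ih (hb.imp_left And.right))

theorem LAct.noBar (h : LAct flip a k σ τ F) (δ : Datum X) : NoBar (F δ) := by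
  induction h with
  | cup d x σ => dsimp only; split <;> simp
  | cap d x σ => dsimp only; split <;> simp
  | cross o p q σ => dsimp only; split <;> simp [noBar_modeAt]
  | virt p q σ => dsimp only; split <;> simp
  | bar x d σ => simp
  | succ a k p σ τ F h ih => dsimp only; split <;> simpa

theorem Img.noBar (h : Img flip w σ τ F) (δ : Datum X) : NoBar (F δ) := by
  induction h with
  | nil => simp
  | cons a k w σ ρ τ F G h hw ih => exact noBar_append.2 ⟨h.noBar δ, ih⟩

/-! ### Separating the strands whose labels have a property -/

/-- The datum which keeps only strands whose labels satisfy `P`. -/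
def Datum.restrict (δ : Datum X) (P : X → Bool) : Datum X := ⟨fun x => δ.keep x && P x, δ.mode⟩

@[simp] theorem Datum.restrict_keep (δ : Datum X) (P : X → Bool) (x : X) :
    (δ.restrict P).keep x = (δ.keep x && P x) := rfl

@[simp] theorem Datum.restrict_mode (δ : Datum X) (P : X → Bool) (x y : X) :
    (δ.restrict P).mode x y = δ.mode x y := rfl

/-- The strands whose labels satisfy `P` are moved to the left, by virtual crossings. -/
def sortWord (δ : Datum X) (P : X → Bool) : List (X × Bool) → Word
  | [] => []
  | p :: σ =>
    if δ.keep p.1 then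
      if P p.1 then shift 1 (sortWord δ P σ)
      else shift 1 (sortWord δ P σ) ++ pass ((δ.restrict P).kept σ).length
    else sortWord δ P σ

theorem run_sortWord (δ : Datum X) (P : X → Bool) (σ : List (X × Bool)) :
    Run (sortWord δ P σ) (δ.kept σ)
      ((δ.restrict P).kept σ ++ (δ.restrict fun x => !P x).kept σ) := by
  induction σ with
  | nil => exact .nil _
  | cons p σ ih =>
    cases h : δ.keep p.1
    · simpa [sortWord, Datum.kept_cons, h] using ih
    · cases h' : P p.1
      · have := (ih.shift_one p.2).append
          ((run_pass p.2 ((δ.restrict P).kept σ)).tail ((δ.restrict fun x => !P x).kept σ))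
        simpa [sortWord, Datum.kept_cons, h, h'] using this
      · simpa [sortWord, Datum.kept_cons, h, h'] using ih.shift_one p.2

/-- If both strands belong to the same class, the crossing moves along with them. If not, it is
virtual: either it already is the crossing which the sorting of the lower strands makes, or it
cancels by V2 against the one which the sorting of the upper strands makes. -/
theorem sort_crossing (δ : Datum X) (P : X → Bool) (p q : X × Bool) (σ : List (X × Bool))
    (m : Option Bool) (o : Bool) (hm : δ.keep p.1 → δ.keep q.1 → P p.1 ≠ P q.1 → m = none) :
    VEqv (δ.kept (p :: q :: σ))
      ((δ.restrict P).kept (q :: p :: σ) ++ (δ.restrict fun x => !P x).kept (q :: p :: σ))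
      ((if δ.keep p.1 && δ.keep q.1 then modeAt 0 m o else []) ++ sortWord δ P (q :: p :: σ))
      (sortWord δ P (p :: q :: σ) ++
        ((if (δ.restrict P).keep p.1 && (δ.restrict P).keep q.1 then modeAt 0 m o else []) ++
          shift ((δ.restrict P).kept (q :: p :: σ)).length
            (if (δ.restrict fun x => !P x).keep p.1 && (δ.restrict fun x => !P x).keep q.1
              then modeAt 0 m o else []))) := by
  have hS := run_sortWord δ P σ
  obtain ⟨x, d⟩ := p
  obtain ⟨y, e⟩ := q
  dsimp only at hm
  cases hp : δ.keep x <;> cases hq : δ.keep y <;>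
    simp only [hp, hq, forall_const, Bool.false_eq_true, false_implies] at hm
  · simpa [sortWord, Datum.kept_cons, hp, hq] using Eqv.refl _
  · simpa [sortWord, Datum.kept_cons, hp, hq] using Eqv.refl _
  · simpa [sortWord, Datum.kept_cons, hp, hq] using Eqv.refl _
  · have h₁ := interchange (run_modeAt m o d e) hS
    cases hP : P x <;> cases hQ : P y
    · have h₁ := h₁.append_right (π := (δ.restrict P).kept σ ++ e :: d :: (δ.restrict fun x => !P x).kept σ)
        (v := shift 1 (pass ((δ.restrict P).kept σ).length) ++ pass ((δ.restrict P).kept σ).length)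
        (by
          have e₁ := (run_pass d ((δ.restrict P).kept σ)).shift_one e
          have e₂ := (run_pass e ((δ.restrict P).kept σ)).tail [d]
          simpa using (e₁.append e₂).tail ((δ.restrict fun x => !P x).kept σ))
      have hS' := hS.shift [d, e]
      have h₂ := ((passBlock_two e d ((δ.restrict P).kept σ)).tail
        ((δ.restrict fun x => !P x).kept σ)).append_left (hS'.append ((run_modeAt m o d e).tail _))
      have h₃ := ((block_mode m o d e ((δ.restrict P).kept σ)).tail
        ((δ.restrict fun x => !P x).kept σ)).append_left hS'
      have h₄ := ((passBlock_two d e ((δ.restrict P).kept σ)).tail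
        ((δ.restrict fun x => !P x).kept σ)).comp hS'
        (π := (δ.restrict P).kept σ ++ e :: d :: (δ.restrict fun x => !P x).kept σ)
        (v := modeAt ((δ.restrict P).kept σ).length m o)
        (by
          have e₁ := (run_modeAt m o d e).shift ((δ.restrict P).kept σ)
          simpa using e₁.tail ((δ.restrict fun x => !P x).kept σ))
      simp [sortWord, Datum.kept_cons, hp, hq, hP, hQ, shift_shift] at h₁ h₂ h₃ h₄ ⊢
      exact h₁.trans (h₂.symm.trans (h₃.trans h₄))
    · obtain rfl := hm (by simp [hP, hQ])
      have h₁ := h₁.append_right (π := e :: (δ.restrict P).kept σ ++ d :: (δ.restrict fun x => !P x).kept σ)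
        (v := shift 1 (pass ((δ.restrict P).kept σ).length))
        (by
          have e₁ := (run_pass d ((δ.restrict P).kept σ)).shift_one e
          simpa using e₁.tail ((δ.restrict fun x => !P x).kept σ))
      simpa [sortWord, Datum.kept_cons, hp, hq, hP, hQ, shift_shift, pass, modeAt] using h₁
    · obtain rfl := hm (by simp [hP, hQ])
      have h₁ := h₁.append_right (π := d :: (δ.restrict P).kept σ ++ e :: (δ.restrict fun x => !P x).kept σ)
        (v := virtAt 0 :: shift 1 (pass ((δ.restrict P).kept σ).length))
        (by
          have e₁ := ((run_pass e ((δ.restrict P).kept σ)).shift_one d).tail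
            ((δ.restrict fun x => !P x).kept σ)
          simpa using (run_virt e d _).append (by simpa using e₁))
      have h₂ := ((mode_R2 none o d e).tail _).comp (hS.shift [d, e])
        (((run_pass e ((δ.restrict P).kept σ)).shift_one d).tail
            ((δ.restrict fun x => !P x).kept σ))
      simp [sortWord, Datum.kept_cons, hp, hq, hP, hQ, shift_shift, pass, modeAt] at h₁ h₂ ⊢
      exact h₁.trans h₂
    · simpa [sortWord, Datum.kept_cons, hp, hq, hP, hQ, shift_shift] using h₁

/-- The sorting of the strands is pushed down through an event, which afterwards lives in one of the
two blocks. In the step for a strand on the left that belongs to the right block, this strand has to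
pass the event of the left block; that is the detour move. -/
theorem LAct.sort (h : LAct flip a k σ τ F) (ha : a ≠ .bar) (δ : Datum X) (P : X → Bool)
    (hmode : ∀ x y, δ.keep x → δ.keep y → P x ≠ P y → δ.mode x y = none) :
    VEqv (δ.kept σ) ((δ.restrict P).kept τ ++ (δ.restrict fun x => !P x).kept τ)
      (F δ ++ sortWord δ P τ)
      (sortWord δ P σ ++ (F (δ.restrict P) ++
        shift ((δ.restrict P).kept τ).length (F (δ.restrict fun x => !P x)))) := by
  induction h with
  | succ a k p σ τ F h ih =>
    have ih := ih ha
    have r₁ := h.run (δ.restrict P) (.inl ha)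
    have n₁ := h.noBar (δ.restrict P)
    have r₂ := h.run (δ.restrict fun x => !P x) (.inl ha)
    have i₁ := run_sortWord δ P σ
    cases hk : δ.keep p.1
    · simpa [Datum.kept_cons, Datum.restrict, sortWord, hk] using ih
    · cases hP : P p.1
      · have h₁ := (ih.shift_one p.2).append_right
          ((run_pass p.2 ((δ.restrict P).kept τ)).tail ((δ.restrict fun x => !P x).kept τ))
        have h₂ := (interchange (run_pass p.2 ((δ.restrict P).kept τ)) r₂).append_left
          ((i₁.shift_one p.2).append ((r₁.shift_one p.2).tail _))
        have h₃ := ((detour r₁ n₁ p.2).tail ((δ.restrict fun x => !P x).kept σ)).comp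
          (i₁.shift_one p.2) (r₂.shift ((δ.restrict P).kept τ ++ [p.2]))
        simp [Datum.kept_cons, sortWord, hk, hP, shift_shift, Nat.add_comm 1] at h₁ h₂ h₃ ⊢
        exact h₁.trans (h₂.symm.trans h₃)
      · simpa [Datum.kept_cons, sortWord, hk, hP, shift_shift, Nat.add_comm]
          using ih.shift_one p.2
  | cup d x σ =>
    have hS := run_sortWord δ P σ
    have hc : Run [cupAt 0 d] [] [d, !d] := .single (.cup d) [] []
    cases hk : δ.keep x
    · simpa [Datum.kept_cons, sortWord, hk] using Eqv.refl _
    · have h₁ := interchange hc hS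
      cases hP : P x
      · have h₁ := h₁.append_right
          (π := (δ.restrict P).kept σ ++ d :: (!d) :: (δ.restrict fun x => !P x).kept σ)
          (v := shift 1 (pass ((δ.restrict P).kept σ).length) ++
            pass ((δ.restrict P).kept σ).length)
          (by
            have e₁ := (run_pass (!d) ((δ.restrict P).kept σ)).shift_one d
            have e₂ := (run_pass d ((δ.restrict P).kept σ)).tail [!d]
            simpa using (e₁.append e₂).tail ((δ.restrict fun x => !P x).kept σ))
        have h₂ := ((passBlock_two d (!d) ((δ.restrict P).kept σ)).tail
          ((δ.restrict fun x => !P x).kept σ)).append_left (hS.append (hc.tail _))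
        have h₃ := ((block_cup d ((δ.restrict P).kept σ)).tail
          ((δ.restrict fun x => !P x).kept σ)).append_left hS
        simp [sortWord, Datum.kept_cons, hk, hP, shift_shift] at h₁ h₂ h₃ ⊢
        exact h₁.trans (h₂.symm.trans h₃)
      · simpa [sortWord, Datum.kept_cons, hk, hP, shift_shift] using h₁
  | cap d x σ =>
    have hS := run_sortWord δ P σ
    cases hk : δ.keep x
    · simpa [Datum.kept_cons, sortWord, hk] using Eqv.refl _
    · have h₁ := interchange (run_cap d) hS
      cases hP : P x
      · have hS' := hS.shift [d, !d]
        have h₂ := ((block_cap d ((δ.restrict P).kept σ)).tail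
          ((δ.restrict fun x => !P x).kept σ)).append_left hS'
        have h₃ := ((passBlock_two d (!d) ((δ.restrict P).kept σ)).tail
          ((δ.restrict fun x => !P x).kept σ)).comp hS'
          (π := (δ.restrict P).kept σ ++ (δ.restrict fun x => !P x).kept σ)
          (v := [capAt ((δ.restrict P).kept σ).length d])
          (by
            have e₁ := (run_cap d).shift ((δ.restrict P).kept σ)
            simpa using e₁.tail ((δ.restrict fun x => !P x).kept σ))
        simp [sortWord, Datum.kept_cons, hk, hP, shift_shift] at h₁ h₂ h₃ ⊢
        exact h₁.trans (h₂.symm.trans h₃)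
      · simpa [sortWord, Datum.kept_cons, hk, hP, shift_shift] using h₁
  | cross o p q σ => exact sort_crossing δ P p q σ (δ.mode p.1 q.1) o (hmode p.1 q.1)
  | virt p q σ => exact sort_crossing δ P p q σ none true fun _ _ _ => rfl
  | bar => exact absurd rfl ha

theorem Img.sort (h : Img flip w σ τ F) (hw : NoBar w) (δ : Datum X) (P : X → Bool)
    (hmode : ∀ x y, δ.keep x → δ.keep y → P x ≠ P y → δ.mode x y = none) :
    VEqv (δ.kept σ) ((δ.restrict P).kept τ ++ (δ.restrict fun x => !P x).kept τ)
      (F δ ++ sortWord δ P τ)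
      (sortWord δ P σ ++ (F (δ.restrict P) ++
        shift ((δ.restrict P).kept τ).length (F (δ.restrict fun x => !P x)))) := by
  induction h with
  | nil => simpa using Eqv.refl _
  | cons a k w σ ρ τ F G h hr ih =>
    rw [noBar_cons] at hw
    have h₁ := (ih hw.2).append_left (h.run δ (.inl hw.1))
    have h₂ := (h.sort hw.1 δ P hmode).append_right
      (((hr.run (δ.restrict P) (.inl hw.2)).tail _).append
        ((hr.run (δ.restrict fun x => !P x) (.inl hw.2)).shift _))
    -- Later events of the left block are put below the present event of the right block, so that
    -- each block becomes one word.
    have h₃ := (interchange (hr.run (δ.restrict P) (.inl hw.2))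
      (h.run (δ.restrict fun x => !P x) (.inl hw.1))).comp
      ((run_sortWord δ P σ).append ((h.run (δ.restrict P) (.inl hw.1)).tail _))
      ((hr.run (δ.restrict fun x => !P x) (.inl hw.2)).shift _)
    simp only [List.append_assoc, shift_append] at h₁ h₂ h₃ ⊢
    exact h₁.trans (h₂.trans h₃.symm)

/-- A closed word without bars, in which strands whose labels satisfy `P` cross other strands
virtually, is equivalent to its two parts, put on top of each other. -/
theorem Img.separate (h : Img flip w [] [] F) (hw : NoBar w) (δ : Datum X) (P : X → Bool)
    (hmode : ∀ x y, δ.keep x → δ.keep y → P x ≠ P y → δ.mode x y = none) :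
    VEqv [] [] (F δ) (F (δ.restrict P) ++ F (δ.restrict fun x => !P x)) := by
  simpa [sortWord] using h.sort hw δ P hmode

end

end TwistedLinks

/-! ### Separation into several colours; labels carried along a replacement -/

namespace TwistedLinks

section

variable {X : Type} {flip : X → X} {a : Kind} {k : ℕ} {w w' : Word} {σ τ ρ : List (X × Bool)}
  {F G : Datum X → Word}

theorem LAct.eq_nil (h : LAct flip a k σ τ F) {δ : Datum X} (hδ : ∀ x, δ.keep x = false) :
    F δ = [] := by
  induction h with
  | succ a k p σ τ F h ih => simp [hδ, ih]
  | _ => simp [hδ]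

theorem Img.eq_nil (h : Img flip w σ τ F) {δ : Datum X} (hδ : ∀ x, δ.keep x = false) :
    F δ = [] := by
  induction h with
  | nil => rfl
  | cons a k w σ ρ τ F G h hw ih => simp [h.eq_nil hδ, ih]

/-- A closed word without bars, in which strands of different colours cross virtually, is
equivalent to its parts of one colour, put on top of each other. -/
theorem Img.separate_colours {Y : Type} [DecidableEq Y] (h : Img flip w [] [] F) (hw : NoBar w)
    (c : X → Y) (l : List Y) (hl : l.Nodup) (δ : Datum X) (hδ : ∀ x, δ.keep x → c x ∈ l)
    (hmode : ∀ x y, δ.keep x → δ.keep y → c x ≠ c y → δ.mode x y = none) :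
    VEqv [] [] (F δ) (l.map fun y => F (δ.restrict fun x => c x = y)).flatten := by
  induction l generalizing δ with
  | nil =>
    rw [h.eq_nil fun x => by simpa using hδ x]
    exact .refl _
  | cons y l ih =>
    rw [List.nodup_cons] at hl
    have h₁ := h.separate hw δ (fun x => c x = y)
      fun x z hx hz hxz => hmode x z hx hz fun e => hxz (by rw [e])
    have h₂ := ih hl.2 (δ.restrict fun x => !decide (c x = y))
      (fun x hx => by
        simp only [Datum.restrict_keep, Bool.and_eq_true, Bool.not_eq_true',
          decide_eq_false_iff_not] at hx
        exact (List.mem_cons.1 (hδ x hx.1)).resolve_left hx.2)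
      (fun x z hx hz => by
        simp only [Datum.restrict_keep, Bool.and_eq_true] at hx hz
        exact hmode x z hx.1 hz.1)
    have e : ∀ z ∈ l, F ((δ.restrict fun x => !decide (c x = y)).restrict fun x => c x = z) =
        F (δ.restrict fun x => c x = z) := by
      intro z hz
      congr 1
      refine Datum.ext (funext fun x => ?_) rfl
      by_cases hxz : c x = z
      · have : c x ≠ y := fun hxy => hl.1 (by rwa [← hxy, hxz])
        simp [this]
      · simp [hxz]
    rw [List.map_congr_left e] at h₂
    exact h₁.trans (h₂.append_left (h.run _ (.inl hw)))

/-! ### Labels along the moves -/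

/-- The datum for labels with a sheet: strands without a sheet are removed, crossings between
different sheets are virtual, and crossings on the second sheet are put between virtual ones. -/
def sheetDatum (s : X → Option Bool) : Datum X :=
  ⟨fun x => (s x).isSome, fun x y => match s x, s y with
    | some b, some c => sheetMode b c
    | _, _ => none⟩

@[simp] theorem sheetDatum_keep (s : X → Option Bool) (x : X) :
    (sheetDatum s).keep x = (s x).isSome := rfl

@[simp] theorem sheetDatum_mode {s : X → Option Bool} {x y : X} {b c : Bool} (hx : s x = some b)
    (hy : s y = some c) : (sheetDatum s).mode x y = sheetMode b c := by
  simp [sheetDatum, hx, hy]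

theorem sheetMode_comm (b c : Bool) : sheetMode b c = sheetMode c b := by
  cases b <;> cases c <;> rfl

theorem sheetMode_self (b : Bool) : sheetMode b b = some b := by simp [sheetMode]

/-- Labels are carried from `l` to `r`, with equivalent images. -/
def Transports (flip : X → X) (l r : Word) : Prop :=
  ∀ (σ τ : List (X × Bool)) (F : Datum X → Word), Img flip l σ τ F →
    Run r (σ.map Prod.snd) (τ.map Prod.snd) → ∃ G, Img flip r σ τ G ∧
      ∀ s : X → Option Bool, (∀ x, s (flip x) = (s x).map (!·)) →
        VEqv ((sheetDatum s).kept σ) ((sheetDatum s).kept τ) (F (sheetDatum s)) (G (sheetDatum s))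

theorem Img.shift_one (h : Img flip w σ τ F) (p : X × Bool) :
    Img flip (shift 1 w) (p :: σ) (p :: τ)
      (fun δ => if δ.keep p.1 then shift 1 (F δ) else F δ) := by
  induction h with
  | nil σ =>
    have := Img.nil (flip := flip) (p :: σ)
    simpa using this
  | cons a k w σ ρ τ F G h hw ih =>
    have := Img.cons a (k + 1) _ _ _ _ _ _ (LAct.succ a k p σ ρ F h) ih
    rw [shift_cons, Nat.add_comm]
    convert this using 2 with δ
    split <;> simp

theorem img_shift_one {p : X × Bool} (h : Img flip (shift 1 w) (p :: σ) τ F) :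
    ∃ τ' G, τ = p :: τ' ∧ Img flip w σ τ' G ∧
      F = fun δ => if δ.keep p.1 then shift 1 (G δ) else G δ := by
  induction w generalizing σ F with
  | nil =>
    cases h
    exact ⟨σ, _, rfl, .nil σ, by simp⟩
  | cons q w ih =>
    obtain ⟨a, k⟩ := q
    rw [shift_cons, Nat.add_comm] at h
    cases h with
    | cons _ _ _ _ _ _ F₁ F₂ h₁ h₂ =>
      cases h₁ with
      | succ _ _ _ _ ρ F₁ h₁ =>
        obtain ⟨τ', G, rfl, hG, rfl⟩ := ih h₂
        refine ⟨τ', _, rfl, .cons a k w σ ρ τ' F₁ G h₁ hG, funext fun δ => ?_⟩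
        cases hp : δ.keep p.1 <;> simp [hp]

theorem run_shift_one {w : Word} {d : Bool} {σ τ : List Bool} :
    Run (shift 1 w) (d :: σ) (d :: τ) ↔ Run w σ τ := by
  refine ⟨fun h => ?_, fun h => h.shift_one d⟩
  have key : ∀ σ, run (shift 1 w) (d :: σ) = (run w σ).map (d :: ·) := by
    clear h
    intro σ
    induction w generalizing σ with
    | nil => rfl
    | cons p w ih =>
      rw [shift_cons, run, run, Nat.add_comm]
      simp only [Kind.actAt]
      cases p.kind.actAt p.pos σ <;> simp [-List.map_cons, ih]
  rw [run_iff, key] at h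
  rw [run_iff]
  simpa using h

theorem exists_cons_of_run {w : Word} {σ τ : List Bool} (hw : w ≠ []) (h : Run (shift 1 w) σ τ) :
    σ ≠ [] := by
  cases w with
  | nil => exact absurd rfl hw
  | cons p w =>
    rintro rfl
    rw [run_iff, shift_cons, run, Nat.add_comm] at h
    simp [Kind.actAt] at h

/-- An event at a positive position forces a strand to its left, whose label is not touched. If both
words were empty there would be no such strand, whence the hypothesis `hlr`. -/
theorem Transports.shift_one {l r : Word} (h : Transports flip l r) (hlr : l ≠ [] ∨ r ≠ []) :
    Transports flip (shift 1 l) (shift 1 r) := by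
  intro σ τ F hF hr
  have hσ : σ.map Prod.snd ≠ [] :=
    hlr.elim (fun hl => exists_cons_of_run hl hF.run_dirs) fun hr' => exists_cons_of_run hr' hr
  cases σ with
  | nil => simp at hσ
  | cons p σ =>
    obtain ⟨τ, G, rfl, hG, rfl⟩ := img_shift_one hF
    obtain ⟨H, hH, e⟩ := h σ τ G hG (run_shift_one.1 hr)
    refine ⟨_, hH.shift_one p, fun s hs => ?_⟩
    simp only [Datum.kept_cons]
    split
    · exact (e s hs).shift_one p.2
    · exact e s hs

theorem Transports.shift {l r : Word} (h : Transports flip l r) (hlr : l ≠ [] ∨ r ≠ []) (k : ℕ) :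
    Transports flip (TwistedLinks.shift k l) (TwistedLinks.shift k r) := by
  induction k with
  | zero => simpa using h
  | succ k ih =>
    have := ih.shift_one (by simpa using hlr)
    rwa [shift_shift, shift_shift, Nat.add_comm] at this

/-- Labels are carried in both directions. -/
def Equates (flip : X → X) (l r : Word) : Prop := Transports flip l r ∧ Transports flip r l

theorem Equates.shift {l r : Word} (h : Equates flip l r) (hl : l ≠ []) (k : ℕ) :
    Equates flip (TwistedLinks.shift k l) (TwistedLinks.shift k r) :=
  ⟨h.1.shift (.inl hl) k, h.2.shift (.inr hl) k⟩

end

end TwistedLinks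

/-! ### Each move carries labels and preserves the images up to virtual moves -/

namespace TwistedLinks

section

variable {X : Type} {flip : X → X} {a b : Kind} {k i : ℕ} {w : Word} {σ τ ρ : List (X × Bool)}
  {F G : Datum X → Word}

theorem Img.step (h : LAct flip a k σ ρ F) (hw : Img flip w ρ τ G) :
    Img flip (⟨a, k⟩ :: w) σ τ (fun δ => F δ ++ G δ) := .cons _ _ _ _ _ _ _ _ h hw

theorem LAct.right (h : LAct flip a k σ τ F) (p : X × Bool) :
    LAct flip a (k + 1) (p :: σ) (p :: τ) (fun δ => if δ.keep p.1 then shift 1 (F δ) else F δ) :=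
  .succ _ _ _ _ _ _ h

theorem Datum.kept_append (δ : Datum X) (σ τ : List (X × Bool)) :
    δ.kept (σ ++ τ) = δ.kept σ ++ δ.kept τ := by
  induction σ with
  | nil => rfl
  | cons p σ ih =>
    simp only [List.cons_append, Datum.kept_cons, ih]
    split <;> rfl

theorem LAct.add (h : LAct flip a k σ τ F) (l : List (X × Bool)) :
    LAct flip a (k + l.length) (l ++ σ) (l ++ τ) (fun δ => shift (δ.kept l).length (F δ)) := by
  induction l with
  | nil => simpa using h
  | cons p l ih =>
    have e : (fun δ : Datum X => shift (δ.kept (p :: l)).length (F δ)) = fun δ =>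
        if δ.keep p.1 then shift 1 (shift (δ.kept l).length (F δ))
        else shift (δ.kept l).length (F δ) := by
      funext δ
      cases hp : δ.keep p.1 <;> simp [Datum.kept_cons, hp, shift_shift, Nat.add_comm]
    rw [e]
    exact ih.right p

theorem lact_add {n : ℕ} (h : LAct flip a (k + n) σ τ F) :
    ∃ l σ' τ' G, l.length = n ∧ σ = l ++ σ' ∧ τ = l ++ τ' ∧ LAct flip a k σ' τ' G ∧
      F = fun δ => shift (δ.kept l).length (G δ) := by
  induction n generalizing σ τ F with
  | zero => exact ⟨[], σ, τ, F, rfl, rfl, rfl, h, by simp⟩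
  | succ n ih =>
    cases h with | succ _ _ p _ _ F h =>
    obtain ⟨l, σ', τ', G, hl, rfl, rfl, hG, rfl⟩ := ih h
    refine ⟨p :: l, σ', τ', G, by simp [hl], rfl, rfl, hG, funext fun δ => ?_⟩
    cases hp : δ.keep p.1 <;> simp [Datum.kept_cons, hp, shift_shift, Nat.add_comm]

/-- An event sees only its own ends. The strands `ρ` to its right can be replaced by others, which
is what an exchange of heights requires. -/
theorem lact_zero (h : LAct flip a 0 σ τ F) :
    ∃ l m ρ, l.length = a.inWidth ∧ m.length = a.outWidth ∧ σ = l ++ ρ ∧ τ = m ++ ρ ∧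
      ∀ ρ, LAct flip a 0 (l ++ ρ) (m ++ ρ) F := by
  cases h with
  | cup d x => exact ⟨[], [_, _], σ, rfl, rfl, rfl, rfl, fun ρ => .cup d x ρ⟩
  | cap d x => exact ⟨[_, _], [], τ, rfl, rfl, rfl, rfl, fun ρ => .cap d x ρ⟩
  | cross o p q ρ => exact ⟨[_, _], [_, _], ρ, rfl, rfl, rfl, rfl, fun ρ => .cross o p q ρ⟩
  | virt p q ρ => exact ⟨[_, _], [_, _], ρ, rfl, rfl, rfl, rfl, fun ρ => .virt p q ρ⟩
  | bar x d ρ => exact ⟨[_], [_], ρ, rfl, rfl, rfl, rfl, fun ρ => .bar x d ρ⟩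

theorem sheetDatum_keep_flip {s : X → Option Bool} (hs : ∀ x, s (flip x) = (s x).map (!·)) (x : X) :
    (sheetDatum s).keep (flip x) = (sheetDatum s).keep x := by simp [hs]

theorem exchange_eqv {l m ρ ρ' : List (X × Bool)} (h : LAct flip a 0 l m F)
    (h' : LAct flip b i ρ ρ' G) {s : X → Option Bool} (hs : ∀ x, s (flip x) = (s x).map (!·)) :
    VEqv ((sheetDatum s).kept (l ++ ρ)) ((sheetDatum s).kept (m ++ ρ'))
      (F (sheetDatum s) ++ shift ((sheetDatum s).kept m).length (G (sheetDatum s)))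
      (shift ((sheetDatum s).kept l).length (G (sheetDatum s)) ++ F (sheetDatum s)) := by
  rw [Datum.kept_append, Datum.kept_append]
  exact interchange (h.run _ (.inr (sheetDatum_keep_flip hs)))
    (h'.run _ (.inr (sheetDatum_keep_flip hs)))

theorem equates_exchange (a b : Kind) (i : ℕ) :
    Equates flip [⟨a, 0⟩, ⟨b, i + a.outWidth⟩] [⟨b, i + a.inWidth⟩, ⟨a, 0⟩] := by
  constructor
  · intro σ τ F h hr
    cases h with | cons _ _ _ _ _ _ _ _ h₁ h =>
    cases h with | cons _ _ _ _ _ _ _ _ h₂ h =>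
    cases h with | nil =>
    obtain ⟨l, m, ρ, hl, hm, rfl, rfl, hA⟩ := lact_zero h₁
    obtain ⟨m', ρ₁, ρ', G, hm', e, rfl, hG, rfl⟩ := lact_add h₂
    obtain ⟨rfl, rfl⟩ := List.append_inj e (by rw [hm, hm'])
    rw [← hl]
    refine ⟨_, .step (hG.add l) (.step (hA ρ') (.nil _)), fun s hs => ?_⟩
    simpa using exchange_eqv (by simpa using hA []) hG hs
  · intro σ τ F h hr
    cases h with | cons _ _ _ _ _ _ _ _ h₁ h =>
    cases h with | cons _ _ _ _ _ _ _ _ h₂ h =>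
    cases h with | nil =>
    obtain ⟨l, m, ρ, hl, hm, rfl, rfl, hA⟩ := lact_zero h₂
    obtain ⟨l', ρ₁, ρ', G, hl', rfl, e, hG, rfl⟩ := lact_add h₁
    obtain ⟨rfl, rfl⟩ := List.append_inj e (by rw [hl, hl'])
    rw [← hm]
    refine ⟨_, .step (hA ρ₁) (.step (hG.add m) (.nil _)), fun s hs => ?_⟩
    simpa using (exchange_eqv (by simpa using hA []) hG hs).symm

/-- The pattern for all moves: the labels at the ends of one side determine a labelling of the other
side. If some strands are removed, the images usually coincide; if all are kept, they differ by the
corresponding `mode` lemma. When a strand is created from the empty word, the hypothesis on `Run`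
supplies its direction. -/
theorem equates_zigzag_right (d : Bool) : Equates flip [cupAt 0 d, capAt 1 (!d)] [] := by
  have key : VEqv [d] [d] [cupAt 0 d, capAt 1 (!d)] [] :=
    veqv_of_chainB [] (by revert d; decide)
  constructor
  · intro σ τ F h hr
    cases h with | cons _ _ _ _ _ _ _ _ h₁ h =>
    cases h₁ with | cup _ x _ =>
    cases h with | cons _ _ _ _ _ _ _ _ h₁ h =>
    cases h₁ with | succ _ _ _ _ _ _ h₁ =>
    cases h₁ with | cap _ _ _ =>
    cases h with | nil =>
    simp only [Bool.not_not]
    refine ⟨_, .nil _, fun s hs => ?_⟩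
    cases hx : s x <;> simp [Datum.kept_cons, hx, Eqv.refl]
    exact key.tail _
  · intro σ τ F h hr
    cases h with | nil =>
    match σ, hr with
    | [], hr => simp [run_iff, run, Kind.actAt, Kind.act] at hr
    | (x, e) :: σ, hr =>
      have hr' := hr
      simp [run_iff, run, Kind.actAt, Kind.act] at hr'
      obtain rfl : e = d := hr'.1
      have h : Img flip [cupAt 0 e, capAt 1 (!e)] ((x, !!e) :: σ) ((x, e) :: σ) _ :=
        .step (.cup _ _ _) (.step (.right (.cap _ _ _) _) (.nil _))
      rw [Bool.not_not] at h
      refine ⟨_, h, fun s hs => ?_⟩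
      cases hx : s x <;> simp [Datum.kept_cons, hx, Eqv.refl]
      exact (key.tail _).symm

theorem equates_zigzag_left (d : Bool) : Equates flip [cupAt 1 d, capAt 0 (!d)] [] := by
  have key : VEqv [!d] [!d] [cupAt 1 d, capAt 0 (!d)] [] :=
    veqv_of_chainB [] (by revert d; decide)
  obtain ⟨e, rfl⟩ : ∃ e, d = !e := ⟨!d, by simp⟩
  simp only [Bool.not_not] at key ⊢
  constructor
  · intro σ τ F h hr
    cases h with | cons _ _ _ _ _ _ _ _ h₁ h =>
    cases h₁ with | succ _ _ p _ _ _ h₁ =>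
    cases h₁ with | cup _ x _ =>
    cases h with | cons _ _ _ _ _ _ _ _ h₁ h =>
    cases h₁ with | cap _ _ _ =>
    cases h with | nil =>
    simp only [Bool.not_not]
    refine ⟨_, .nil _, fun s hs => ?_⟩
    cases hx : s x <;> simp [Datum.kept_cons, hx, Eqv.refl]
    exact key.tail _
  · intro σ τ F h hr
    cases h with | nil =>
    match σ, hr with
    | [], hr => simp [run_iff, run, Kind.actAt, Kind.act] at hr
    | (x, c) :: σ, hr =>
      obtain rfl : c = e := by
        have := hr
        simp [run_iff, run, Kind.actAt, Kind.act] at this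
        exact this.1
      have h : Img flip [cupAt 1 (!c), capAt 0 c] ((x, c) :: σ) ((x, !!c) :: σ) _ :=
        .step (.right (.cup _ _ _) _) (.step (.cap _ _ _) (.nil _))
      rw [Bool.not_not] at h
      refine ⟨_, h, fun s hs => ?_⟩
      cases hx : s x <;> simp [Datum.kept_cons, hx, Eqv.refl]
      exact (key.tail _).symm

theorem equates_cross_cup (d o : Bool) :
    Equates flip [cupAt 1 d, crossAt 0 o] [cupAt 0 d, crossAt 1 (!o)] := by
  constructor
  · intro σ τ F h hr
    cases h with | cons _ _ _ _ _ _ _ _ h₁ h =>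
    cases h₁ with | succ _ _ p _ _ _ h₁ =>
    cases h₁ with | cup _ x _ =>
    cases h with | cons _ _ _ _ _ _ _ _ h₁ h =>
    cases h₁ with | cross _ _ _ _ =>
    cases h with | nil =>
    refine ⟨_, .step (.cup d _ _) (.step (.right (.cross _ _ _ _) _) (.nil _)), fun s hs => ?_⟩
    obtain ⟨y, e⟩ := p
    cases hy : s y <;> cases hx : s x <;> simp [Datum.kept_cons, hy, hx, Eqv.refl]
    -- Beyond the minimal point the two strands meet in the other order from left to right.
    rw [sheetMode_comm]
    exact (mode_cup _ d o e).tail _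
  · intro σ τ F h hr
    cases h with | cons _ _ _ _ _ _ _ _ h₁ h =>
    cases h₁ with | cup _ x _ =>
    cases h with | cons _ _ _ _ _ _ _ _ h₁ h =>
    cases h₁ with | succ _ _ _ _ _ _ h₁ =>
    cases h₁ with | cross _ _ p _ =>
    cases h with | nil =>
    refine ⟨_, .step (.right (.cup d _ _) _) (.step (.cross o _ _ _) (.nil _)), fun s hs => ?_⟩
    obtain ⟨y, e⟩ := p
    cases hy : s y <;> cases hx : s x <;> simp [Datum.kept_cons, hy, hx, Eqv.refl]
    rw [sheetMode_comm]
    exact ((mode_cup _ d o e).tail _).symm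

theorem equates_cross_cap (d o : Bool) :
    Equates flip [crossAt 0 o, capAt 1 d] [crossAt 1 (!o), capAt 0 d] := by
  constructor
  · intro σ τ F h hr
    cases h with | cons _ _ _ _ _ _ _ _ h₁ h =>
    cases h₁ with | cross _ p q _ =>
    cases h with | cons _ _ _ _ _ _ _ _ h₁ h =>
    cases h₁ with | succ _ _ _ _ _ _ h₁ =>
    cases h₁ with | cap _ x _ =>
    cases h with | nil =>
    refine ⟨_, .step (.right (.cross _ _ _ _) _) (.step (.cap _ _ _) (.nil _)), fun s hs => ?_⟩
    obtain ⟨y, e⟩ := q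
    cases hy : s y <;> cases hx : s x <;> simp [Datum.kept_cons, hy, hx, Eqv.refl]
    rw [sheetMode_comm]
    exact (mode_cap _ d o e).tail _
  · intro σ τ F h hr
    cases h with | cons _ _ _ _ _ _ _ _ h₁ h =>
    cases h₁ with | succ _ _ _ _ _ _ h₁ =>
    cases h₁ with | cross _ q _ _ =>
    cases h with | cons _ _ _ _ _ _ _ _ h₁ h =>
    cases h₁ with | cap _ x _ =>
    cases h with | nil =>
    refine ⟨_, .step (.cross _ _ _ _) (.step (.right (.cap _ _ _) _) (.nil _)), fun s hs => ?_⟩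
    obtain ⟨y, e⟩ := q
    cases hy : s y <;> cases hx : s x <;> simp [Datum.kept_cons, hy, hx, Eqv.refl]
    rw [sheetMode_comm]
    exact ((mode_cap _ d o e).tail _).symm

theorem equates_virt_cup (d : Bool) :
    Equates flip [cupAt 1 d, virtAt 0] [cupAt 0 d, virtAt 1] := by
  constructor
  · intro σ τ F h hr
    cases h with | cons _ _ _ _ _ _ _ _ h₁ h =>
    cases h₁ with | succ _ _ p _ _ _ h₁ =>
    cases h₁ with | cup _ x _ =>
    cases h with | cons _ _ _ _ _ _ _ _ h₁ h =>
    cases h₁ with | virt _ _ _ =>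
    cases h with | nil =>
    refine ⟨_, .step (.cup d _ _) (.step (.right (.virt _ _ _) _) (.nil _)), fun s hs => ?_⟩
    obtain ⟨y, e⟩ := p
    cases hy : s y <;> cases hx : s x <;> simp [Datum.kept_cons, hy, hx, Eqv.refl]
    exact (mode_cup none d true e).tail _
  · intro σ τ F h hr
    cases h with | cons _ _ _ _ _ _ _ _ h₁ h =>
    cases h₁ with | cup _ x _ =>
    cases h with | cons _ _ _ _ _ _ _ _ h₁ h =>
    cases h₁ with | succ _ _ _ _ _ _ h₁ =>
    cases h₁ with | virt _ p _ =>
    cases h with | nil =>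
    refine ⟨_, .step (.right (.cup d _ _) _) (.step (.virt _ _ _) (.nil _)), fun s hs => ?_⟩
    obtain ⟨y, e⟩ := p
    cases hy : s y <;> cases hx : s x <;> simp [Datum.kept_cons, hy, hx, Eqv.refl]
    exact ((mode_cup none d true e).tail _).symm

theorem equates_virt_cap (d : Bool) :
    Equates flip [virtAt 0, capAt 1 d] [virtAt 1, capAt 0 d] := by
  constructor
  · intro σ τ F h hr
    cases h with | cons _ _ _ _ _ _ _ _ h₁ h =>
    cases h₁ with | virt p q _ =>
    cases h with | cons _ _ _ _ _ _ _ _ h₁ h =>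
    cases h₁ with | succ _ _ _ _ _ _ h₁ =>
    cases h₁ with | cap _ x _ =>
    cases h with | nil =>
    refine ⟨_, .step (.right (.virt _ _ _) _) (.step (.cap _ _ _) (.nil _)), fun s hs => ?_⟩
    obtain ⟨y, e⟩ := q
    cases hy : s y <;> cases hx : s x <;> simp [Datum.kept_cons, hy, hx, Eqv.refl]
    exact (mode_cap none d true e).tail _
  · intro σ τ F h hr
    cases h with | cons _ _ _ _ _ _ _ _ h₁ h =>
    cases h₁ with | succ _ _ _ _ _ _ h₁ =>
    cases h₁ with | virt q _ _ =>
    cases h with | cons _ _ _ _ _ _ _ _ h₁ h =>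
    cases h₁ with | cap _ x _ =>
    cases h with | nil =>
    refine ⟨_, .step (.virt _ _ _) (.step (.right (.cap _ _ _) _) (.nil _)), fun s hs => ?_⟩
    obtain ⟨y, e⟩ := q
    cases hy : s y <;> cases hx : s x <;> simp [Datum.kept_cons, hy, hx, Eqv.refl]
    exact ((mode_cap none d true e).tail _).symm

/-- With the bar on the other leg, the minimal point itself lies on the other sheet and carries the
label `flip x`; the second leg gets back its label because `flip` is an involution. -/
theorem equates_bar_cup (hf : ∀ x, flip (flip x) = x) (d : Bool) :
    Equates flip [cupAt 0 d, barAt 0] [cupAt 0 d, barAt 1] := by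
  constructor
  · intro σ τ F h hr
    cases h with | cons _ _ _ _ _ _ _ _ h₁ h =>
    cases h₁ with | cup _ x _ =>
    cases h with | cons _ _ _ _ _ _ _ _ h₁ h =>
    cases h₁ with | bar _ _ _ =>
    cases h with | nil =>
    have h : Img flip [cupAt 0 d, barAt 1] σ ((flip x, d) :: (flip (flip x), !d) :: σ) _ :=
      .step (.cup _ _ _) (.step (.right (.bar _ _ _) _) (.nil _))
    rw [hf] at h
    refine ⟨_, h, fun s hs => ?_⟩
    cases hx : s x <;> simp [Datum.kept_cons, hs, hx, Eqv.refl]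
  · intro σ τ F h hr
    cases h with | cons _ _ _ _ _ _ _ _ h₁ h =>
    cases h₁ with | cup _ x _ =>
    cases h with | cons _ _ _ _ _ _ _ _ h₁ h =>
    cases h₁ with | succ _ _ _ _ _ _ h₁ =>
    cases h₁ with | bar _ _ _ =>
    cases h with | nil =>
    have h : Img flip [cupAt 0 d, barAt 0] σ ((flip (flip x), d) :: (flip x, !d) :: σ) _ :=
      .step (.cup _ _ _) (.step (.bar _ _ _) (.nil _))
    rw [hf] at h
    refine ⟨_, h, fun s hs => ?_⟩
    cases hx : s x <;> simp [Datum.kept_cons, hs, hx, Eqv.refl]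

theorem equates_bar_cap (hf : ∀ x, flip (flip x) = x) (d : Bool) :
    Equates flip [barAt 0, capAt 0 d] [barAt 1, capAt 0 d] := by
  constructor
  · intro σ τ F h hr
    cases h with | cons _ _ _ _ _ _ _ _ h₁ h =>
    cases h₁ with | bar x _ _ =>
    cases h with | cons _ _ _ _ _ _ _ _ h₁ h =>
    cases h₁ with | cap _ _ _ =>
    cases h with | nil =>
    have h : Img flip [barAt 1, capAt 0 d] ((flip (flip x), d) :: (flip x, !d) :: τ) τ _ :=
      .step (.right (.bar _ _ _) _) (.step (.cap _ _ _) (.nil _))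
    rw [hf] at h
    refine ⟨_, h, fun s hs => ?_⟩
    cases hx : s x <;> simp [Datum.kept_cons, hs, hx, Eqv.refl]
  · intro σ τ F h hr
    cases h with | cons _ _ _ _ _ _ _ _ h₁ h =>
    cases h₁ with | succ _ _ _ _ _ _ h₁ =>
    cases h₁ with | bar x _ _ =>
    cases h with | cons _ _ _ _ _ _ _ _ h₁ h =>
    cases h₁ with | cap _ _ _ =>
    cases h with | nil =>
    have h : Img flip [barAt 0, capAt 0 d] ((flip x, d) :: (flip (flip x), !d) :: τ) τ _ :=
      .step (.bar _ _ _) (.step (.cap _ _ _) (.nil _))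
    rw [hf] at h
    refine ⟨_, h, fun s hs => ?_⟩
    cases hx : s x <;> simp [Datum.kept_cons, hs, hx, Eqv.refl]

theorem equates_R1_right (d o : Bool) :
    Equates flip [cupAt 1 d, crossAt 0 o, capAt 1 d] [] := by
  constructor
  · intro σ τ F h hr
    cases h with | cons _ _ _ _ _ _ _ _ h₁ h =>
    cases h₁ with | succ _ _ p _ _ _ h₁ =>
    cases h₁ with | cup _ x _ =>
    cases h with | cons _ _ _ _ _ _ _ _ h₁ h =>
    cases h₁ with | cross _ _ _ _ =>
    cases h with | cons _ _ _ _ _ _ _ _ h₁ h =>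
    cases h₁ with | succ _ _ _ _ _ _ h₁ =>
    cases h₁ with | cap _ _ _ =>
    cases h with | nil =>
    refine ⟨_, .nil _, fun s hs => ?_⟩
    cases hx : s x <;> simp [Datum.kept_cons, hx, Eqv.refl, sheetMode_self]
    exact (mode_R1_right _ d o).tail _
  · intro σ τ F h hr
    cases h with | nil =>
    match σ, hr with
    | [], hr => simp [run_iff, run, Kind.actAt, Kind.act] at hr
    | (x, e) :: σ, hr =>
      have hr' := hr
      simp [run_iff, run, Kind.actAt, Kind.act] at hr'
      obtain rfl : e = d := hr'.1
      refine ⟨_, .step (.right (.cup _ _ _) _) (.step (.cross _ _ _ _) (.step (.right (.cap _ _ _) _) (.nil _))), fun s hs => ?_⟩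
      cases hx : s x <;> simp [Datum.kept_cons, hx, Eqv.refl, sheetMode_self]
      exact ((mode_R1_right _ e o).tail _).symm

theorem equates_R1_left (d o : Bool) :
    Equates flip [cupAt 0 d, crossAt 1 o, capAt 0 d] [] := by
  constructor
  · intro σ τ F h hr
    cases h with | cons _ _ _ _ _ _ _ _ h₁ h =>
    cases h₁ with | cup _ x _ =>
    cases h with | cons _ _ _ _ _ _ _ _ h₁ h =>
    cases h₁ with | succ _ _ _ _ _ _ h₁ =>
    cases h₁ with | cross _ _ _ _ =>
    cases h with | cons _ _ _ _ _ _ _ _ h₁ h =>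
    cases h₁ with | cap _ _ _ =>
    cases h with | nil =>
    refine ⟨_, .nil _, fun s hs => ?_⟩
    cases hx : s x <;> simp [Datum.kept_cons, hx, Eqv.refl, sheetMode_self]
    exact (mode_R1_left _ d o).tail _
  · intro σ τ F h hr
    cases h with | nil =>
    match σ, hr with
    | [], hr => simp [run_iff, run, Kind.actAt, Kind.act] at hr
    | (x, e) :: σ, hr =>
      obtain rfl : e = !d := by
        have := hr
        simp [run_iff, run, Kind.actAt, Kind.act] at this
        exact this.1
      refine ⟨_, .step (.cup _ _ _) (.step (.right (.cross _ _ _ _) _) (.step (.cap _ _ _) (.nil _))), fun s hs => ?_⟩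
      cases hx : s x <;> simp [Datum.kept_cons, hx, Eqv.refl, sheetMode_self]
      exact ((mode_R1_left _ d o).tail _).symm

theorem equates_V1_right (d : Bool) :
    Equates flip [cupAt 1 d, virtAt 0, capAt 1 d] [] := by
  have key : VEqv [d] [d] [cupAt 1 d, virtAt 0, capAt 1 d] [] :=
    veqv_of_chainB [] (by revert d; decide)
  constructor
  · intro σ τ F h hr
    cases h with | cons _ _ _ _ _ _ _ _ h₁ h =>
    cases h₁ with | succ _ _ p _ _ _ h₁ =>
    cases h₁ with | cup _ x _ =>
    cases h with | cons _ _ _ _ _ _ _ _ h₁ h =>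
    cases h₁ with | virt _ _ _ =>
    cases h with | cons _ _ _ _ _ _ _ _ h₁ h =>
    cases h₁ with | succ _ _ _ _ _ _ h₁ =>
    cases h₁ with | cap _ _ _ =>
    cases h with | nil =>
    refine ⟨_, .nil _, fun s hs => ?_⟩
    cases hx : s x <;> simp [Datum.kept_cons, hx, Eqv.refl]
    exact key.tail _
  · intro σ τ F h hr
    cases h with | nil =>
    match σ, hr with
    | [], hr => simp [run_iff, run, Kind.actAt, Kind.act] at hr
    | (x, e) :: σ, hr =>
      have hr' := hr
      simp [run_iff, run, Kind.actAt, Kind.act] at hr'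
      obtain rfl : e = d := hr'.1
      refine ⟨_, .step (.right (.cup _ _ _) _) (.step (.virt _ _ _) (.step (.right (.cap _ _ _) _) (.nil _))), fun s hs => ?_⟩
      cases hx : s x <;> simp [Datum.kept_cons, hx, Eqv.refl]
      exact (key.tail _).symm

theorem equates_V1_left (d : Bool) :
    Equates flip [cupAt 0 d, virtAt 1, capAt 0 d] [] := by
  have key : VEqv [!d] [!d] [cupAt 0 d, virtAt 1, capAt 0 d] [] :=
    veqv_of_chainB [] (by revert d; decide)
  constructor
  · intro σ τ F h hr
    cases h with | cons _ _ _ _ _ _ _ _ h₁ h =>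
    cases h₁ with | cup _ x _ =>
    cases h with | cons _ _ _ _ _ _ _ _ h₁ h =>
    cases h₁ with | succ _ _ _ _ _ _ h₁ =>
    cases h₁ with | virt _ _ _ =>
    cases h with | cons _ _ _ _ _ _ _ _ h₁ h =>
    cases h₁ with | cap _ _ _ =>
    cases h with | nil =>
    refine ⟨_, .nil _, fun s hs => ?_⟩
    cases hx : s x <;> simp [Datum.kept_cons, hx, Eqv.refl]
    exact key.tail _
  · intro σ τ F h hr
    cases h with | nil =>
    match σ, hr with
    | [], hr => simp [run_iff, run, Kind.actAt, Kind.act] at hr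
    | (x, e) :: σ, hr =>
      obtain rfl : e = !d := by
        have := hr
        simp [run_iff, run, Kind.actAt, Kind.act] at this
        exact this.1
      refine ⟨_, .step (.cup _ _ _) (.step (.right (.virt _ _ _) _) (.step (.cap _ _ _) (.nil _))), fun s hs => ?_⟩
      cases hx : s x <;> simp [Datum.kept_cons, hx, Eqv.refl]
      exact (key.tail _).symm

theorem equates_R2 (o : Bool) : Equates flip [crossAt 0 o, crossAt 0 (!o)] [] := by
  constructor
  · intro σ τ F h hr
    cases h with | cons _ _ _ _ _ _ _ _ h₁ h =>
    cases h₁ with | cross _ p q _ =>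
    cases h with | cons _ _ _ _ _ _ _ _ h₁ h =>
    cases h₁ with | cross _ _ _ _ =>
    cases h with | nil =>
    refine ⟨_, .nil _, fun s hs => ?_⟩
    obtain ⟨x, d⟩ := p
    obtain ⟨y, e⟩ := q
    cases hx : s x <;> cases hy : s y <;> simp [Datum.kept_cons, hx, hy, Eqv.refl]
    nth_rewrite 2 [sheetMode_comm]
    exact (mode_R2 _ o d e).tail _
  · intro σ τ F h hr
    cases h with | nil =>
    match σ, hr with
    | [], hr => simp [run_iff, run, Kind.actAt, Kind.act] at hr
    | [_], hr => simp [run_iff, run, Kind.actAt, Kind.act] at hr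
    | (x, d) :: (y, e) :: σ, hr =>
      refine ⟨_, .step (.cross _ _ _ _) (.step (.cross _ _ _ _) (.nil _)), fun s hs => ?_⟩
      cases hx : s x <;> cases hy : s y <;> simp [Datum.kept_cons, hx, hy, Eqv.refl]
      nth_rewrite 2 [sheetMode_comm]
      exact ((mode_R2 _ o d e).tail _).symm

theorem equates_V2 : Equates flip [virtAt 0, virtAt 0] [] := by
  constructor
  · intro σ τ F h hr
    cases h with | cons _ _ _ _ _ _ _ _ h₁ h =>
    cases h₁ with | virt p q _ =>
    cases h with | cons _ _ _ _ _ _ _ _ h₁ h =>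
    cases h₁ with | virt _ _ _ =>
    cases h with | nil =>
    refine ⟨_, .nil _, fun s hs => ?_⟩
    obtain ⟨x, d⟩ := p
    obtain ⟨y, e⟩ := q
    cases hx : s x <;> cases hy : s y <;> simp [Datum.kept_cons, hx, hy, Eqv.refl]
    exact (mode_R2 none true d e).tail _
  · intro σ τ F h hr
    cases h with | nil =>
    match σ, hr with
    | [], hr => simp [run_iff, run, Kind.actAt, Kind.act] at hr
    | [_], hr => simp [run_iff, run, Kind.actAt, Kind.act] at hr
    | (x, d) :: (y, e) :: σ, hr =>
      refine ⟨_, .step (.virt _ _ _) (.step (.virt _ _ _) (.nil _)), fun s hs => ?_⟩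
      cases hx : s x <;> cases hy : s y <;> simp [Datum.kept_cons, hx, hy, Eqv.refl]
      exact ((mode_R2 none true d e).tail _).symm

theorem equates_R3 (o₁ o₂ o₃ : Bool) (h : o₁ = o₃ → o₂ = o₁) :
    Equates flip [crossAt 0 o₁, crossAt 1 o₂, crossAt 0 o₃]
      [crossAt 1 o₃, crossAt 0 o₂, crossAt 1 o₁] := by
  have ho := h
  clear h
  constructor
  · intro σ τ F h hr
    cases h with | cons _ _ _ _ _ _ _ _ h₁ h =>
    cases h₁ with | cross _ p q _ =>
    cases h with | cons _ _ _ _ _ _ _ _ h₁ h =>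
    cases h₁ with | succ _ _ _ _ _ _ h₁ =>
    cases h₁ with | cross _ _ r _ =>
    cases h with | cons _ _ _ _ _ _ _ _ h₁ h =>
    cases h₁ with | cross _ _ _ _ =>
    cases h with | nil =>
    refine ⟨_, .step (.right (.cross _ _ _ _) _) (.step (.cross _ _ _ _) (.step (.right (.cross _ _ _ _) _) (.nil _))), fun s hs => ?_⟩
    obtain ⟨x, d⟩ := p
    obtain ⟨y, e⟩ := q
    obtain ⟨z, f⟩ := r
    cases hx : s x <;> cases hy : s y <;> cases hz : s z <;>
      simp [Datum.kept_cons, hx, hy, hz, Eqv.refl]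
    simpa using (mode_R3 _ _ _ o₁ o₂ o₃ d e f ho).tail _
  · intro σ τ F h hr
    cases h with | cons _ _ _ _ _ _ _ _ h₁ h =>
    cases h₁ with | succ _ _ p _ _ _ h₁ =>
    cases h₁ with | cross _ q r _ =>
    cases h with | cons _ _ _ _ _ _ _ _ h₁ h =>
    cases h₁ with | cross _ _ _ _ =>
    cases h with | cons _ _ _ _ _ _ _ _ h₁ h =>
    cases h₁ with | succ _ _ _ _ _ _ h₁ =>
    cases h₁ with | cross _ _ _ _ =>
    cases h with | nil =>
    refine ⟨_, .step (.cross _ _ _ _) (.step (.right (.cross _ _ _ _) _) (.step (.cross _ _ _ _) (.nil _))), fun s hs => ?_⟩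
    obtain ⟨x, d⟩ := p
    obtain ⟨y, e⟩ := q
    obtain ⟨z, f⟩ := r
    cases hx : s x <;> cases hy : s y <;> cases hz : s z <;>
      simp [Datum.kept_cons, hx, hy, hz, Eqv.refl]
    simpa using ((mode_R3 _ _ _ o₁ o₂ o₃ d e f ho).tail _).symm

theorem equates_V3 : Equates flip [virtAt 0, virtAt 1, virtAt 0] [virtAt 1, virtAt 0, virtAt 1] := by
  constructor
  · intro σ τ F h hr
    cases h with | cons _ _ _ _ _ _ _ _ h₁ h =>
    cases h₁ with | virt p q _ =>
    cases h with | cons _ _ _ _ _ _ _ _ h₁ h =>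
    cases h₁ with | succ _ _ _ _ _ _ h₁ =>
    cases h₁ with | virt _ r _ =>
    cases h with | cons _ _ _ _ _ _ _ _ h₁ h =>
    cases h₁ with | virt _ _ _ =>
    cases h with | nil =>
    refine ⟨_, .step (.right (.virt _ _ _) _) (.step (.virt _ _ _) (.step (.right (.virt _ _ _) _) (.nil _))), fun s hs => ?_⟩
    obtain ⟨x, d⟩ := p
    obtain ⟨y, e⟩ := q
    obtain ⟨z, f⟩ := r
    cases hx : s x <;> cases hy : s y <;> cases hz : s z <;>
      simp [Datum.kept_cons, hx, hy, hz, Eqv.refl]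
    exact (mode_V4_third none true d e f).tail _
  · intro σ τ F h hr
    cases h with | cons _ _ _ _ _ _ _ _ h₁ h =>
    cases h₁ with | succ _ _ p _ _ _ h₁ =>
    cases h₁ with | virt q r _ =>
    cases h with | cons _ _ _ _ _ _ _ _ h₁ h =>
    cases h₁ with | virt _ _ _ =>
    cases h with | cons _ _ _ _ _ _ _ _ h₁ h =>
    cases h₁ with | succ _ _ _ _ _ _ h₁ =>
    cases h₁ with | virt _ _ _ =>
    cases h with | nil =>
    refine ⟨_, .step (.virt _ _ _) (.step (.right (.virt _ _ _) _) (.step (.virt _ _ _) (.nil _))), fun s hs => ?_⟩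
    obtain ⟨x, d⟩ := p
    obtain ⟨y, e⟩ := q
    obtain ⟨z, f⟩ := r
    cases hx : s x <;> cases hy : s y <;> cases hz : s z <;>
      simp [Datum.kept_cons, hx, hy, hz, Eqv.refl]
    exact ((mode_V4_third none true d e f).tail _).symm

theorem equates_V4_third (o : Bool) :
    Equates flip [crossAt 0 o, virtAt 1, virtAt 0] [virtAt 1, virtAt 0, crossAt 1 o] := by
  constructor
  · intro σ τ F h hr
    cases h with | cons _ _ _ _ _ _ _ _ h₁ h =>
    cases h₁ with | cross _ p q _ =>
    cases h with | cons _ _ _ _ _ _ _ _ h₁ h =>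
    cases h₁ with | succ _ _ _ _ _ _ h₁ =>
    cases h₁ with | virt _ r _ =>
    cases h with | cons _ _ _ _ _ _ _ _ h₁ h =>
    cases h₁ with | virt _ _ _ =>
    cases h with | nil =>
    refine ⟨_, .step (.right (.virt _ _ _) _) (.step (.virt _ _ _) (.step (.right (.cross _ _ _ _) _) (.nil _))), fun s hs => ?_⟩
    obtain ⟨x, d⟩ := p
    obtain ⟨y, e⟩ := q
    obtain ⟨z, f⟩ := r
    cases hx : s x <;> cases hy : s y <;> cases hz : s z <;>
      simp [Datum.kept_cons, hx, hy, hz, Eqv.refl]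
    exact (mode_V4_third _ o d e f).tail _
  · intro σ τ F h hr
    cases h with | cons _ _ _ _ _ _ _ _ h₁ h =>
    cases h₁ with | succ _ _ p _ _ _ h₁ =>
    cases h₁ with | virt q r _ =>
    cases h with | cons _ _ _ _ _ _ _ _ h₁ h =>
    cases h₁ with | virt _ _ _ =>
    cases h with | cons _ _ _ _ _ _ _ _ h₁ h =>
    cases h₁ with | succ _ _ _ _ _ _ h₁ =>
    cases h₁ with | cross _ _ _ _ =>
    cases h with | nil =>
    refine ⟨_, .step (.cross _ _ _ _) (.step (.right (.virt _ _ _) _) (.step (.virt _ _ _) (.nil _))), fun s hs => ?_⟩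
    obtain ⟨x, d⟩ := p
    obtain ⟨y, e⟩ := q
    obtain ⟨z, f⟩ := r
    cases hx : s x <;> cases hy : s y <;> cases hz : s z <;>
      simp [Datum.kept_cons, hx, hy, hz, Eqv.refl]
    exact ((mode_V4_third _ o d e f).tail _).symm

theorem equates_V4_first (o : Bool) :
    Equates flip [virtAt 0, virtAt 1, crossAt 0 o] [crossAt 1 o, virtAt 0, virtAt 1] := by
  constructor
  · intro σ τ F h hr
    cases h with | cons _ _ _ _ _ _ _ _ h₁ h =>
    cases h₁ with | virt p q _ =>
    cases h with | cons _ _ _ _ _ _ _ _ h₁ h =>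
    cases h₁ with | succ _ _ _ _ _ _ h₁ =>
    cases h₁ with | virt _ r _ =>
    cases h with | cons _ _ _ _ _ _ _ _ h₁ h =>
    cases h₁ with | cross _ _ _ _ =>
    cases h with | nil =>
    refine ⟨_, .step (.right (.cross _ _ _ _) _) (.step (.virt _ _ _) (.step (.right (.virt _ _ _) _) (.nil _))), fun s hs => ?_⟩
    obtain ⟨x, d⟩ := p
    obtain ⟨y, e⟩ := q
    obtain ⟨z, f⟩ := r
    cases hx : s x <;> cases hy : s y <;> cases hz : s z <;>
      simp [Datum.kept_cons, hx, hy, hz, Eqv.refl]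
    exact (mode_V4_first _ o d e f).tail _
  · intro σ τ F h hr
    cases h with | cons _ _ _ _ _ _ _ _ h₁ h =>
    cases h₁ with | succ _ _ p _ _ _ h₁ =>
    cases h₁ with | cross _ q r _ =>
    cases h with | cons _ _ _ _ _ _ _ _ h₁ h =>
    cases h₁ with | virt _ _ _ =>
    cases h with | cons _ _ _ _ _ _ _ _ h₁ h =>
    cases h₁ with | succ _ _ _ _ _ _ h₁ =>
    cases h₁ with | virt _ _ _ =>
    cases h with | nil =>
    refine ⟨_, .step (.virt _ _ _) (.step (.right (.virt _ _ _) _) (.step (.cross _ _ _ _) (.nil _))), fun s hs => ?_⟩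
    obtain ⟨x, d⟩ := p
    obtain ⟨y, e⟩ := q
    obtain ⟨z, f⟩ := r
    cases hx : s x <;> cases hy : s y <;> cases hz : s z <;>
      simp [Datum.kept_cons, hx, hy, hz, Eqv.refl]
    exact ((mode_V4_first _ o d e f).tail _).symm

theorem equates_V4_second (o : Bool) :
    Equates flip [virtAt 0, crossAt 1 o, virtAt 0] [virtAt 1, crossAt 0 o, virtAt 1] := by
  constructor
  · intro σ τ F h hr
    cases h with | cons _ _ _ _ _ _ _ _ h₁ h =>
    cases h₁ with | virt p q _ =>
    cases h with | cons _ _ _ _ _ _ _ _ h₁ h =>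
    cases h₁ with | succ _ _ _ _ _ _ h₁ =>
    cases h₁ with | cross _ _ r _ =>
    cases h with | cons _ _ _ _ _ _ _ _ h₁ h =>
    cases h₁ with | virt _ _ _ =>
    cases h with | nil =>
    refine ⟨_, .step (.right (.virt _ _ _) _) (.step (.cross _ _ _ _) (.step (.right (.virt _ _ _) _) (.nil _))), fun s hs => ?_⟩
    obtain ⟨x, d⟩ := p
    obtain ⟨y, e⟩ := q
    obtain ⟨z, f⟩ := r
    cases hx : s x <;> cases hy : s y <;> cases hz : s z <;>
      simp [Datum.kept_cons, hx, hy, hz, Eqv.refl]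
    simpa using (mode_V4_second _ o d e f).tail _
  · intro σ τ F h hr
    cases h with | cons _ _ _ _ _ _ _ _ h₁ h =>
    cases h₁ with | succ _ _ p _ _ _ h₁ =>
    cases h₁ with | virt q r _ =>
    cases h with | cons _ _ _ _ _ _ _ _ h₁ h =>
    cases h₁ with | cross _ _ _ _ =>
    cases h with | cons _ _ _ _ _ _ _ _ h₁ h =>
    cases h₁ with | succ _ _ _ _ _ _ h₁ =>
    cases h₁ with | virt _ _ _ =>
    cases h with | nil =>
    refine ⟨_, .step (.virt _ _ _) (.step (.right (.cross _ _ _ _) _) (.step (.virt _ _ _) (.nil _))), fun s hs => ?_⟩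
    obtain ⟨x, d⟩ := p
    obtain ⟨y, e⟩ := q
    obtain ⟨z, f⟩ := r
    cases hx : s x <;> cases hy : s y <;> cases hz : s z <;>
      simp [Datum.kept_cons, hx, hy, hz, Eqv.refl]
    simpa using (mode_V4_second _ o d e f).symm.tail _

/-- Bars have empty image and virtual crossings have the same image on all sheets, so the two images
are equal. -/
theorem equates_T1_left : Equates flip [barAt 0, virtAt 0] [virtAt 0, barAt 1] := by
  constructor
  · intro σ τ F h hr
    cases h with | cons _ _ _ _ _ _ _ _ h₁ h =>
    cases h₁ with | bar x d _ =>
    cases h with | cons _ _ _ _ _ _ _ _ h₁ h =>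
    cases h₁ with | virt _ q _ =>
    cases h with | nil =>
    refine ⟨_, .step (.virt _ _ _) (.step (.right (.bar _ _ _) _) (.nil _)), fun s hs => ?_⟩
    cases hx : s x <;> cases hy : s q.1 <;> simp [Datum.kept_cons, hs, hx, hy, Eqv.refl]
  · intro σ τ F h hr
    cases h with | cons _ _ _ _ _ _ _ _ h₁ h =>
    cases h₁ with | virt p q _ =>
    cases h with | cons _ _ _ _ _ _ _ _ h₁ h =>
    cases h₁ with | succ _ _ _ _ _ _ h₁ =>
    cases h₁ with | bar x d _ =>
    cases h with | nil =>
    refine ⟨_, .step (.bar _ _ _) (.step (.virt _ _ _) (.nil _)), fun s hs => ?_⟩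
    cases hx : s x <;> cases hy : s q.1 <;> simp [Datum.kept_cons, hs, hx, hy, Eqv.refl]

theorem equates_T1_right : Equates flip [barAt 1, virtAt 0] [virtAt 0, barAt 0] := by
  constructor
  · intro σ τ F h hr
    cases h with | cons _ _ _ _ _ _ _ _ h₁ h =>
    cases h₁ with | succ _ _ q _ _ _ h₁ =>
    cases h₁ with | bar x d _ =>
    cases h with | cons _ _ _ _ _ _ _ _ h₁ h =>
    cases h₁ with | virt _ _ _ =>
    cases h with | nil =>
    refine ⟨_, .step (.virt _ _ _) (.step (.bar _ _ _) (.nil _)), fun s hs => ?_⟩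
    cases hx : s x <;> cases hy : s q.1 <;> simp [Datum.kept_cons, hs, hx, hy, Eqv.refl]
  · intro σ τ F h hr
    cases h with | cons _ _ _ _ _ _ _ _ h₁ h =>
    cases h₁ with | virt p q _ =>
    cases h with | cons _ _ _ _ _ _ _ _ h₁ h =>
    cases h₁ with | bar x d _ =>
    cases h with | nil =>
    refine ⟨_, .step (.right (.bar _ _ _) _) (.step (.virt _ _ _) (.nil _)), fun s hs => ?_⟩
    cases hx : s x <;> cases hy : s p.1 <;> simp [Datum.kept_cons, hs, hx, hy, Eqv.refl]

theorem equates_T2 (hf : ∀ x, flip (flip x) = x) : Equates flip [barAt 0, barAt 0] [] := by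
  constructor
  · intro σ τ F h hr
    cases h with | cons _ _ _ _ _ _ _ _ h₁ h =>
    cases h₁ with | bar x d _ =>
    cases h with | cons _ _ _ _ _ _ _ _ h₁ h =>
    cases h₁ with | bar _ _ _ =>
    cases h with | nil =>
    rw [hf]
    refine ⟨_, .nil _, fun s hs => by simpa using Eqv.refl _⟩
  · intro σ τ F h hr
    cases h with | nil =>
    match σ, hr with
    | [], hr => simp [run_iff, run, Kind.actAt, Kind.act] at hr
    | (x, d) :: σ, hr =>
      have h : Img flip [barAt 0, barAt 0] ((x, d) :: σ) ((flip (flip x), d) :: σ) _ :=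
        .step (.bar _ _ _) (.step (.bar _ _ _) (.nil _))
      rw [hf] at h
      exact ⟨_, h, fun s hs => by simpa using Eqv.refl _⟩

/-- Changing both sheets exchanges a plain crossing with a conjugated one, and the two outer virtual
crossings undo this. Between different sheets everything is virtual and V2 suffices. The modes are
chosen for this identity, which is T3 on the level of images. -/
theorem virt_mode_virt (b c o x y : Bool) : VEqv [x, y] [y, x]
    ([virtAt 0] ++ modeAt 0 (sheetMode (!c) (!b)) o ++ [virtAt 0])
    (modeAt 0 (sheetMode b c) o) := by
  cases b <;> cases c
  · exact mode_conj true o x y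
  · exact veqv_of_chainB [] (by revert o x y; decide)
  · exact veqv_of_chainB [] (by revert o x y; decide)
  · exact mode_conj false o x y

/-- Between the bars both strands lie on their opposite sheets, so `virt_mode_virt` applies; the
outer labels return by `hf`. -/
theorem equates_T3 (hf : ∀ x, flip (flip x) = x) (o : Bool) : Equates flip
    [barAt 0, barAt 1, virtAt 0, crossAt 0 o, virtAt 0, barAt 0, barAt 1] [crossAt 0 o] := by
  constructor
  · intro σ τ F h hr
    cases h with | cons _ _ _ _ _ _ _ _ h₁ h =>
    cases h₁ with | bar x d _ =>
    cases h with | cons _ _ _ _ _ _ _ _ h₁ h =>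
    cases h₁ with | succ _ _ _ _ _ _ h₁ =>
    cases h₁ with | bar y e _ =>
    cases h with | cons _ _ _ _ _ _ _ _ h₁ h =>
    cases h₁ with | virt _ _ _ =>
    cases h with | cons _ _ _ _ _ _ _ _ h₁ h =>
    cases h₁ with | cross _ _ _ _ =>
    cases h with | cons _ _ _ _ _ _ _ _ h₁ h =>
    cases h₁ with | virt _ _ _ =>
    cases h with | cons _ _ _ _ _ _ _ _ h₁ h =>
    cases h₁ with | bar _ _ _ =>
    cases h with | cons _ _ _ _ _ _ _ _ h₁ h =>
    cases h₁ with | succ _ _ _ _ _ _ h₁ =>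
    cases h₁ with | bar _ _ _ =>
    cases h with | nil =>
    rw [hf, hf]
    refine ⟨_, .step (.cross o _ _ _) (.nil _), fun s hs => ?_⟩
    cases hx : s x <;> cases hy : s y <;> simp [Datum.kept_cons, hs, hx, hy, Eqv.refl]
    have hx' := hs x
    have hy' := hs y
    simp only [hx, hy, Option.map_some] at hx' hy'
    rw [sheetDatum_mode hy' hx']
    simpa using (virt_mode_virt _ _ o d e).tail _
  · intro σ τ F h hr
    cases h with | cons _ _ _ _ _ _ _ _ h₁ h =>
    cases h₁ with | cross _ p q _ =>
    cases h with | nil =>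
    obtain ⟨x, d⟩ := p
    obtain ⟨y, e⟩ := q
    rename_i σ
    have h : Img flip [barAt 0, barAt 1, virtAt 0, crossAt 0 o, virtAt 0, barAt 0, barAt 1]
        ((x, d) :: (y, e) :: σ) ((flip (flip y), e) :: (flip (flip x), d) :: σ) _ :=
      .step (.bar _ _ _) (.step (.right (.bar _ _ _) _) (.step (.virt _ _ _) (.step (.cross _ _ _ _) (.step (.virt _ _ _) (.step (.bar _ _ _) (.step (.right (.bar _ _ _) _) (.nil _)))))))
    rw [hf, hf] at h
    refine ⟨_, h, fun s hs => ?_⟩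
    cases hx : s x <;> cases hy : s y <;> simp [Datum.kept_cons, hs, hx, hy, Eqv.refl]
    have hx' := hs x
    have hy' := hs y
    simp only [hx, hy, Option.map_some] at hx' hy'
    rw [sheetDatum_mode hy' hx']
    simpa using (virt_mode_virt _ _ o d e).symm.tail _

end

end TwistedLinks

/-! ### Transport of labels along equivalences; invariance of being empty -/

namespace TwistedLinks

section

variable {X : Type} {flip : X → X} {a b : Kind} {k i : ℕ} {w w' : Word} {σ τ ρ : List (X × Bool)}
  {F G : Datum X → Word}

theorem TwistedRule.equates (hf : ∀ x, flip (flip x) = x) {l r : Word} (h : TwistedRule l r) :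
    Equates flip l r := by
  rcases h with (h | h | h) | h
  · cases h with
    | exchange a b k i =>
      have := (equates_exchange (flip := flip) a b i).shift (by simp) k
      simpa [Nat.add_assoc, Nat.add_comm, Nat.add_left_comm] using this
    | zigzag_right k d => exact (equates_zigzag_right d).shift (by simp) k
    | zigzag_left k d => exact (equates_zigzag_left d).shift (by simp) k
    | cross_cup k d o => exact (equates_cross_cup d o).shift (by simp) k
    | cross_cap k d o => exact (equates_cross_cap d o).shift (by simp) k
    | virt_cup k d => exact (equates_virt_cup d).shift (by simp) k
    | virt_cap k d => exact (equates_virt_cap d).shift (by simp) k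
    | bar_cup k d => exact (equates_bar_cup hf d).shift (by simp) k
    | bar_cap k d => exact (equates_bar_cap hf d).shift (by simp) k
  · cases h with
    | R1_right k d o => exact (equates_R1_right d o).shift (by simp) k
    | R1_left k d o => exact (equates_R1_left d o).shift (by simp) k
    | R2 k o => exact (equates_R2 o).shift (by simp) k
    | R3 k o₁ o₂ o₃ h => exact (equates_R3 o₁ o₂ o₃ h).shift (by simp) k
  · cases h with
    | V1_right k d => exact (equates_V1_right d).shift (by simp) k
    | V1_left k d => exact (equates_V1_left d).shift (by simp) k
    | V2 k => exact equates_V2.shift (by simp) k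
    | V3 k => exact equates_V3.shift (by simp) k
    | V4_third k o => exact (equates_V4_third o).shift (by simp) k
    | V4_first k o => exact (equates_V4_first o).shift (by simp) k
    | V4_second k o => exact (equates_V4_second o).shift (by simp) k
  · cases h with
    | T1_left k => exact equates_T1_left.shift (by simp) k
    | T1_right k => exact equates_T1_right.shift (by simp) k
    | T2 k => exact (equates_T2 hf).shift (by simp) k
    | T3 k o => exact (equates_T3 hf o).shift (by simp) k

theorem Transports.context {l r : Word} (h : Transports flip l r) (u v : Word) :
    Transports flip (u ++ l ++ v) (u ++ r ++ v) := by
  intro σ τ F hF hr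
  obtain ⟨ρ₂, F₁₂, F₃, h₁₂, h₃, e₃⟩ := img_append hF
  obtain ⟨ρ₁, F₁, F₂, h₁, h₂, e₁₂⟩ := img_append h₁₂
  obtain ⟨π₂, r₁₂, r₃⟩ := run_append.1 hr
  obtain ⟨π₁, r₁, r₂⟩ := run_append.1 r₁₂
  -- The directions at the two cuts are determined from below by `u` and from above by `v`, hence
  -- agree with those of the labelled strands.
  obtain rfl := r₁.unique h₁.run_dirs
  obtain rfl := r₃.unique_bot h₃.run_dirs
  obtain ⟨G, hG, e⟩ := h _ _ _ h₂ r₂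
  refine ⟨_, (h₁.append hG).append h₃, fun s hs => ?_⟩
  rw [e₃, e₁₂]
  exact (e s hs).comp (h₁.run _ (.inr (sheetDatum_keep_flip hs)))
    (h₃.run _ (.inr (sheetDatum_keep_flip hs)))

/-- Labels are carried along an equivalence of twisted link diagrams. -/
theorem Eqv.transport (hf : ∀ x, flip (flip x) = x) (h : TEqv [] [] w w')
    (hF : Img flip w [] [] F) : ∃ G, Img flip w' [] [] G ∧
      ∀ s : X → Option Bool, (∀ x, s (flip x) = (s x).map (!·)) →
        VEqv [] [] (F (sheetDatum s)) (G (sheetDatum s)) := by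
  let T : Word → Word → Prop := fun w w' => ∀ F : Datum X → Word, Img flip w [] [] F →
    ∃ G, Img flip w' [] [] G ∧ ∀ s : X → Option Bool, (∀ x, s (flip x) = (s x).map (!·)) →
      VEqv [] [] (F (sheetDatum s)) (G (sheetDatum s))
  have trans : ∀ {w w' w''}, T w w' → T w' w'' → T w w'' := by
    intro w w' w'' h h' F hF
    obtain ⟨G, hG, e⟩ := h F hF
    obtain ⟨H, hH, e'⟩ := h' G hG
    exact ⟨H, hH, fun s hs => (e s hs).trans (e' s hs)⟩
  -- Both directions are proved together, since the generated equivalence contains inverse steps.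
  have key : T w w' ∧ T w' w := by
    clear hF
    induction h with
    | rel w w' h =>
      obtain ⟨h₁, h₂, u, v, l, r, hlr, rfl, rfl⟩ := h
      have e := hlr.equates hf
      exact ⟨fun F hF => e.1.context u v [] [] F hF h₂, fun F hF => e.2.context u v [] [] F hF h₁⟩
    | refl w => exact ⟨fun F hF => ⟨F, hF, fun _ _ => .refl _⟩, fun F hF => ⟨F, hF, fun _ _ => .refl _⟩⟩
    | symm _ _ _ ih => exact ih.symm
    | trans _ _ _ _ _ ih₁ ih₂ => exact ⟨trans ih₁.1 ih₂.1, trans ih₂.2 ih₁.2⟩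
  exact key.1 F hF

/-! ### Diagrams without events -/

/-- Where a rule has an empty side, its other side contains a through strand and is not closed. So
no rule removes a whole component. -/
theorem VirtualRule.ne_nil {l r : Word} (h : VirtualRule l r) :
    l ≠ [] ∧ (r ≠ [] ∨ ¬ Run l [] []) := by
  have h₁ : ∀ (k : ℕ) (d : Bool), (Kind.cup d).actAt k [] = if k = 0 then some [d, !d] else none :=
    fun k d => by cases k <;> rfl
  have h₂ : ∀ (k : ℕ) (o : Bool), (Kind.cross o).actAt k [] = none := fun k d => by cases k <;> rfl
  have h₃ : ∀ k : ℕ, Kind.virt.actAt k [] = none := fun k => by cases k <;> rfl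
  rcases h with h | h | h <;> cases h <;> simp [run_iff, run, h₁, h₂, h₃] <;>
    split <;> simp_all [Kind.actAt, Kind.act]

/-- Non-emptiness of a part is thereby a property of the virtual link; this detects which labels
survive an equivalence. -/
theorem Eqv.nil_iff (h : VEqv [] [] w w') : w = [] ↔ w' = [] := by
  induction h with
  | rel w w' h =>
    obtain ⟨h₁, h₂, u, v, l, r, hlr, rfl, rfl⟩ := h
    have := hlr.ne_nil
    simp only [List.append_eq_nil_iff]
    constructor
    · rintro ⟨⟨-, h⟩, -⟩
      exact absurd h this.1
    · rintro ⟨⟨rfl, rfl⟩, rfl⟩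
      simp only [List.nil_append, List.append_nil] at h₁
      exact absurd h₁ (this.2.resolve_left (by simp))
  | refl => rfl
  | symm _ _ _ ih => exact ih.symm
  | trans _ _ _ _ _ ih₁ ih₂ => exact ih₁.trans ih₂

end

end TwistedLinks

namespace TwistedLinks

section

variable {X Y : Type} {flip : X → X} {a b : Kind} {k i : ℕ} {w w' : Word}
  {σ τ ρ : List (X × Bool)} {F G : Datum X → Word}

/-! ### Changing labels and data -/

/-- The datum for labels which are mapped to labels `Y`. -/
def Datum.comap (f : X → Y) (δ : Datum Y) : Datum X :=
  ⟨fun x => δ.keep (f x), fun x y => δ.mode (f x) (f y)⟩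

/-- Without bars the flip is never applied, so it can be replaced by any other. -/
theorem LAct.map (h : LAct flip a k σ τ F) (ha : a ≠ .bar) (f : X → Y) (flip' : Y → Y) :
    LAct flip' a k (σ.map (Prod.map f id)) (τ.map (Prod.map f id)) fun δ => F (δ.comap f) := by
  induction h with
  | cup d x σ => exact .cup d (f x) _
  | cap d x σ => exact .cap d (f x) _
  | cross o p q σ => exact .cross o (Prod.map f id p) (Prod.map f id q) _
  | virt p q σ => exact .virt (Prod.map f id p) (Prod.map f id q) _
  | bar => exact absurd rfl ha
  | succ a k p σ τ F h ih => exact .succ _ _ (Prod.map f id p) _ _ _ (ih ha)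

theorem Img.map (h : Img flip w σ τ F) (hw : NoBar w) (f : X → Y) (flip' : Y → Y) :
    Img flip' w (σ.map (Prod.map f id)) (τ.map (Prod.map f id)) fun δ => F (δ.comap f) := by
  induction h with
  | nil => exact .nil _
  | cons a k w σ ρ τ F G h hr ih =>
    rw [noBar_cons] at hw
    exact .step (h.map hw.1 f flip') (ih hw.2)

/-- The datum which keeps the strands with one label, with all crossings in one mode. -/
def Datum.only [DecidableEq X] (x : X) (b : Bool) : Datum X := ⟨fun y => y = x, fun _ _ => some b⟩

@[simp] theorem Datum.only_keep [DecidableEq X] (x y : X) (b : Bool) :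
    (Datum.only x b).keep y = decide (y = x) := rfl

@[simp] theorem Datum.only_mode [DecidableEq X] (x y z : X) (b : Bool) :
    (Datum.only x b).mode y z = some b := rfl

/-- A label that enters at a minimal point has a non-empty image under `Datum.only`. So labels whose
image is empty never occur, and the image depends only on the values of the datum at labels that do.
-/
theorem LAct.congr_of_present [DecidableEq X] {P : X → Prop} (h : LAct flip a k σ τ F)
    (ha : a ≠ .bar) (hσ : ∀ p ∈ σ, P p.1) (hP : ∀ x, ¬ P x → F (.only x false) = []) :
    (∀ p ∈ τ, P p.1) ∧ ∀ δ δ' : Datum X, (∀ x, P x → δ.keep x = δ'.keep x) →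
      (∀ x y, P x → P y → δ.keep x → δ.keep y → δ.mode x y = δ'.mode x y) → F δ = F δ' := by
  induction h with
  | cup d x σ =>
    -- Otherwise the image under `Datum.only x false` would be empty, while it contains this minimal
    -- point.
    have hx : P x := by
      by_contra hx
      simpa using hP x hx
    refine ⟨by simpa [hx] using hσ, fun δ δ' h _ => by simp [h x hx]⟩
  | cap d x σ =>
    simp only [List.forall_mem_cons] at hσ
    exact ⟨hσ.2.2, fun δ δ' h _ => by simp [h x hσ.1]⟩
  | cross o p q σ =>
    simp only [List.forall_mem_cons] at hσ ⊢
    refine ⟨⟨hσ.2.1, hσ.1, hσ.2.2⟩, fun δ δ' h h' => ?_⟩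
    rw [← h _ hσ.1, ← h _ hσ.2.1]
    cases h₁ : δ.keep p.1 <;> cases h₂ : δ.keep q.1 <;> simp
    rw [h' _ _ hσ.1 hσ.2.1 h₁ h₂]
  | virt p q σ =>
    simp only [List.forall_mem_cons] at hσ ⊢
    exact ⟨⟨hσ.2.1, hσ.1, hσ.2.2⟩, fun δ δ' h _ => by simp [h _ hσ.1, h _ hσ.2.1]⟩
  | bar => exact absurd rfl ha
  | succ a k p σ τ F h ih =>
    simp only [List.forall_mem_cons] at hσ ⊢
    obtain ⟨h₁, h₂⟩ := ih ha hσ.2 fun x hx => by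
      have := hP x hx
      dsimp only at this
      split at this
      · simpa using this
      · exact this
    exact ⟨⟨hσ.1, h₁⟩, fun δ δ' h h' => by rw [h₂ δ δ' h h', h _ hσ.1]⟩

theorem Img.congr_of_present [DecidableEq X] {P : X → Prop} (h : Img flip w σ τ F)
    (hw : NoBar w) (hσ : ∀ p ∈ σ, P p.1) (hP : ∀ x, ¬ P x → F (.only x false) = [])
    {δ δ' : Datum X} (hk : ∀ x, P x → δ.keep x = δ'.keep x)
    (hm : ∀ x y, P x → P y → δ.keep x → δ.keep y → δ.mode x y = δ'.mode x y) : F δ = F δ' := by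
  induction h with
  | nil => rfl
  | cons a k w σ ρ τ F G h hr ih =>
    simp only [noBar_cons, List.append_eq_nil_iff] at hw hP
    obtain ⟨h₁, h₂⟩ := h.congr_of_present hw.1 hσ fun x hx => (hP x hx).1
    dsimp only
    rw [h₂ δ δ' hk hm, ih hw.2 h₁ fun x hx => (hP x hx).2]

theorem Img.congr [DecidableEq X] (h : Img flip w σ τ F) (hw : NoBar w) {δ δ' : Datum X}
    (hk : ∀ x, δ.keep x = δ'.keep x)
    (hm : ∀ x y, δ.keep x → δ.keep y → δ.mode x y = δ'.mode x y) : F δ = F δ' :=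
  h.congr_of_present (P := fun _ => True) hw (by simp) (by simp) (fun x _ => hk x)
    fun x y _ _ => hm x y

theorem LAct.virtConj (h : LAct flip a k σ τ F) {δ δ' : Datum X}
    (hk : ∀ x, δ'.keep x = δ.keep x) (hm : ∀ x y, δ.mode x y = some false)
    (hm' : ∀ x y, δ'.mode x y = some true) : F δ' = TwistedLinks.virtConj (F δ) := by
  induction h with
  | cup d x σ => dsimp only; rw [hk]; split <;> rfl
  | cap d x σ => dsimp only; rw [hk]; split <;> rfl
  | cross o p q σ =>
    dsimp only
    rw [hk, hk, hm, hm']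
    split <;> rfl
  | virt p q σ => dsimp only; rw [hk, hk]; split <;> rfl
  | bar => rfl
  | succ a k p σ τ F h ih =>
    dsimp only
    rw [hk, ih]
    split
    · rw [virtConj_shift]
    · rfl

theorem Img.virtConj (h : Img flip w σ τ F) {δ δ' : Datum X} (hk : ∀ x, δ'.keep x = δ.keep x)
    (hm : ∀ x y, δ.mode x y = some false) (hm' : ∀ x y, δ'.mode x y = some true) :
    F δ' = TwistedLinks.virtConj (F δ) := by
  induction h with
  | nil => rfl
  | cons a k w σ ρ τ F G h hr ih =>
    dsimp only
    rw [virtConj_append, h.virtConj hk hm hm', ih]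

theorem virtConj_eq_nil {w : Word} : TwistedLinks.virtConj w = [] ↔ w = [] := by
  cases w with
  | nil => simp
  | cons p w =>
    obtain ⟨a, k⟩ := p
    cases a <;> simp [TwistedLinks.virtConj, modeAt]

theorem Img.only_eq_nil [DecidableEq X] (h : Img flip w σ τ F) (x : X) (b : Bool) :
    F (.only x b) = [] ↔ F (.only x false) = [] := by
  cases b
  · rfl
  · rw [h.virtConj (δ := .only x false) (δ' := .only x true) (fun _ => rfl) (fun _ _ => rfl) (fun _ _ => rfl),
      virtConj_eq_nil]

/-- New labels come in only at minimal points, one at each. -/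
theorem LAct.exists_labels (h : LAct flip a k σ τ F) (ha : a ≠ .bar) :
    ∃ l : List X, l.length ≤ 1 ∧ (∀ p ∈ τ, p.1 ∈ l ∨ ∃ q ∈ σ, q.1 = p.1) ∧
      ∀ δ : Datum X, (∀ p ∈ σ, δ.keep p.1 = false) → (∀ x ∈ l, δ.keep x = false) → F δ = [] := by
  induction h with
  | cup d x σ =>
    refine ⟨[x], le_rfl, ?_, fun δ _ h => by simpa using h⟩
    simp only [List.forall_mem_cons, List.mem_singleton, true_or, true_and]
    exact fun p hp => .inr ⟨p, hp, rfl⟩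
  | cap d x σ =>
    exact ⟨[], by simp, fun p hp => .inr ⟨p, by simp [hp], rfl⟩, fun δ h _ => by simp_all⟩
  | cross o p q σ =>
    refine ⟨[], by simp, fun r hr => .inr ⟨r, ?_, rfl⟩, fun δ h _ => by simp_all⟩
    simp only [List.mem_cons] at hr ⊢
    tauto
  | virt p q σ =>
    refine ⟨[], by simp, fun r hr => .inr ⟨r, ?_, rfl⟩, fun δ h _ => by simp_all⟩
    simp only [List.mem_cons] at hr ⊢
    tauto
  | bar => exact absurd rfl ha
  | succ a k p σ τ F h ih =>
    obtain ⟨l, hl, h₁, h₂⟩ := ih ha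
    refine ⟨l, hl, ?_, fun δ h h' => ?_⟩
    · simp only [List.forall_mem_cons]
      refine ⟨.inr ⟨p, by simp, rfl⟩, fun q hq => (h₁ q hq).imp_right ?_⟩
      rintro ⟨r, hr, e⟩
      exact ⟨r, by simp [hr], e⟩
    · simp only [List.forall_mem_cons] at h
      simp [h.1, h₂ δ h.2 h']

/-- There are no more labels than events, up to labels at the bottom. -/
theorem Img.exists_labels (h : Img flip w σ τ F) (hw : NoBar w) :
    ∃ l : List X, l.length ≤ w.length ∧ ∀ δ : Datum X, (∀ p ∈ σ, δ.keep p.1 = false) →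
      (∀ x ∈ l, δ.keep x = false) → F δ = [] := by
  induction h with
  | nil => exact ⟨[], by simp, fun _ _ _ => rfl⟩
  | cons a k w σ ρ τ F G h hr ih =>
    rw [noBar_cons] at hw
    obtain ⟨l, hl, h₁, h₂⟩ := h.exists_labels hw.1
    obtain ⟨m, hm, h₃⟩ := ih hw.2
    refine ⟨l ++ m, by simp; omega, fun δ hσ h => ?_⟩
    simp only [List.mem_append, or_imp, forall_and] at h
    dsimp only
    rw [h₂ δ hσ h.1, h₃ δ (fun p hp => ?_) h.2, List.append_nil]
    rcases h₁ p hp with h' | ⟨q, hq, e⟩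
    · exact h.1 _ h'
    · rw [← e]
      exact hσ q hq

/-! ### Labels for the colours of a split diagram -/

/-- Gives a first labelling to start from: one label everywhere, for which keeping all strands and
all crossings reproduces the word. -/
theorem exists_img {w : Word} {s t : List Bool} (h : Run w s t) (hw : NoBar w) :
    ∃ F : Datum Unit → Word, Img id w (s.map ((), ·)) (t.map ((), ·)) F ∧
      F ⟨fun _ => true, fun _ _ => some false⟩ = w := by
  induction h with
  | nil s => exact ⟨_, .nil _, rfl⟩
  | cons a l m u v t w h hr ih =>
    rw [noBar_cons] at hw
    obtain ⟨G, hG, e⟩ := ih hw.2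
    obtain ⟨F, hF, e'⟩ : ∃ F : Datum Unit → Word, LAct id a 0 ((l ++ v).map ((), ·))
        ((m ++ v).map ((), ·)) F ∧ F ⟨fun _ => true, fun _ _ => some false⟩ = [⟨a, 0⟩] := by
      cases h with
      | cup d => exact ⟨_, .cup d () _, rfl⟩
      | cap d => exact ⟨_, .cap d () _, rfl⟩
      | cross o x y => exact ⟨_, .cross o ((), x) ((), y) _, rfl⟩
      | virt x y => exact ⟨_, .virt ((), x) ((), y) _, rfl⟩
      | bar => exact absurd rfl hw.1
    have hk : ∀ u : List Bool, Datum.kept (⟨fun _ => true, fun _ _ => some false⟩ : Datum Unit)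
        (u.map ((), ·)) = u := by
      intro u
      induction u with
      | nil => rfl
      | cons d u ih => simp [Datum.kept_cons, ih]
    have h₁ := hF.add (u.map ((), ·))
    simp only [List.length_map, Nat.zero_add, ← List.map_append, ← List.append_assoc] at h₁
    exact ⟨_, .step h₁ hG, by simp [hk, e, e']⟩

/-- Strands with two labels. -/
def joint (σ : List (X × Bool)) (τ : List (Y × Bool)) : List ((X × Y) × Bool) :=
  List.zipWith (fun p q => ((p.1, q.1), p.2)) σ τ

/-- The event respects both kinds of labels: its strands share one colour `c`, while the labels from
`X` are arbitrary. Hence the pairs are again an admissible labelling. -/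
theorem LAct.joint_zero {l m : List Bool} (h : LAct flip a 0 σ ρ F) (hA : a.Acts l m)
    (ha : a ≠ .bar) (flip' : X × Y → X × Y) (c : Y) (v : List (Y × Bool))
    (hσ : σ.map Prod.snd = l ++ v.map Prod.snd) :
    ρ.map Prod.snd = m ++ v.map Prod.snd ∧ ∃ G,
      LAct flip' a 0 (joint σ (l.map (c, ·) ++ v)) (joint ρ (m.map (c, ·) ++ v)) G ∧
      (∀ δ δ', (∀ x, δ'.keep (x, c) = δ.keep x) →
        (∀ x y, δ'.mode (x, c) (y, c) = δ.mode x y) → G δ' = F δ) ∧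
      (∀ δ', (∀ x y, δ'.mode (x, c) (y, c) = some false) → (∀ x, δ'.keep (x, c) = true) →
        G δ' = [⟨a, 0⟩]) ∧
      ∀ δ', (∀ x, δ'.keep (x, c) = false) → G δ' = [] := by
  cases hA with
  | cup d =>
    cases h with | cup _ x _ =>
    exact ⟨by simpa using hσ, _, .cup d (x, c) _, fun δ δ' h _ => by simp [h],
      fun δ' _ h => by simp [h], fun δ' h => by simp [h]⟩
  | cap d =>
    cases h with | cap _ x _ =>
    exact ⟨by simpa using hσ, _, .cap d (x, c) _, fun δ δ' h _ => by simp [h],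
      fun δ' _ h => by simp [h], fun δ' h => by simp [h]⟩
  | cross o d e =>
    cases h with | cross _ p q _ =>
    refine ⟨by simpa [and_left_comm] using hσ, _, .cross o ((p.1, c), p.2) ((q.1, c), q.2) _,
      fun δ δ' h h' => by simp [h, h'],
      fun δ' h h' => by simp [h, h', modeAt], fun δ' h => by simp [h]⟩
  | virt d e =>
    cases h with | virt p q _ =>
    refine ⟨by simpa [and_left_comm] using hσ, _, .virt ((p.1, c), p.2) ((q.1, c), q.2) _,
      fun δ δ' h h' => by simp [h],
      fun δ' h h' => by simp [h'], fun δ' h => by simp [h]⟩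
  | bar => exact absurd rfl ha

theorem kept_joint_left {δ : Datum X} {δ' : Datum (X × Y)}
    (h : ∀ x y, δ'.keep (x, y) = δ.keep x) {σ : List (X × Bool)} {τ : List (Y × Bool)}
    (hl : σ.length = τ.length) : δ'.kept (joint σ τ) = δ.kept σ := by
  induction σ generalizing τ with
  | nil => cases τ <;> rfl
  | cons p σ ih =>
    cases τ with
    | nil => simp at hl
    | cons q τ =>
      have := ih (τ := τ) (by simpa using hl)
      simp only [joint, List.zipWith_cons_cons, Datum.kept_cons, h] at this ⊢
      rw [this]

/-- Compares the position of an event in the image with the count of strands of its colour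
prescribed by `Splits`. -/
theorem kept_joint_right [DecidableEq Y] {j : Y} {δ' : Datum (X × Y)}
    (h : ∀ x y, δ'.keep (x, y) = decide (y = j)) {σ : List (X × Bool)} {τ : List (Y × Bool)}
    (hl : σ.length = τ.length) :
    (δ'.kept (joint σ τ)).length = (τ.filter fun x => x.1 = j).length := by
  induction σ generalizing τ with
  | nil =>
    cases τ with
    | nil => rfl
    | cons => simp at hl
  | cons p σ ih =>
    cases τ with
    | nil => simp at hl
    | cons q τ =>
      have := ih (τ := τ) (by simpa using hl)
      by_cases hq : q.1 = j <;>
        simpa [joint, Datum.kept_cons, h, hq, List.filter_cons] using this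

theorem joint_append {σ σ' : List (X × Bool)} {τ τ' : List (Y × Bool)}
    (h : σ.length = τ.length) : joint (σ ++ σ') (τ ++ τ') = joint σ τ ++ joint σ' τ' :=
  List.zipWith_append h

/-- The labels of a word and the colours of a splitting, taken together. -/
theorem Splits.joint [DecidableEq Y] {τ : List (Y × Bool)} {E : Y → Word} (h : Splits w τ E)
    (hw : NoBar w) (hF : Img flip w σ [] F) (hσ : σ.map Prod.snd = τ.map Prod.snd)
    (flip' : X × Y → X × Y) :
    ∃ G, Img flip' w (TwistedLinks.joint σ τ) [] G ∧
      (∀ δ δ', (∀ x j, δ'.keep (x, j) = δ.keep x) →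
        (∀ x y j, δ'.mode (x, j) (y, j) = δ.mode x y) → G δ' = F δ) ∧
      ∀ δ' j, (∀ x j', δ'.keep (x, j') = decide (j' = j)) →
        (∀ x y, δ'.mode (x, j) (y, j) = some false) → G δ' = E j := by
  induction h generalizing σ F with
  | nil =>
    cases hF
    exact ⟨_, .nil _, fun _ _ _ _ => rfl, fun _ _ _ _ => rfl⟩
  | cons a c l m u v w E hA hs ih =>
    rw [noBar_cons] at hw
    cases hF with | cons _ _ _ _ ρ _ F₁ F₂ h₁ h₂ =>
    rw [← Nat.zero_add u.length] at h₁
    obtain ⟨u', σ', ρ', F, hu, rfl, rfl, hF, rfl⟩ := lact_add h₁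
    simp only [List.map_append, List.map_map, List.append_assoc] at hσ
    obtain ⟨hσ₁, hσ₂⟩ := List.append_inj hσ (by simp [hu])
    obtain ⟨hρ, G, hG, g₁, g₂, g₃⟩ := hF.joint_zero hA hw.1 flip' c v
      (by simpa [Function.comp_def] using hσ₂)
    obtain ⟨H, hH, e₁, e₂⟩ := ih hw.2 h₂ (by simp [hσ₁, hρ, Function.comp_def])
    have h₃ := hG.add (TwistedLinks.joint u' u)
    have hl : (TwistedLinks.joint u' u).length = u.length := by simp [TwistedLinks.joint, hu]
    rw [hl, Nat.zero_add] at h₃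
    rw [List.append_assoc, joint_append hu] at hH
    rw [List.append_assoc, joint_append hu]
    refine ⟨_, .step h₃ hH, fun δ δ' hk hm => ?_, fun δ' j hk hm => ?_⟩
    · rw [e₁ δ δ' hk hm, g₁ δ δ' (fun x => hk x c) fun x y => hm x y c, kept_joint_left hk hu]
    · rw [e₂ δ' j hk hm, kept_joint_right hk hu]
      by_cases hj : c = j
      · subst hj
        rw [g₂ δ' hm fun x => by simp [hk]]
        simp
      · rw [g₃ δ' fun x => by simp [hk, hj], Function.update_of_ne (Ne.symm hj)]
        rfl

theorem Splits.run [DecidableEq Y] {τ : List (Y × Bool)} {E : Y → Word} (h : Splits w τ E) :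
    Run w (τ.map Prod.snd) [] := by
  induction h with
  | nil => exact .nil _
  | cons a c l m u v w E hA hs ih =>
    have := Run.cons a l m (u.map Prod.snd) (v.map Prod.snd) [] w hA
      (by simpa [Function.comp_def] using ih)
    simpa [Function.comp_def] using this

/-- The colours of a splitting of a closed word, as labels. -/
theorem Splits.exists_img [DecidableEq Y] {E : Y → Word} (h : Splits w [] E) (hw : NoBar w)
    (f : Y → X) (flip : X → X) :
    ∃ G, Img flip w [] [] G ∧
      (∀ δ, (∀ j, δ.keep (f j) = true) → (∀ j, δ.mode (f j) (f j) = some false) → G δ = w) ∧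
      ∀ δ j, (∀ j', δ.keep (f j') = decide (j' = j)) → δ.mode (f j) (f j) = some false →
        G δ = E j := by
  obtain ⟨F, hF, e⟩ := TwistedLinks.exists_img h.run hw
  obtain ⟨G, hG, e₁, e₂⟩ := h.joint hw hF rfl id
  refine ⟨_, hG.map hw (fun p => f p.2) flip, fun δ hk hm => ?_, fun δ j hk hm => ?_⟩
  · rw [e₁ ⟨fun _ => true, fun _ _ => some false⟩ _ (fun _ j => hk j) fun _ _ j => hm j, e]
  · exact e₂ _ j (fun _ j' => hk j') fun _ _ => hm

end

end TwistedLinks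

namespace TwistedLinks

section

variable {X Y : Type} {flip : X → X} {w w' : Word} {F G : Datum X → Word}

/-! ### Disjoint unions of diagrams -/

theorem flatten_closed {l : List X} {f : X → Word} (h : ∀ x ∈ l, Run (f x) [] []) :
    Run (l.map f).flatten [] [] := by
  induction l with
  | nil => exact .nil _
  | cons x l ih =>
    simp only [List.forall_mem_cons] at h
    exact h.1.append (ih h.2)

theorem flatten_noBar {l : List X} {f : X → Word} (h : ∀ x ∈ l, NoBar (f x)) :
    NoBar (l.map f).flatten := by
  induction l with
  | nil => simp
  | cons x l ih =>
    simp only [List.forall_mem_cons] at h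
    exact noBar_append.2 ⟨h.1, ih h.2⟩

theorem flatten_eqv {R : Word → Word → Prop} {l : List X} {f g : X → Word}
    (hf : ∀ x, Run (f x) [] []) (h : ∀ x, Eqv R [] [] (f x) (g x)) :
    Eqv R [] [] (l.map f).flatten (l.map g).flatten := by
  induction l with
  | nil => exact .refl _
  | cons x l ih => exact (h x).append ih (hf x) (flatten_closed fun x _ => hf x)

/-- Diagrams put on top of each other. -/
def VirtualDiagram.stack (l : List VirtualDiagram) : VirtualDiagram where
  word := (l.map VirtualDiagram.word).flatten
  closed := flatten_closed fun D _ => D.closed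
  noBar := flatten_noBar fun D _ => D.noBar

/-- A closed word stacked below a split one may be given any colour, including one already in use.
-/
theorem Splits.append [DecidableEq X] {s : List Bool} {E : X → Word} (h : Run w s []) (c : X)
    (h' : Splits w' [] E) :
    Splits (w ++ w') (s.map (c, ·)) (Function.update E c (w ++ E c)) := by
  generalize hr : ([] : List Bool) = r at h
  induction h with
  | nil s =>
    subst hr
    simpa using h'
  | cons a l m u v t w hA hw ih =>
    have := Splits.cons a c l m (u.map (c, ·)) (v.map (c, ·)) _ _ hA (by simpa using ih hr)
    simpa [List.filter_map, Function.comp_def] using this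

theorem splits_flatten [DecidableEq X] {l : List X} (hl : l.Nodup) {f : X → Word}
    (hf : ∀ x, Run (f x) [] []) :
    Splits (l.map f).flatten [] fun x => if x ∈ l then f x else [] := by
  induction l with
  | nil => simpa using Splits.nil
  | cons x l ih =>
    rw [List.nodup_cons] at hl
    have := Splits.append (hf x) x (ih hl.2)
    simp only [List.map_nil] at this
    simp only [List.map_cons, List.flatten_cons]
    convert this using 1
    funext y
    by_cases hy : y = x
    · subst hy
      simp [hl.1]
    · simp [hy]

/-- The list may run through the colours in any order; this permits permuting the parts later on. -/
theorem isSplit_of_flatten {n : ℕ} {L : VirtualLink} {E : Fin n → VirtualDiagram}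
    {l : List (Fin n)} (hl : l.Nodup) (hl' : ∀ i, i ∈ l) (hE : ∀ i, (E i).word ≠ [])
    (hL : L = (VirtualDiagram.stack (l.map E)).link) : L.IsSplit fun i => (E i).link := by
  refine ⟨_, E, hL.symm, fun _ => rfl, ?_, hE⟩
  have := splits_flatten hl (f := fun i => (E i).word) fun i => (E i).closed
  simpa [hl', VirtualDiagram.stack, Function.comp_def] using this

theorem isSplit_of_stack {L : VirtualLink} {l : List VirtualDiagram}
    (hl : ∀ E ∈ l, E.word ≠ []) (hL : L = (VirtualDiagram.stack l).link) :
    L.IsSplit fun i : Fin l.length => (l.get i).link :=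
  isSplit_of_flatten (List.nodup_finRange _) List.mem_finRange (fun i => hl _ (l.get_mem i))
    (by rw [hL, List.map_get_finRange])

/-- Parts may lie inside each other in the plane; the detour move pulls them apart and puts them on
top of each other. -/
theorem Splits.eqv_flatten {n : ℕ} {E : Fin n → Word} (h : Splits w [] E) (hw : NoBar w) :
    VEqv [] [] w ((List.finRange n).map E).flatten := by
  obtain ⟨G, hG, e₁, e₂⟩ := h.exists_img hw id id
  have := hG.separate_colours hw id (List.finRange n) (List.nodup_finRange _)
    -- Strands of different colours never meet, so declaring their crossings virtual changes nothing
    -- but makes the separation applicable.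
    ⟨fun _ => true, fun i j => if i = j then some false else none⟩
    (fun i _ => List.mem_finRange i) (fun i j _ _ hij => if_neg hij)
  rw [e₁ _ (fun _ => rfl) fun _ => if_pos rfl] at this
  convert this using 4 with i
  exact (e₂ _ i (fun j => by simp) (if_pos rfl)).symm

theorem VirtualLink.IsSplit.eq_stack {n : ℕ} {L : VirtualLink} {A : Fin n → VirtualLink}
    (h : L.IsSplit A) : ∃ E : Fin n → VirtualDiagram, (∀ i, (E i).link = A i) ∧
      (∀ i, (E i).word ≠ []) ∧ L = (VirtualDiagram.stack ((List.finRange n).map E)).link := by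
  obtain ⟨D, E, rfl, hA, hs, hE⟩ := h
  refine ⟨E, hA, hE, VirtualDiagram.link_eq_iff.2 ?_⟩
  simpa [VirtualDiagram.stack, Function.comp_def] using hs.eqv_flatten D.noBar

/-! ### Maximal split decompositions exist -/

/-- The labels of the `n` parts are carried to `w'`. If some `i` had no label there, its image would
be empty, and so would `E i` by `Eqv.nil_iff`. Labels are introduced by events, so there are at most
`w'.length` of them. -/
theorem Splits.card_le {n : ℕ} {E : Fin n → Word} (h : Splits w [] E) (hw : NoBar w)
    (hE : ∀ i, E i ≠ []) (e : VEqv [] [] w w') : n ≤ w'.length := by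
  obtain ⟨F, hF, -, e₂⟩ := h.exists_img hw (fun i => (i, false))
    fun x : Fin n × Bool => (x.1, !x.2)
  obtain ⟨G, hG, e'⟩ := e.twisted.transport (fun x => by simp) hF
  obtain ⟨l, hl, h'⟩ := hG.exists_labels (e.noBar_iff.1 hw)
  have key : ∀ i, i ∈ l.map Prod.fst := by
    intro i
    by_contra hi
    have h₁ := e' (fun x => if x.1 = i then some x.2 else none) fun x => by
      dsimp only; split <;> rfl
    rw [e₂ _ i (fun j => by by_cases hj : j = i <;> simp [hj]) (by simp [sheetDatum, sheetMode]),
      h' _ (by simp) fun x hx => ?_] at h₁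
    · exact hE i (h₁.nil_iff.2 rfl)
    · have : x.1 ≠ i := fun hxi => hi (hxi ▸ List.mem_map_of_mem hx)
      simp [this]
  have : (Finset.univ : Finset (Fin n)).card ≤ (l.map Prod.fst).toFinset.card :=
    Finset.card_le_card fun i _ => by simpa using key i
  calc n = (Finset.univ : Finset (Fin n)).card := by simp
    _ ≤ (l.map Prod.fst).toFinset.card := this
    _ ≤ _ := (List.toFinset_card_le _).trans (by simpa using hl)

theorem length_le_of_stack {D : VirtualDiagram} {l : List VirtualDiagram}
    (hl : ∀ E ∈ l, E.word ≠ []) (hD : D.link = (VirtualDiagram.stack l).link) :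
    l.length ≤ D.word.length := by
  obtain ⟨D', E, hD', -, hs, hE⟩ := isSplit_of_stack hl hD
  exact hs.card_le D'.noBar hE (VirtualDiagram.link_eq_iff.1 hD')

/-- A stack of non-empty diagrams with the largest number of members has non-splittable members: a
splittable one could be replaced by at least two. -/
theorem exists_maximal (D : VirtualDiagram) : ∃ l : List VirtualDiagram,
    (∀ E ∈ l, E.word ≠ []) ∧ D.link = (VirtualDiagram.stack l).link ∧
      ∀ E ∈ l, ¬ E.link.Splittable := by
  let S : Set ℕ := {n | ∃ l : List VirtualDiagram, (∀ E ∈ l, E.word ≠ []) ∧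
    D.link = (VirtualDiagram.stack l).link ∧ l.length = n}
  have hb : ∀ n ∈ S, n ≤ D.word.length := by
    rintro n ⟨l, hl, hD, rfl⟩
    exact length_le_of_stack hl hD
  have hne : S.Nonempty := by
    -- The empty diagram is the stack of no diagrams; otherwise `D` is the stack of itself alone.
    by_cases h : D.word = []
    · refine ⟨0, [], by simp, ?_, rfl⟩
      congr 1
      exact VirtualDiagram.ext h
    · refine ⟨1, [D], by simpa using h, ?_, rfl⟩
      congr 1
      exact VirtualDiagram.ext (by simp [VirtualDiagram.stack])
  obtain ⟨l, hl, hD, hn⟩ := Nat.sSup_mem hne ⟨_, hb⟩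
  refine ⟨l, hl, hD, fun E hE ⟨k, A, hk, hA⟩ => ?_⟩
  obtain ⟨B, -, hB, hEB⟩ := hA.eq_stack
  obtain ⟨s, t, rfl⟩ := List.append_of_mem hE
  have hS : (s ++ ((List.finRange k).map B ++ t)).length ∈ S := by
    refine ⟨_, ?_, ?_, rfl⟩
    · simp only [List.mem_append, List.mem_cons, or_imp, forall_and] at hl ⊢
      refine ⟨hl.1, ?_, hl.2.2⟩
      simpa using hB
    · rw [hD, VirtualDiagram.link_eq_iff]
      have e := VirtualDiagram.link_eq_iff.1 hEB
      have := e.comp (VirtualDiagram.stack s).closed (VirtualDiagram.stack t).closed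
      simpa [VirtualDiagram.stack] using this
  have := le_csSup ⟨_, hb⟩ hS
  rw [← hn] at this
  simp at this
  omega

/-- Among the pieces of a non-splittable diagram, exactly one is non-empty. -/
theorem existsUnique_ne_nil {D : VirtualDiagram} (hD : ¬ D.link.Splittable) (hD' : D.word ≠ [])
    {l : List X} {f : X → Word} (hf : ∀ x, Run (f x) [] [])
    (hb : ∀ x, NoBar (f x)) (e : VEqv [] [] D.word (l.map f).flatten) :
    ∃ x ∈ l, VEqv [] [] D.word (f x) ∧ ∀ y ∈ l, f y ≠ [] ↔ y = x := by
  classical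
  -- `m` lists the labels of the non-empty pieces. None would make `D` empty, and two or more would
  -- split it.
  obtain ⟨m, hm, hmem⟩ : ∃ m : List X, (l.map f).flatten = (m.map f).flatten ∧
      ∀ x, x ∈ m ↔ x ∈ l ∧ f x ≠ [] := by
    refine ⟨l.filter fun x => f x ≠ [], ?_, by simp⟩
    clear e
    induction l with
    | nil => rfl
    | cons x l ih => by_cases hx : f x = [] <;> simp_all
  rw [hm] at e
  match m with
  | [] => exact absurd (e.nil_iff.2 rfl) hD'
  | [x] =>
    refine ⟨x, ((hmem x).1 (by simp)).1, by simpa using e, fun y hy => ?_⟩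
    have := hmem y
    simp only [hy, true_and, List.mem_singleton] at this
    exact this.symm
  | x :: y :: t =>
    refine absurd ⟨((x :: y :: t).map fun x => ⟨f x, hf x, hb x⟩ : List VirtualDiagram).length, _,
      by simp, isSplit_of_stack (l := (x :: y :: t).map fun x => ⟨f x, hf x, hb x⟩) ?_ ?_⟩ hD
    · intro E hE
      obtain ⟨z, hz, rfl⟩ := List.mem_map.1 hE
      exact ((hmem z).1 hz).2
    · rw [VirtualDiagram.link_eq_iff]
      simpa [VirtualDiagram.stack, Function.comp_def] using e

end

end TwistedLinks

/-! ### Comparison of two maximal split decompositions -/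

namespace TwistedLinks

section

variable {w w' : Word} {n m : ℕ} {E : Fin n → VirtualDiagram} {E' : Fin m → VirtualDiagram}

/-- The pieces of a split diagram, found again in a split diagram of the same twisted link: the
piece `i` is the part with label `((i, β i), J i)`. -/
theorem exists_pieces (hw : NoBar w) (hw' : NoBar w') (e : TEqv [] [] w w')
    (h : Splits w [] fun i => (E i).word) (h' : Splits w' [] fun j => (E' j).word)
    (hE : ∀ i, (E i).word ≠ []) (hs : ∀ i, ¬ (E i).link.Splittable) :
    ∃ (G : Datum ((Fin n × Bool) × Fin m) → Word) (J : Fin n → Fin m) (β : Fin n → Bool),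
      Img id w' [] [] G ∧
      (∀ i b j, G (.only ((i, b), j) false) ≠ [] ↔ b = β i ∧ j = J i) ∧
      (∀ j, G ⟨fun x => x.2 = j, fun _ _ => some false⟩ = (E' j).word) ∧
      ∀ i, VEqv [] [] (E i).word (G (.only ((i, β i), J i) (β i))) := by
  obtain ⟨F, hF, -, e₁⟩ := h.exists_img hw (fun i => (i, false))
    fun x : Fin n × Bool => (x.1, !x.2)
  obtain ⟨F', hF', e₂⟩ := e.transport (fun x => by simp) hF
  obtain ⟨G, hG, e₃, e₄⟩ := h'.joint hw' hF' rfl id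
  -- The sheets for part `i`: strands of all other parts are removed.
  let s : Fin n → Fin n × Bool → Option Bool := fun i x => if x.1 = i then some x.2 else none
  -- This is the sheet datum for `i`, except that crossings between different colours of `w'` count
  -- as virtual. There are no such crossings, and the datum now separates by sheet and colour at
  -- once.
  let δ : Fin n → Datum ((Fin n × Bool) × Fin m) := fun i =>
    ⟨fun x => x.1.1 = i, fun x y => if x.2 = y.2 then (sheetDatum (s i)).mode x.1 y.1 else none⟩
  have hk : ∀ i x, (sheetDatum (s i)).keep x = decide (x.1 = i) := fun i x => by
    by_cases hx : x.1 = i <;> simp [s, hx]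
  have hm : ∀ i b c, (sheetDatum (s i)).mode (i, b) (i, c) = sheetMode b c := fun i b c =>
    sheetDatum_mode (by simp [s]) (by simp [s])
  have e₅ : ∀ i, VEqv [] [] (E i).word (G (δ i)) := by
    intro i
    have := e₂ (s i) fun x => by dsimp only [s]; split <;> rfl
    rwa [e₁ _ i (fun j => hk i _) (by rw [hm, sheetMode_self]), ← e₃ _ (δ i) (fun x j => (hk i x).symm)
      fun x y j => if_pos rfl] at this
  have e₆ : ∀ i, VEqv [] [] (E i).word ((Finset.univ : Finset (Bool × Fin m)).toList.map fun y =>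
      G (.only ((i, y.1), y.2) y.1)).flatten := by
    intro i
    have := hG.separate_colours hw' (fun x => (x.1.2, x.2))
      (Finset.univ : Finset (Bool × Fin m)).toList (Finset.nodup_toList _) (δ i)
      (fun x _ => by simp) (by
        rintro ⟨⟨i₁, b⟩, j⟩ ⟨⟨i₂, c⟩, j'⟩ h₁ h₂ h₃
        simp only [δ, decide_eq_true_eq] at h₁ h₂
        subst h₁ h₂
        simp only [δ, hm]
        split
        · next hj =>
          have : b ≠ c := fun hb => h₃ (by simp [hb]; exact hj)
          simp [sheetMode, this]
        · rfl)
    refine (e₅ i).trans ?_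
    convert this using 4 with y
    -- With one sheet `b` left, all remaining crossings are in the mode `some b`.
    refine hG.congr hw' ?_ ?_
    · rintro ⟨⟨i', b⟩, j⟩
      obtain ⟨b', j'⟩ := y
      simp only [Datum.only_keep, Datum.restrict_keep, δ, Prod.mk.injEq, Bool.decide_and,
        Bool.and_assoc]
    · rintro x x' hx hx'
      simp only [Datum.only_keep, decide_eq_true_eq] at hx hx'
      subst hx hx'
      simp [δ, hm, sheetMode_self]
  have hrun : ∀ δ, Run (G δ) [] [] := fun δ => hG.run δ (.inl hw')
  choose y _ hy hy' using fun i => existsUnique_ne_nil (hs i) (hE i) (fun _ => hrun _)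
    (fun _ => hG.noBar _) (e₆ i)
  refine ⟨G, fun i => (y i).2, fun i => (y i).1, hG, fun i b j => ?_, fun j => ?_, hy⟩
  · rw [← Prod.mk_inj (a₁ := b) (b₁ := j), Prod.mk.eta, ← hy' i (b, j) (by simp)]
    exact (hG.only_eq_nil _ b).not.symm
  · exact e₄ _ j (fun _ _ => rfl) fun _ _ => rfl

/-- If `j` were missed by `J`, no label with colour `j` would occur in `w'`, and the part `E' j`
would be empty. -/
theorem surjective_of_pieces {G : Datum ((Fin n × Bool) × Fin m) → Word} {J : Fin n → Fin m}
    {β : Fin n → Bool} (hw' : NoBar w') (hG : Img id w' [] [] G)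
    (h₁ : ∀ i b j, G (.only ((i, b), j) false) ≠ [] ↔ b = β i ∧ j = J i)
    (h₂ : ∀ j, G ⟨fun x => x.2 = j, fun _ _ => some false⟩ = (E' j).word)
    (hE' : ∀ j, (E' j).word ≠ []) : Function.Surjective J := by
  intro j
  by_contra! hj
  refine hE' j ?_
  rw [← h₂, hG.congr_of_present (P := fun x => G (.only x false) ≠ []) hw' (by simp)
    (fun x hx => not_not.1 hx) (δ' := ⟨fun _ => false, fun _ _ => none⟩) ?_ ?_]
  · exact hG.eq_nil fun _ => rfl
  · rintro ⟨⟨i, b⟩, j'⟩ hx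
    have := (h₁ i b j').1 hx
    simpa [this.2] using hj i
  · rintro ⟨⟨i, b⟩, j'⟩ _ hx _ h _
    have := (h₁ i b j').1 hx
    simp only [decide_eq_true_eq] at h
    exact absurd (this.2 ▸ h) (hj i)

theorem card_le_card (hw : NoBar w) (hw' : NoBar w') (e : TEqv [] [] w w')
    (h : Splits w [] fun i => (E i).word) (h' : Splits w' [] fun j => (E' j).word)
    (hE : ∀ i, (E i).word ≠ []) (hE' : ∀ j, (E' j).word ≠ [])
    (hs : ∀ i, ¬ (E i).link.Splittable) : m ≤ n := by
  obtain ⟨G, J, β, hG, h₁, h₂, -⟩ := exists_pieces hw hw' e h h' hE hs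
  simpa using Fintype.card_le_of_surjective J (surjective_of_pieces hw' hG h₁ h₂ hE')

/-- With equal numbers of parts `J` is also injective, so each `E' (J i)` is one whole piece. The
sheet `β i` decides whether `E i` is equivalent to it directly or to its conjugate, which is
equivalent to its image under `s`. -/
theorem exists_bijective {E' : Fin n → VirtualDiagram} (hw : NoBar w) (hw' : NoBar w')
    (e : TEqv [] [] w w')
    (h : Splits w [] fun i => (E i).word) (h' : Splits w' [] fun j => (E' j).word)
    (hE : ∀ i, (E i).word ≠ []) (hE' : ∀ j, (E' j).word ≠ [])
    (hs : ∀ i, ¬ (E i).link.Splittable) : ∃ J : Fin n → Fin n, Function.Bijective J ∧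
      ∀ i, VEqv [] [] (E i).word (E' (J i)).word ∨ VEqv [] [] (E i).word (sWord (E' (J i)).word) := by
  obtain ⟨G, J, β, hG, h₁, h₂, h₃⟩ := exists_pieces hw hw' e h h' hE hs
  have hJ := Finite.surjective_iff_bijective.1 (surjective_of_pieces hw' hG h₁ h₂ hE')
  refine ⟨J, hJ, fun i => ?_⟩
  -- A label of colour `J i` that occurs is `((i', β i'), J i')` with `J i' = J i`, so `i' = i` by
  -- injectivity.
  have e₁ : G (.only ((i, β i), J i) false) = (E' (J i)).word := by
    rw [← h₂]
    refine hG.congr_of_present (P := fun x => G (.only x false) ≠ []) hw' (by simp)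
      (fun x hx => not_not.1 hx) ?_ fun _ _ _ _ _ _ => rfl
    rintro ⟨⟨i', b⟩, j⟩ hx
    obtain ⟨rfl, rfl⟩ := (h₁ i' b j).1 hx
    by_cases hi : i' = i
    · subst hi
      simp
    · simp [hi, hJ.1.eq_iff]
  have e₂ := h₃ i
  cases hb : β i
  · rw [← e₁, hb]
    rw [hb] at e₂
    exact .inl e₂
  · rw [hb] at e₁ e₂
    rw [hG.virtConj (δ := .only ((i, true), J i) false) (δ' := .only ((i, true), J i) true)
      (fun _ => rfl) (fun _ _ => rfl) fun _ _ => rfl, e₁] at e₂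
    exact .inr (e₂.trans (virtConj_eqv_sWord (E' _).closed (E' _).noBar))

theorem VirtualLink.s_s (L : VirtualLink) : L.s.s = L := by
  induction L using Quot.ind with
  | mk D =>
    have : D.s.s = D := by
      apply VirtualDiagram.ext
      change sWord (sWord D.word) = D.word
      simp only [sWord, Word.switch, Word.reflect, List.map_reverse, List.map_map, List.reverse_reverse]
      conv_rhs => rw [← List.map_id D.word]
      refine List.map_congr_left fun p _ => ?_
      obtain ⟨a, k⟩ := p
      cases a <;> simp [Kind.reflect, Kind.switch]
    exact congrArg VirtualDiagram.link this

/-- The parts can be stacked in any order, which allows renumbering the second decomposition along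
`J`. -/
theorem VirtualLink.IsSplit.comp {L : VirtualLink} {A : Fin n → VirtualLink} (h : L.IsSplit A)
    (e : Fin n ≃ Fin n) : L.IsSplit fun i => A (e i) := by
  obtain ⟨E, hA, hE, hL⟩ := h.eq_stack
  have := isSplit_of_flatten (L := L) (l := (List.finRange n).map e.symm) (E := fun i => E (e i))
    ((List.nodup_map_iff e.symm.injective).2 (List.nodup_finRange n))
    (fun i => List.mem_map.2 ⟨e i, List.mem_finRange _, by simp⟩) (fun i => hE _)
    (by rw [hL]; simp [Function.comp_def])
  simpa [hA] using this

theorem VirtualLink.exists_isMaximalSplit (L : VirtualLink) :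
    ∃ (n : ℕ) (A : Fin n → VirtualLink), L.IsMaximalSplit A := by
  induction L using Quot.ind with | mk D =>
  obtain ⟨l, hl, hD, hs⟩ := exists_maximal D
  exact ⟨_, _, isSplit_of_stack hl hD, fun i => hs _ (l.get_mem i)⟩

theorem sCongruent_of_toTwisted_eq {L L' : VirtualLink} (h : L.toTwisted = L'.toTwisted) :
    L.SCongruent L' := by
  obtain ⟨n, A, hL, hs⟩ := L.exists_isMaximalSplit
  obtain ⟨m, A', hL', hs'⟩ := L'.exists_isMaximalSplit
  obtain ⟨D, E, rfl, hA, h₁, hE⟩ := id hL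
  obtain ⟨D', E', rfl, hA', h₂, hE'⟩ := id hL'
  obtain rfl : A = fun i => (E i).link := funext fun i => (hA i).symm
  obtain rfl : A' = fun i => (E' i).link := funext fun i => (hA' i).symm
  have e := VirtualDiagram.toTwisted_eq_iff.1 h
  -- Both decompositions are maximal, so the surjection argument applies in both directions.
  obtain rfl : n = m := le_antisymm (card_le_card D'.noBar D.noBar e.symm h₂ h₁ hE' hE hs')
    (card_le_card D.noBar D'.noBar e h₁ h₂ hE hE' hs)
  obtain ⟨J, hJ, hJE⟩ := exists_bijective D.noBar D'.noBar e h₁ h₂ hE hE' hs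
  refine ⟨n, _, _, ⟨hL, hs⟩, ⟨hL'.comp (.ofBijective J hJ), fun i => hs' _⟩, fun i => ?_⟩
  rcases hJE i with h | h
  · exact .inl (VirtualDiagram.link_eq_iff.2 h.symm)
  · have : (E i).link = (E' (J i)).link.s := VirtualDiagram.link_eq_iff.2 h
    exact .inr (by rw [this, VirtualLink.s_s]; rfl)

/-- Both links are stacks of their parts, and corresponding parts are twisted equivalent by
`eqv_sWord`. Maximality plays no role in this direction. -/
theorem toTwisted_eq_of_sCongruent {L L' : VirtualLink} (h : L.SCongruent L') :
    L.toTwisted = L'.toTwisted := by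
  obtain ⟨n, A, A', ⟨hA, -⟩, ⟨hA', -⟩, h⟩ := h
  obtain ⟨E, hE, -, rfl⟩ := hA.eq_stack
  obtain ⟨E', hE', -, rfl⟩ := hA'.eq_stack
  rw [VirtualDiagram.toTwisted_eq_iff]
  have := flatten_eqv (R := TwistedRule) (l := List.finRange n) (fun i => (E i).closed)
    (g := fun i => (E' i).word) fun i => ?_
  · simpa [VirtualDiagram.stack, Function.comp_def] using this
  · have := h i
    rw [← hE, ← hE'] at this
    rcases this with h | h
    · exact (VirtualDiagram.link_eq_iff.1 h.symm).twisted
    · have h : (E' i).link = (E i).s.link := h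
      exact (eqv_sWord (E i).closed (E i).noBar).trans (VirtualDiagram.link_eq_iff.1 h.symm).twisted

end

end TwistedLinks

/-- Two virtual links are equivalent as twisted links if and only if they are s-congruent. -/
theorem theorem3 (L L' : TwistedLinks.VirtualLink) :
    L.toTwisted = L'.toTwisted ↔ L.SCongruent L' :=
  ⟨TwistedLinks.sCongruent_of_toTwisted_eq, TwistedLinks.toTwisted_eq_of_sCongruent⟩
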